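/- Let $\mathcal C$ be a $\otimes$-factor braided abelian category, i.e. an abelian, braided monoidal category $(\mathcal C,\otimes,\mathbf 1,\Psi)$ with bi-additive tensor product in which $f\otimes g$ is an epimorphism (resp. a monomorphism) whenever $f$ and $g$ are. Let $\mathcal C^{\mathbb N}$ be the category of $\mathbb N_0$-graded objects of $\mathcal C$ with $(\hat X\otimes\hat Y)_n=\bigoplus_{k+l=n}X_k\otimes Y_l$ and with the braiding equal to $(-1)^{kl}\Psi_{X_k,Y_l}$ on $X_k\otimes Y_l$. Let $X$ be an object of $\mathcal C$. For $1\le a<n$ put $\psi_a=\mathrm{id}_{X^{\otimes (a-1)}}\otimes\Psi_{X,X}\otimes\mathrm{id}_{X^{\otimes (n-a-1)}}$, and for $\sigma\in S_n$ with reduced expression $\sigma=t_{a_1}\cdots t_{a_\ell}$ in the adjacent transpositions $t_a=(a\;a{+}1)$ put $\sigma_{\mathcal C}(X)=\psi_{a_1}\circ\cdots\circ\psi_{a_\ell}$ and $\ell(\sigma)=\ell$. For $n,m\ge 0$ let $$\Big[{n+m\atop n}\Big]=\sum_{\sigma}(-1)^{\ell(\sigma)}\sigma_{\mathcal C}(X),\qquad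 \Big[{n\atop n+m}\Big]=\sum_{\sigma}(-1)^{\ell(\sigma)}\sigma_{\mathcal C}(X),$$ where in the first sum $\sigma$ runs over all $\sigma\in S_{n+m}$ such that $\sigma^{-1}$ is increasing on $\{1,\dots,n\}$ and on $\{n+1,\dots,n+m\}$, and in the second sum over the inverses of these permutations. Let $[n|X]!=\sum_{\sigma\in S_n}(-1)^{\ell(\sigma)}\sigma_{\mathcal C}(X)$ be the braided factorial. Then the graded object $(X^{\otimes n})_{n\ge 0}$ of $\mathcal C^{\mathbb N}$ carries the following two Hopf algebra structures (up to the canonical isomorphisms $X^{\otimes n}\otimes X^{\otimes m}\cong X^{\otimes (n+m)}$). The tensor Hopf algebra $T(X)$ has multiplication components $\mathrm m_{n,m}=\mathrm{id}$ and comultiplication components $\Delta_{n,m}=\big[{n+m\atop n}\big]$. The dual tensor Hopf algebra $\overset{\circ}{T}(X)$ has $\overset{\circ}{\mathrm m}_{n,m}=\big[{n\atop n+m}\big]$ and $\overset{\circ}\Delta_{n,m}=\mathrm{id}$. In both cases the unit and the counit are the identity of $\mathbf 1$ in degree $0$ and zero in positive degrees, and the antipode in degree $n$ is $(-1)^n(-1)^{\binom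 n2}(\sigma^0_n)_{\mathcal C}(X)$, where $\sigma^0_n$ is the order-reversing permutation. The braided antisymmetrizer $\hat A_X:T(X)\to\overset{\circ}{T}(X)$, $(\hat A_X)_n=[n|X]!$, is a morphism of Hopf algebras in $\mathcal C^{\mathbb N}$. Moreover, let $$T(X)\xrightarrow{\ \operatorname{coim}\hat A_X\ }T^\wedge(X)\xrightarrow{\ \operatorname{im}\hat A_X\ }\overset{\circ}{T}(X)$$ be the factorization of $\hat A_X$ through its image (formed degreewise), into an epimorphism followed by a monomorphism. Then there is exactly one Hopf algebra structure on $T^\wedge(X)$ for which $\operatorname{coim}\hat A_X$ and $\operatorname{im}\hat A_X$ are Hopf algebra morphisms; with it $T^\wedge(X)$ is the antisymmetric tensor Hopf algebra of $X$. -/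

import Mathlib

open CategoryTheory MonoidalCategory Limits
open scoped MonObj ComonObj
universe v u

set_option linter.unusedSectionVars false
set_option linter.unusedSimpArgs false

namespace BraidedTensor

section Graded

variable {C : Type u} [Category.{v} C] [Abelian C] [MonoidalCategory C] [MonoidalPreadditive C]

instance curriedTensor_preservesFiniteCoproducts (X : C) :
    PreservesFiniteCoproducts ((curriedTensor C).obj X) := by
  have : ((curriedTensor C).obj X).Additive := inferInstanceAs ((tensorLeft X).Additive)
  infer_instance

instance curriedTensor_flip_preservesFiniteCoproducts (X : C) :
    PreservesFiniteCoproducts ((curriedTensor C).flip.obj X) := by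
  have : ((curriedTensor C).flip.obj X).Additive := inferInstanceAs ((tensorRight X).Additive)
  infer_instance

theorem whiskerLeft_zsmul' (X : C) {Y Z : C} (n : ℤ) (f : Y ⟶ Z) :
    X ◁ (n • f) = n • (X ◁ f) :=
  (tensorLeft X).map_zsmul (f := f) (r := n)

theorem zsmul_whiskerRight' (X : C) {Y Z : C} (n : ℤ) (f : Y ⟶ Z) :
    (n • f) ▷ X = n • (f ▷ X) :=
  (tensorRight X).map_zsmul (f := f) (r := n)

open GradedObject GradedObject.Monoidal

instance graded_hasTensor (X Y : GradedObject ℕ C) : HasTensor X Y := inferInstance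

instance graded_hasGoodTensor₁₂ (X Y Z : GradedObject ℕ C) : HasGoodTensor₁₂Tensor X Y Z :=
  inferInstance

instance graded_hasGoodTensor₂₃ (X Y Z : GradedObject ℕ C) : HasGoodTensorTensor₂₃ X Y Z :=
  inferInstance

noncomputable instance graded_monoidal : MonoidalCategory (GradedObject ℕ C) :=
  GradedObject.monoidalCategory

variable [BraidedCategory C]

theorem sign_mul_self (a : ℕ) : ((-1 : ℤ) ^ a) * ((-1 : ℤ) ^ a) = 1 := by
  rw [← pow_add, ← two_mul, pow_mul]; simp

/-- The braiding whose component `X i ⊗ Y j ⟶ Y j ⊗ X i` is `(-1) ^ (i * j)` times the braiding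
of `C`. -/
noncomputable def signedBraiding (X Y : GradedObject ℕ C) :
    GradedObject.Monoidal.tensorObj X Y ≅ GradedObject.Monoidal.tensorObj Y X where
  hom k := tensorObjDesc (fun i j hij => ((-1 : ℤ) ^ (i * j)) • ((β_ (X i) (Y j)).hom ≫
    ιTensorObj Y X j i k (by rw [add_comm, hij])))
  inv k := tensorObjDesc (fun i j hij => ((-1 : ℤ) ^ (i * j)) • ((β_ (X j) (Y i)).inv ≫
    ιTensorObj X Y j i k (by rw [add_comm, hij])))
  hom_inv_id := by
    ext k i j h
    simp [Preadditive.zsmul_comp, Preadditive.comp_zsmul, smul_smul, mul_comm j i, sign_mul_self]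
  inv_hom_id := by
    ext k i j h
    simp [Preadditive.zsmul_comp, Preadditive.comp_zsmul, smul_smul, mul_comm j i, sign_mul_self]

theorem ι_signedBraiding_hom (X Y : GradedObject ℕ C) (i j k : ℕ) (h : i + j = k) :
    ιTensorObj X Y i j k h ≫ (signedBraiding X Y).hom k =
      ((-1 : ℤ) ^ (i * j)) • ((β_ (X i) (Y j)).hom ≫
        ιTensorObj Y X j i k (by rw [add_comm, h])) := by
  simp [signedBraiding]

theorem ι_signedBraiding_hom_assoc (X Y : GradedObject ℕ C) (i j k : ℕ) (h : i + j = k)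
    {A : C} (g : GradedObject.Monoidal.tensorObj Y X k ⟶ A) :
    ιTensorObj X Y i j k h ≫ (signedBraiding X Y).hom k ≫ g =
      ((-1 : ℤ) ^ (i * j)) • ((β_ (X i) (Y j)).hom ≫
        ιTensorObj Y X j i k (by rw [add_comm, h]) ≫ g) := by
  rw [← Category.assoc, ι_signedBraiding_hom, Preadditive.zsmul_comp, Category.assoc]

theorem ι_braiding_hom (X Y : GradedObject ℕ C) (i j k : ℕ) (h : i + j = k) :
    ιTensorObj X Y i j k h ≫ (GradedObject.Monoidal.braiding X Y).hom k =
      (β_ (X i) (Y j)).hom ≫ ιTensorObj Y X j i k (by rw [add_comm, h]) := by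
  simp [GradedObject.Monoidal.braiding]

theorem ι_signedBraiding_hom' (X Y : GradedObject ℕ C) (i j k : ℕ) (h : i + j = k) :
    ιTensorObj X Y i j k h ≫ (signedBraiding X Y).hom k =
      ((-1 : ℤ) ^ (i * j)) •
        (ιTensorObj X Y i j k h ≫ (GradedObject.Monoidal.braiding X Y).hom k) := by
  rw [ι_signedBraiding_hom, ι_braiding_hom]

variable (X Y Z : GradedObject ℕ C)

theorem ι₃_signedBraiding (i₁ i₂ i₃ k : ℕ) (h : i₁ + i₂ + i₃ = k) :
    ιTensorObj₃ X Y Z i₁ i₂ i₃ k h ≫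
        (signedBraiding X (GradedObject.Monoidal.tensorObj Y Z)).hom k =
      ((-1 : ℤ) ^ (i₁ * (i₂ + i₃))) • (ιTensorObj₃ X Y Z i₁ i₂ i₃ k h ≫
        (GradedObject.Monoidal.braiding X (GradedObject.Monoidal.tensorObj Y Z)).hom k) := by
  rw [ιTensorObj₃_eq X Y Z i₁ i₂ i₃ k h _ rfl, Category.assoc, ι_signedBraiding_hom',
    Preadditive.comp_zsmul, Category.assoc]

theorem ι₃'_signedBraiding (i₁ i₂ i₃ k : ℕ) (h : i₁ + i₂ + i₃ = k) :
    ιTensorObj₃' X Y Z i₁ i₂ i₃ k h ≫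
        (signedBraiding (GradedObject.Monoidal.tensorObj X Y) Z).hom k =
      ((-1 : ℤ) ^ ((i₁ + i₂) * i₃)) • (ιTensorObj₃' X Y Z i₁ i₂ i₃ k h ≫
        (GradedObject.Monoidal.braiding (GradedObject.Monoidal.tensorObj X Y) Z).hom k) := by
  rw [ιTensorObj₃'_eq X Y Z i₁ i₂ i₃ k h _ rfl, Category.assoc, ι_signedBraiding_hom',
    Preadditive.comp_zsmul, Category.assoc]

theorem ι₃'_whiskerRight_braiding (i₁ i₂ i₃ k : ℕ) (h : i₁ + i₂ + i₃ = k) :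
    ιTensorObj₃' X Y Z i₁ i₂ i₃ k h ≫
        GradedObject.Monoidal.whiskerRight (GradedObject.Monoidal.braiding X Y).hom Z k =
      ((β_ (X i₁) (Y i₂)).hom ▷ Z i₃) ≫
        ιTensorObj₃' Y X Z i₂ i₁ i₃ k (by rw [add_comm i₂, h]) := by
  rw [ιTensorObj₃'_eq X Y Z i₁ i₂ i₃ k h _ rfl, Category.assoc, ι_tensorHom,
    ιTensorObj₃'_eq Y X Z i₂ i₁ i₃ k (by rw [add_comm i₂, h]) _ (add_comm _ _),
    categoryOfGradedObjects_id, tensorHom_id, ← comp_whiskerRight_assoc, ι_braiding_hom,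
    comp_whiskerRight_assoc]

theorem ι₃'_whiskerRight_signedBraiding (i₁ i₂ i₃ k : ℕ) (h : i₁ + i₂ + i₃ = k) :
    ιTensorObj₃' X Y Z i₁ i₂ i₃ k h ≫
        GradedObject.Monoidal.whiskerRight (signedBraiding X Y).hom Z k =
      ((-1 : ℤ) ^ (i₁ * i₂)) • (((β_ (X i₁) (Y i₂)).hom ▷ Z i₃) ≫
        ιTensorObj₃' Y X Z i₂ i₁ i₃ k (by rw [add_comm i₂, h])) := by
  rw [ιTensorObj₃'_eq X Y Z i₁ i₂ i₃ k h _ rfl, Category.assoc, ι_tensorHom,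
    ιTensorObj₃'_eq Y X Z i₂ i₁ i₃ k (by rw [add_comm i₂, h]) _ (add_comm _ _),
    categoryOfGradedObjects_id, tensorHom_id, ← comp_whiskerRight_assoc, ι_signedBraiding_hom,
    zsmul_whiskerRight', comp_whiskerRight, Preadditive.zsmul_comp, Category.assoc]

theorem ι₃_whiskerLeft_braiding (i₁ i₂ i₃ k : ℕ) (h : i₁ + i₂ + i₃ = k) :
    ιTensorObj₃ X Y Z i₁ i₂ i₃ k h ≫
        GradedObject.Monoidal.whiskerLeft X (GradedObject.Monoidal.braiding Y Z).hom k =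
      (X i₁ ◁ (β_ (Y i₂) (Z i₃)).hom) ≫
        ιTensorObj₃ X Z Y i₁ i₃ i₂ k (by rw [add_right_comm, h]) := by
  rw [ιTensorObj₃_eq X Y Z i₁ i₂ i₃ k h _ rfl, Category.assoc, ι_tensorHom,
    ιTensorObj₃_eq X Z Y i₁ i₃ i₂ k (by rw [add_right_comm, h]) _ (add_comm _ _),
    categoryOfGradedObjects_id, id_tensorHom, ← whiskerLeft_comp_assoc, ι_braiding_hom,
    whiskerLeft_comp_assoc]

theorem ι₃_whiskerLeft_signedBraiding (i₁ i₂ i₃ k : ℕ) (h : i₁ + i₂ + i₃ = k) :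
    ιTensorObj₃ X Y Z i₁ i₂ i₃ k h ≫
        GradedObject.Monoidal.whiskerLeft X (signedBraiding Y Z).hom k =
      ((-1 : ℤ) ^ (i₂ * i₃)) • ((X i₁ ◁ (β_ (Y i₂) (Z i₃)).hom) ≫
        ιTensorObj₃ X Z Y i₁ i₃ i₂ k (by rw [add_right_comm, h])) := by
  rw [ιTensorObj₃_eq X Y Z i₁ i₂ i₃ k h _ rfl, Category.assoc, ι_tensorHom,
    ιTensorObj₃_eq X Z Y i₁ i₃ i₂ k (by rw [add_right_comm, h]) _ (add_comm _ _),
    categoryOfGradedObjects_id, id_tensorHom, ← whiskerLeft_comp_assoc, ι_signedBraiding_hom,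
    whiskerLeft_zsmul', MonoidalCategory.whiskerLeft_comp, Preadditive.zsmul_comp, Category.assoc]

theorem signedBraiding_hexagon_forward :
    (GradedObject.Monoidal.associator X Y Z).hom ≫ (signedBraiding X (GradedObject.Monoidal.tensorObj Y Z)).hom ≫
        (GradedObject.Monoidal.associator Y Z X).hom =
      GradedObject.Monoidal.whiskerRight (signedBraiding X Y).hom Z ≫
        (GradedObject.Monoidal.associator Y X Z).hom ≫ GradedObject.Monoidal.whiskerLeft Y (signedBraiding X Z).hom := by
  ext k i₁ i₂ i₃ h
  have H0 :
      (GradedObject.Monoidal.associator X Y Z).hom ≫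
        (GradedObject.Monoidal.braiding X (GradedObject.Monoidal.tensorObj Y Z)).hom ≫
        (GradedObject.Monoidal.associator Y Z X).hom =
      GradedObject.Monoidal.whiskerRight (GradedObject.Monoidal.braiding X Y).hom Z ≫
        (GradedObject.Monoidal.associator Y X Z).hom ≫
          GradedObject.Monoidal.whiskerLeft Y (GradedObject.Monoidal.braiding X Z).hom :=
    GradedObject.Monoidal.hexagon_forward X Y Z
  have H := congrFun H0 k
  replace H := congrArg (fun f => ιTensorObj₃' X Y Z i₁ i₂ i₃ k h ≫ f) H
  simp only [categoryOfGradedObjects_comp] at H ⊢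
  rw [ιTensorObj₃'_associator_hom_assoc, ← Category.assoc (ιTensorObj₃' X Y Z i₁ i₂ i₃ k h),
    ι₃'_whiskerRight_braiding, Category.assoc, ιTensorObj₃'_associator_hom_assoc,
    ι₃_whiskerLeft_braiding] at H
  rw [ιTensorObj₃'_associator_hom_assoc, ← Category.assoc (ιTensorObj₃ X Y Z i₁ i₂ i₃ k h),
    ι₃_signedBraiding, ← Category.assoc (ιTensorObj₃' X Y Z i₁ i₂ i₃ k h),
    ι₃'_whiskerRight_signedBraiding, Preadditive.zsmul_comp, Preadditive.zsmul_comp,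
    Category.assoc, Category.assoc, ιTensorObj₃'_associator_hom_assoc,
    ι₃_whiskerLeft_signedBraiding]
  simp only [Preadditive.comp_zsmul, smul_smul, H, mul_add, pow_add]

theorem signedBraiding_hexagon_reverse :
    (GradedObject.Monoidal.associator X Y Z).inv ≫ (signedBraiding (GradedObject.Monoidal.tensorObj X Y) Z).hom ≫
        (GradedObject.Monoidal.associator Z X Y).inv =
      GradedObject.Monoidal.whiskerLeft X (signedBraiding Y Z).hom ≫
        (GradedObject.Monoidal.associator X Z Y).inv ≫
          GradedObject.Monoidal.whiskerRight (signedBraiding X Z).hom Y := by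
  ext k i₁ i₂ i₃ h
  have H := congrFun (GradedObject.Monoidal.hexagon_reverse X Y Z) k
  replace H := congrArg (fun f => ιTensorObj₃ X Y Z i₁ i₂ i₃ k h ≫ f) H
  simp only [categoryOfGradedObjects_comp] at H ⊢
  rw [ιTensorObj₃_associator_inv_assoc, ← Category.assoc (ιTensorObj₃ X Y Z i₁ i₂ i₃ k h),
    ι₃_whiskerLeft_braiding, Category.assoc, ιTensorObj₃_associator_inv_assoc,
    ι₃'_whiskerRight_braiding] at H
  rw [ιTensorObj₃_associator_inv_assoc, ← Category.assoc (ιTensorObj₃' X Y Z i₁ i₂ i₃ k h),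
    ι₃'_signedBraiding, ← Category.assoc (ιTensorObj₃ X Y Z i₁ i₂ i₃ k h),
    ι₃_whiskerLeft_signedBraiding, Preadditive.zsmul_comp, Preadditive.zsmul_comp,
    Category.assoc, Category.assoc, ιTensorObj₃_associator_inv_assoc,
    ι₃'_whiskerRight_signedBraiding]
  simp only [Preadditive.comp_zsmul, smul_smul, H, add_mul, pow_add,
    mul_comm ((-1 : ℤ) ^ (i₂ * i₃))]

theorem signedBraiding_naturality_right {Y Z} (f : Y ⟶ Z) :
    GradedObject.Monoidal.whiskerLeft X f ≫ (signedBraiding X Z).hom =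
      (signedBraiding X Y).hom ≫ GradedObject.Monoidal.whiskerRight f X := by
  ext k i j h
  simp only [categoryOfGradedObjects_comp, ι_tensorHom_assoc, ι_signedBraiding_hom_assoc,
    ι_signedBraiding_hom]
  simp [Preadditive.zsmul_comp, Preadditive.comp_zsmul]

theorem signedBraiding_naturality_left {X Y} (f : X ⟶ Y) :
    GradedObject.Monoidal.whiskerRight f Z ≫ (signedBraiding Y Z).hom =
      (signedBraiding X Z).hom ≫ GradedObject.Monoidal.whiskerLeft Z f := by
  ext k i j h
  simp only [categoryOfGradedObjects_comp, ι_tensorHom_assoc, ι_signedBraiding_hom_assoc,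
    ι_signedBraiding_hom]
  simp [Preadditive.zsmul_comp, Preadditive.comp_zsmul]


end Graded

section NGraded

variable (C : Type u) [Category.{v} C]

/-- The category of `ℕ`-graded objects of `C`. -/
def NGraded : Type u := GradedObject ℕ C

instance : Category (NGraded C) := inferInstanceAs (Category (GradedObject ℕ C))

variable [Abelian C] [MonoidalCategory C] [MonoidalPreadditive C]

/-- The tensor product `(X ⊗ Y)_k = ⨁_{i + j = k} X i ⊗ Y j`. -/
noncomputable instance : MonoidalCategory (NGraded C) :=
  inferInstanceAs (MonoidalCategory (GradedObject ℕ C))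

/-- The braiding `(-1) ^ (i * j) Ψ` on the summand `X i ⊗ Y j`. -/
noncomputable instance [BraidedCategory C] : BraidedCategory (NGraded C) where
  braiding X Y := signedBraiding X Y
  braiding_naturality_left f Z := signedBraiding_naturality_left (C := C) Z f
  braiding_naturality_right X _ _ f := signedBraiding_naturality_right (C := C) X f
  hexagon_forward X Y Z := signedBraiding_hexagon_forward (C := C) X Y Z
  hexagon_reverse X Y Z := signedBraiding_hexagon_reverse (C := C) X Y Z

end NGraded

section Graded

variable {C : Type u} [Category.{v} C] [Abelian C] [MonoidalCategory C] [MonoidalPreadditive C]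

/-- The morphism `A ⟶ (X ⊗ Y)_k = ⨁_{i + j = k} X i ⊗ Y j` with given components. -/
noncomputable def tensorObjLift {X Y : NGraded C} {A : C} {k : ℕ}
    (f : ∀ i j : ℕ, i + j = k → (A ⟶ (X i ⊗ Y j : C))) :
    A ⟶ (X ⊗ Y : NGraded C) k :=
  ∑ p : Finset.HasAntidiagonal.antidiagonal k,
    f p.1.1 p.1.2 (Finset.HasAntidiagonal.mem_antidiagonal.1 p.2) ≫
      GradedObject.Monoidal.ιTensorObj X Y p.1.1 p.1.2 k (Finset.HasAntidiagonal.mem_antidiagonal.1 p.2)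

end Graded

/-- The tensor product of two epimorphisms is an epimorphism and the tensor product of two
monomorphisms is a monomorphism. -/
class TensorFactor (C : Type u) [Category.{v} C] [MonoidalCategory C] : Prop where
  epi_tensorHom : ∀ {X X' Y Y' : C} (f : X ⟶ X') (g : Y ⟶ Y') [Epi f] [Epi g], Epi (f ⊗ₘ g)
  mono_tensorHom : ∀ {X X' Y Y' : C} (f : X ⟶ X') (g : Y ⟶ Y') [Mono f] [Mono g], Mono (f ⊗ₘ g)

/-- Morphisms of Hopf algebras in a braided category: algebra and coalgebra morphisms that
commute with the antipodes. -/
structure IsHopfHom {D : Type u} [Category.{v} D] [MonoidalCategory D] [BraidedCategory D]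
    {A B : D} [HopfObj A] [HopfObj B] (f : A ⟶ B) : Prop where
  isBimonHom : IsBimonHom f
  antipode_comp : HopfObj.antipode (X := A) ≫ f = f ≫ HopfObj.antipode (X := B)

/-! ### Reduced expressions of permutations -/

/-- The transposition of `a` and `a + 1` in the symmetric group of `{0, …, n - 1}`. -/
def adjSwap (n : ℕ) (a : Fin (n - 1)) : Equiv.Perm (Fin n) :=
  Equiv.swap ⟨a, by omega⟩ ⟨a + 1, by omega⟩

/-- `w = [a₁, …, a_l]` is a reduced expression of `σ`: the product `t_{a₁} ⋯ t_{a_l}` is `σ`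
and no shorter product of adjacent transpositions is `σ`. -/
def IsReducedWord {n : ℕ} (σ : Equiv.Perm (Fin n)) (w : List (Fin (n - 1))) : Prop :=
  (w.map (adjSwap n)).prod = σ ∧
    ∀ w' : List (Fin (n - 1)), (w'.map (adjSwap n)).prod = σ → w.length ≤ w'.length

theorem exists_word {n : ℕ} (σ : Equiv.Perm (Fin n)) :
    ∃ w : List (Fin (n - 1)), (w.map (adjSwap n)).prod = σ := by
  cases n with
  | zero => exact ⟨[], Subsingleton.elim _ _⟩
  | succ m =>
    have h : σ ∈ Submonoid.closure
        (Set.range fun i : Fin m => Equiv.swap i.castSucc i.succ) := by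
      rw [Equiv.Perm.mclosure_swap_castSucc_succ]; trivial
    induction h using Submonoid.closure_induction with
    | mem x hx =>
      obtain ⟨i, rfl⟩ := hx
      exact ⟨[i], by simp [adjSwap]; rfl⟩
    | one => exact ⟨[], rfl⟩
    | mul x y _ _ hx hy =>
      obtain ⟨w, rfl⟩ := hx
      obtain ⟨w', rfl⟩ := hy
      exact ⟨w ++ w', by simp⟩

theorem exists_reducedWord {n : ℕ} (σ : Equiv.Perm (Fin n)) :
    ∃ w : List (Fin (n - 1)), IsReducedWord σ w := by
  classical
  have h : ∃ l, ∃ w : List (Fin (n - 1)), (w.map (adjSwap n)).prod = σ ∧ w.length = l := by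
    obtain ⟨w, hw⟩ := exists_word σ
    exact ⟨_, w, hw, rfl⟩
  obtain ⟨w, hw, hl⟩ := Nat.find_spec h
  exact ⟨w, hw, fun w' hw' => hl ▸ Nat.find_min' h ⟨w', hw', rfl⟩⟩

/-- A reduced expression of `σ`. -/
noncomputable def reducedWord {n : ℕ} (σ : Equiv.Perm (Fin n)) : List (Fin (n - 1)) :=
  (exists_reducedWord σ).choose

/-- The length of `σ`. -/
noncomputable def permLength {n : ℕ} (σ : Equiv.Perm (Fin n)) : ℕ := (reducedWord σ).length

/-- `σ⁻¹` preserves the order within each block, where `b i` is the label of the block of `i`.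
For monotone `b` these are the shuffle permutations, which map certain elements onto each
block without changing their order. -/
def IsShuffle {n : ℕ} (b : Fin n → ℕ) (σ : Equiv.Perm (Fin n)) : Prop :=
  ∀ i j : Fin n, b i = b j → i < j → σ⁻¹ i < σ⁻¹ j

/-- The block labels of the partition `n + m` of a set of `n + m` elements. -/
def twoBlocks (n m : ℕ) : Fin (n + m) → ℕ := fun i => if (i : ℕ) < n then 0 else 1

section Tensor

variable {C : Type u} [Category.{v} C] [MonoidalCategory C]

/-- The tensor power `X ^ ⊗ n`. -/
def tpow (X : C) : ℕ → C
  | 0 => 𝟙_ C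
  | n + 1 => tpow X n ⊗ X

/-- The canonical isomorphism `X ^ ⊗ n ⊗ X ^ ⊗ m ≅ X ^ ⊗ (n + m)`. -/
def tpowAdd (X : C) (n : ℕ) : (m : ℕ) → (tpow X n ⊗ tpow X m ≅ tpow X (n + m))
  | 0 => ρ_ (tpow X n)
  | m + 1 => (α_ (tpow X n) (tpow X m) X).symm ≪≫ whiskerRightIso (tpowAdd X n m) X

/-- `id ⊗ Ψ ⊗ id` on `X ^ ⊗ n`, with `Ψ` the braiding of `X ⊗ X` acting on the
tensor factors `a` and `a + 1` (counted from `0`, `a + 1 < n`). -/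
def adjBraid [BraidedCategory C] (X : C) : (n a : ℕ) → (tpow X n ⟶ tpow X n)
  | 0, _ => 𝟙 _
  | 1, _ => 𝟙 _
  | n + 2, a =>
    if a = n then
      (α_ (tpow X n) X X).hom ≫ tpow X n ◁ (β_ X X).hom ≫ (α_ (tpow X n) X X).inv
    else adjBraid X (n + 1) a ▷ X

/-- The composite `ψ_{a₁} ∘ ⋯ ∘ ψ_{a_l}` for `w = [a₁, …, a_l]`. -/
def wordBraid [BraidedCategory C] (X : C) (n : ℕ) :
    List (Fin (n - 1)) → (tpow X n ⟶ tpow X n)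
  | [] => 𝟙 _
  | a :: w => wordBraid X n w ≫ adjBraid X n a

/-- The action of a permutation on `X ^ ⊗ n` through a reduced expression. (By the braid
relations the result does not depend on the reduced expression.) -/
noncomputable def permBraid [BraidedCategory C] (X : C) {n : ℕ} (σ : Equiv.Perm (Fin n)) :
    tpow X n ⟶ tpow X n :=
  wordBraid X n (reducedWord σ)

variable [Preadditive C] [BraidedCategory C]

open Classical in
/-- The braided multinomial `[n over π | X]` of the partition `π` with block labels `b`: the
alternating sum over the shuffle permutations. -/
noncomputable def multinomial (X : C) {n : ℕ} (b : Fin n → ℕ) : tpow X n ⟶ tpow X n :=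
  ∑ σ : Equiv.Perm (Fin n) with IsShuffle b σ, ((-1 : ℤ) ^ permLength σ) • permBraid X σ

open Classical in
/-- The dual braided multinomial `[π over n | X]`: the alternating sum over the inverses of the
shuffle permutations. -/
noncomputable def dualMultinomial (X : C) {n : ℕ} (b : Fin n → ℕ) : tpow X n ⟶ tpow X n :=
  ∑ σ : Equiv.Perm (Fin n) with IsShuffle b σ⁻¹, ((-1 : ℤ) ^ permLength σ) • permBraid X σ

/-- The braided factorial `[n | X]!`, the braided multinomial of the partition into blocks of
size one. -/
noncomputable def braidedFactorial (X : C) (n : ℕ) : tpow X n ⟶ tpow X n :=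
  multinomial X (n := n) (fun i => (i : ℕ))

/-- `(-1) ^ n (-1) ^ (n choose 2)` times the action of the order reversing permutation. -/
noncomputable def antipodeComponent (X : C) (n : ℕ) : tpow X n ⟶ tpow X n :=
  ((-1 : ℤ) ^ (n + n.choose 2)) • permBraid X (Fin.revPerm : Equiv.Perm (Fin n))

end Tensor

section TensorHopf

variable {C : Type u} [Category.{v} C] [Abelian C] [MonoidalCategory C] [MonoidalPreadditive C]

/-- The graded object with components `X ^ ⊗ n`, which carries the tensor Hopf algebra `T(X)`. -/
def tensorAlg (X : C) : NGraded C := fun n => tpow X n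

/-- The same graded object, which carries the dual tensor Hopf algebra. -/
def dualTensorAlg (X : C) : NGraded C := fun n => tpow X n

/-- The morphism `𝟙 ⟶ (X ^ ⊗ n)_n` that is the identity in degree `0`. -/
noncomputable def unitHom (X : C) : ∀ n, (𝟙_ (NGraded C) : NGraded C) n ⟶ tpow X n
  | 0 => (GradedObject.Monoidal.tensorUnit₀ (I := ℕ) (C := C)).hom
  | _ + 1 => 0

/-- The morphism `(X ^ ⊗ n)_n ⟶ 𝟙` that is the identity in degree `0`. -/
noncomputable def counitHom (X : C) : ∀ n, tpow X n ⟶ (𝟙_ (NGraded C) : NGraded C) n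
  | 0 => (GradedObject.Monoidal.tensorUnit₀ (I := ℕ) (C := C)).inv
  | _ + 1 => 0

variable [BraidedCategory C]

/-- Multiplication of `T(X)`: the components are the canonical isomorphisms. -/
noncomputable def mulT (X : C) : tensorAlg X ⊗ tensorAlg X ⟶ tensorAlg X := fun _ =>
  GradedObject.Monoidal.tensorObjDesc (X₁ := tensorAlg X) (X₂ := tensorAlg X) fun n m h =>
    (tpowAdd X n m).hom ≫ eqToHom (congrArg (tpow X) h)

/-- Comultiplication of `T(X)`: the components are the braided binomials. -/
noncomputable def comulT (X : C) : tensorAlg X ⟶ tensorAlg X ⊗ tensorAlg X := fun _ =>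
  tensorObjLift (X := tensorAlg X) (Y := tensorAlg X) fun n m h =>
    eqToHom (congrArg (tpow X) h.symm) ≫ multinomial X (twoBlocks n m) ≫ (tpowAdd X n m).inv

/-- Multiplication of the dual tensor algebra: the components are the dual braided binomials. -/
noncomputable def mulTDual (X : C) : dualTensorAlg X ⊗ dualTensorAlg X ⟶ dualTensorAlg X := fun _ =>
  GradedObject.Monoidal.tensorObjDesc (X₁ := dualTensorAlg X) (X₂ := dualTensorAlg X) fun n m h =>
    (tpowAdd X n m).hom ≫ dualMultinomial X (twoBlocks n m) ≫ eqToHom (congrArg (tpow X) h)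

/-- Comultiplication of the dual tensor algebra: the components are the canonical isomorphisms. -/
noncomputable def comulTDual (X : C) : dualTensorAlg X ⟶ dualTensorAlg X ⊗ dualTensorAlg X := fun _ =>
  tensorObjLift (X := dualTensorAlg X) (Y := dualTensorAlg X) fun n m h =>
    eqToHom (congrArg (tpow X) h.symm) ≫ (tpowAdd X n m).inv

/-- A Hopf algebra structure on `tensorAlg X` is the one of the tensor Hopf algebra. -/
structure IsTensorHopf (X : C) (h : HopfObj (tensorAlg X)) : Prop where
  mul_eq : μ[tensorAlg X] = mulT X
  one_eq : η[tensorAlg X] = (fun n => unitHom X n : 𝟙_ (NGraded C) ⟶ tensorAlg X)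
  comul_eq : Δ[tensorAlg X] = comulT X
  counit_eq : ε[tensorAlg X] = (fun n => counitHom X n : tensorAlg X ⟶ 𝟙_ (NGraded C))
  antipode_eq : HopfObj.antipode (X := tensorAlg X) = (fun n => antipodeComponent X n : tensorAlg X ⟶ tensorAlg X)

/-- A Hopf algebra structure on `dualTensorAlg X` is the one of the dual tensor Hopf algebra. -/
structure IsDualTensorHopf (X : C) (h : HopfObj (dualTensorAlg X)) : Prop where
  mul_eq : μ[dualTensorAlg X] = mulTDual X
  one_eq : η[dualTensorAlg X] = (fun n => unitHom X n : 𝟙_ (NGraded C) ⟶ dualTensorAlg X)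
  comul_eq : Δ[dualTensorAlg X] = comulTDual X
  counit_eq : ε[dualTensorAlg X] = (fun n => counitHom X n : dualTensorAlg X ⟶ 𝟙_ (NGraded C))
  antipode_eq :
    HopfObj.antipode (X := dualTensorAlg X) = (fun n => antipodeComponent X n : dualTensorAlg X ⟶ dualTensorAlg X)

/-- The antisymmetrizer. -/
noncomputable def antisymmetrizer (X : C) : tensorAlg X ⟶ dualTensorAlg X := fun n => braidedFactorial X n

/-- The image of the antisymmetrizer (computed degreewise). -/
noncomputable def antisymTensorAlg (X : C) : NGraded C := fun n => Abelian.image (braidedFactorial X n)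

/-- The epimorphism onto the image of the antisymmetrizer. -/
noncomputable def coimA (X : C) : tensorAlg X ⟶ antisymTensorAlg X := fun n =>
  Abelian.factorThruImage (braidedFactorial X n)

/-- The inclusion of the image of the antisymmetrizer. -/
noncomputable def imA (X : C) : antisymTensorAlg X ⟶ dualTensorAlg X := fun n =>
  Abelian.image.ι (braidedFactorial X n)

end TensorHopf

end BraidedTensor

/-!
All structure morphisms of `T(X)` and of its dual act, in each degree, through operators on
`X ^ ⊗ n` that are polynomials in the operators `-ψ_a`. These operators are called `gen`; they
satisfy the braid relations (`isBraidSeq_gen`), and the Hopf algebra axioms become identities in a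
ring with a sequence of elements that satisfies these relations (`IsBraidSeq`). As the sign is part
of the generators, no signs of permutations occur in the identities.

*Sums over permutations.* A permutation of `n + 1` elements amounts to the image `p` of the last
element and a permutation of the others (`insPerm`). The corresponding recursion defines an element
`insLift` for every permutation, which equals the product of the generators along any reduced word
(`prod_reducedWord`). Hence sums over shuffles can be computed by recursion on the number of strands:
the binomials become elements `braidBinom` with a recursion of Pascal's type
(`shuffleSum_twoBlocks`), the factorial becomes `braidFact` (`shuffleSum_of_injective`), and the
order reversing permutation becomes the half twist `halfTwist` (`insLift_revPerm`).

*The tensor Hopf algebra.* Coassociativity says that splitting into three blocks does not depend on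
the order of the splittings (`IsBraidSeq.braidBinom_mul_braidBinom`). The compatibility of
multiplication and comultiplication is a braided Vandermonde identity (`IsBraidSeq.braidBinom_add`),
because the signed braiding of `X ^ ⊗ n` and `X ^ ⊗ m` is the exchange `blockSwap` of two blocks of
strands (`braiding_tadd`, `tensorμ_tadd`). The antipode axioms say that the alternating sums of half
twists times binomials vanish (`IsBraidSeq.sum_halfTwist_mul_braidBinom` and its right-hand version).

*The dual tensor Hopf algebra.* Inverting a permutation reverses the product along its reduced words,
so the dual binomials are the binomials of the opposite ring. The opposite of a braid sequence is a
braid sequence (`IsBraidSeq.op`), and the axioms are the same identities in the opposite ring. Block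
exchanges swap the sizes of their blocks under this reversal (`IsBraidSeq.unop_blockSwap`), half
twists and factorials are invariant (`unop_halfTwist`, `unop_braidFact`).

*The antisymmetrizer.* The factorial of all strands is a binomial followed by the factorials of the
two blocks (`IsBraidSeq.braidFact_mul_braidBinom`); this identity and its reversal say that the
factorials commute with comultiplication and multiplication. A morphism of bialgebras between Hopf
algebras commutes with the antipodes.

*The image.* Tensor products preserve epimorphisms and monomorphisms, hence so does the tensor
product of graded objects, in each degree. The structure morphisms of the image are therefore
diagonal fillers of squares with an epimorphism on one side and a monomorphism on the other
(`exists_lift`). The laws of an algebra hold in the image because it is a subobject of the dual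
tensor algebra, those of a coalgebra because it is a quotient of the tensor algebra
(`exists_hopfObj_image`), and the structure is unique because the projections from `T(X)` and from
`T(X) ⊗ T(X)` are epimorphisms (`hopfObj_eq_of_epi`).
-/

/-! ### Braided integers in a ring with a braid sequence -/

namespace BraidedTensor

/-- A sequence of elements that satisfies the relations of the generators of the braid groups. -/
structure IsBraidSeq {R : Type*} [Ring R] (φ : ℕ → R) : Prop where
  braid : ∀ a, φ a * φ (a + 1) * φ a = φ (a + 1) * φ a * φ (a + 1)
  comm : ∀ a b, a + 2 ≤ b → Commute (φ a) (φ b)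

section Ring

variable {R : Type*} [Ring R] (φ : ℕ → R)

/-- The product `φ s ⋯ φ (s + m - 1)`, the braid that moves strand `s + m` to position `s`
across the `m` strands in between. -/
def cyc (s : ℕ) : ℕ → R
  | 0 => 1
  | m + 1 => cyc s m * φ (s + m)

/-- The binomial of `n` strands starting at position `s`, with `k` strands in the first block,
by a recursion of Pascal's type: the last strand ends up last in the second or in the first
block. -/
def braidBinom (s : ℕ) : ℕ → ℕ → R
  | _, 0 => 1
  | 0, _ + 1 => 0
  | n + 1, k + 1 => braidBinom s n (k + 1) + cyc φ (s + k) (n - k) * braidBinom s n k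

/-- The factorial of `n` strands starting at position `s`. -/
def braidFact (s : ℕ) : ℕ → R
  | 0 => 1
  | n + 1 => (∑ k ∈ Finset.range (n + 1), cyc φ (s + k) (n - k)) * braidFact s n

/-- The half twist of `n` strands starting at position `s`. -/
def halfTwist (s : ℕ) : ℕ → R
  | 0 => 1
  | n + 1 => cyc φ s n * halfTwist s n

/-- The braid that exchanges a block of `b` strands starting at position `s` with the following
`c` strands. -/
def blockSwap (s b : ℕ) : ℕ → R
  | 0 => 1
  | c + 1 => cyc φ (s + c) b * blockSwap s b c

@[simp] theorem cyc_zero (s : ℕ) : cyc φ s 0 = 1 := rfl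

theorem cyc_succ (s m : ℕ) : cyc φ s (m + 1) = cyc φ s m * φ (s + m) := rfl

theorem cyc_add (s m n : ℕ) : cyc φ s (m + n) = cyc φ s m * cyc φ (s + m) n := by
  induction n with
  | zero => simp
  | succ n ih => rw [← add_assoc, cyc_succ, ih, cyc_succ, mul_assoc, add_assoc]

theorem cyc_succ' (s m : ℕ) : cyc φ s (m + 1) = φ s * cyc φ (s + 1) m := by
  rw [add_comm m 1, cyc_add]; simp [cyc_succ]

@[simp] theorem braidBinom_zero_right (s n : ℕ) : braidBinom φ s n 0 = 1 := by
  cases n <;> rfl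

@[simp] theorem braidBinom_zero_succ (s k : ℕ) : braidBinom φ s 0 (k + 1) = 0 := rfl

theorem braidBinom_succ_succ (s n k : ℕ) :
    braidBinom φ s (n + 1) (k + 1) =
      braidBinom φ s n (k + 1) + cyc φ (s + k) (n - k) * braidBinom φ s n k := rfl

theorem braidBinom_eq_zero (s n k : ℕ) (h : n < k) : braidBinom φ s n k = 0 := by
  induction n generalizing k with
  | zero => obtain ⟨k, rfl⟩ := Nat.exists_eq_succ_of_ne_zero h.ne'; rfl
  | succ n ih =>
    obtain ⟨k, rfl⟩ := Nat.exists_eq_succ_of_ne_zero (by omega : k ≠ 0)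
    rw [Nat.succ_eq_add_one, braidBinom_succ_succ, ih _ (by omega), ih _ (by omega)]; simp

@[simp] theorem braidBinom_self (s n : ℕ) : braidBinom φ s n n = 1 := by
  induction n with
  | zero => rfl
  | succ n ih => rw [braidBinom_succ_succ, braidBinom_eq_zero φ s n _ (by omega), ih]; simp

@[simp] theorem braidFact_zero (s : ℕ) : braidFact φ s 0 = 1 := rfl

theorem braidFact_succ (s n : ℕ) : braidFact φ s (n + 1) =
    (∑ k ∈ Finset.range (n + 1), cyc φ (s + k) (n - k)) * braidFact φ s n := rfl

@[simp] theorem halfTwist_zero (s : ℕ) : halfTwist φ s 0 = 1 := rfl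

theorem halfTwist_succ (s n : ℕ) : halfTwist φ s (n + 1) = cyc φ s n * halfTwist φ s n := rfl

@[simp] theorem blockSwap_zero (s b : ℕ) : blockSwap φ s b 0 = 1 := rfl

theorem blockSwap_succ (s b c : ℕ) :
    blockSwap φ s b (c + 1) = cyc φ (s + c) b * blockSwap φ s b c := rfl

/-! The elements above are polynomials in the `φ i`. So a subring of a product that contains the
pairs of corresponding generators contains the pairs of elements that are built from them; this
covers commutation relations and images under ring homomorphisms at the same time. -/

section Pair

variable {S : Type*} [Ring S] {ψ : ℕ → S} {φ} (T : Subring (R × S)) {s t : ℕ}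

theorem cyc_pair {m : ℕ} (h : ∀ i < m, (φ (s + i), ψ (t + i)) ∈ T) :
    (cyc φ s m, cyc ψ t m) ∈ T := by
  induction m with
  | zero => exact T.one_mem
  | succ m ih => exact T.mul_mem (ih fun i hi => h i (by omega)) (h m (by omega))

theorem cyc_pair' {n j m : ℕ} (h : ∀ i, i + 1 < n → (φ (s + i), ψ (t + i)) ∈ T)
    (hm : j + m < n) : (cyc φ (s + j) m, cyc ψ (t + j) m) ∈ T :=
  cyc_pair T fun i hi => by simpa only [add_assoc] using h (j + i) (by omega)

theorem braidBinom_pair {n k : ℕ} (h : ∀ i, i + 1 < n → (φ (s + i), ψ (t + i)) ∈ T) :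
    (braidBinom φ s n k, braidBinom ψ t n k) ∈ T := by
  induction n generalizing k with
  | zero => cases k; exacts [T.one_mem, T.zero_mem]
  | succ n ih =>
    cases k with
    | zero => exact T.one_mem
    | succ k =>
      have ih' := fun k => @ih k fun i hi => h i (by omega)
      refine T.add_mem (x := (_, _)) (y := (_, _)) (ih' _) ?_
      by_cases hk : k ≤ n
      · exact T.mul_mem (cyc_pair' T h (by omega)) (ih' _)
      · rw [braidBinom_eq_zero φ _ _ _ (by omega), braidBinom_eq_zero ψ _ _ _ (by omega),
          mul_zero, mul_zero]
        exact T.zero_mem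

theorem braidFact_pair {n : ℕ} (h : ∀ i, i + 1 < n → (φ (s + i), ψ (t + i)) ∈ T) :
    (braidFact φ s n, braidFact ψ t n) ∈ T := by
  induction n with
  | zero => exact T.one_mem
  | succ n ih =>
    rw [braidFact_succ, braidFact_succ, ← Prod.mk_mul_mk]
    refine T.mul_mem ?_ (ih fun i hi => h i (by omega))
    have : (∑ k ∈ Finset.range (n + 1), (cyc φ (s + k) (n - k), cyc ψ (t + k) (n - k))) ∈ T :=
      T.sum_mem fun k hk => cyc_pair' T h (by rw [Finset.mem_range] at hk; omega)
    convert this using 1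
    exact Prod.ext (by rw [Prod.fst_sum]) (by rw [Prod.snd_sum])

theorem halfTwist_pair {n : ℕ} (h : ∀ i, i + 1 < n → (φ (s + i), ψ (t + i)) ∈ T) :
    (halfTwist φ s n, halfTwist ψ t n) ∈ T := by
  induction n with
  | zero => exact T.one_mem
  | succ n ih =>
    exact T.mul_mem (x := (_, _)) (y := (_, _)) (cyc_pair T fun i hi => h i (by omega))
      (ih fun i hi => h i (by omega))

theorem blockSwap_pair {b c : ℕ} (h : ∀ i, i + 1 < b + c → (φ (s + i), ψ (t + i)) ∈ T) :
    (blockSwap φ s b c, blockSwap ψ t b c) ∈ T := by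
  induction c with
  | zero => exact T.one_mem
  | succ c ih =>
    exact T.mul_mem (x := (_, _)) (y := (_, _)) (cyc_pair' T h (by omega))
      (ih fun i hi => h i (by omega))

end Pair

/-- The pairs `(y, z)` with `x * y = z * x`. -/
def semiconjSubring (x : R) : Subring (R × R) where
  carrier := {p | SemiconjBy x p.1 p.2}
  mul_mem' h h' := h.mul_right h'
  one_mem' := SemiconjBy.one_right x
  add_mem' h h' := h.add_right h'
  zero_mem' := SemiconjBy.zero_right x
  neg_mem' h := h.neg_right

variable {φ}

theorem IsBraidSeq.comm' (hφ : IsBraidSeq φ) {a b : ℕ} (h : a + 2 ≤ b ∨ b + 2 ≤ a) :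
    Commute (φ a) (φ b) :=
  h.elim (hφ.comm a b) fun h => (hφ.comm b a h).symm

theorem commute_cyc {x : R} {s m : ℕ} (h : ∀ i < m, Commute x (φ (s + i))) :
    Commute x (cyc φ s m) :=
  cyc_pair (semiconjSubring x) h

theorem commute_braidBinom {x : R} {s n k : ℕ} (h : ∀ i, i + 1 < n → Commute x (φ (s + i))) :
    Commute x (braidBinom φ s n k) :=
  braidBinom_pair (semiconjSubring x) h

theorem commute_braidFact {x : R} {s n : ℕ} (h : ∀ i, i + 1 < n → Commute x (φ (s + i))) :
    Commute x (braidFact φ s n) :=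
  braidFact_pair (semiconjSubring x) h

theorem commute_halfTwist {x : R} {s n : ℕ} (h : ∀ i, i + 1 < n → Commute x (φ (s + i))) :
    Commute x (halfTwist φ s n) :=
  halfTwist_pair (semiconjSubring x) h

theorem commute_blockSwap {x : R} {s b c : ℕ}
    (h : ∀ i, i + 1 < b + c → Commute x (φ (s + i))) :
    Commute x (blockSwap φ s b c) :=
  blockSwap_pair (semiconjSubring x) h

theorem IsBraidSeq.gen_commute_cyc (hφ : IsBraidSeq φ) {a s m : ℕ}
    (h : a + 2 ≤ s ∨ s + m < a) : Commute (φ a) (cyc φ s m) :=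
  commute_cyc fun _ _ => hφ.comm' (by omega)

theorem IsBraidSeq.cyc_commute_braidBinom (hφ : IsBraidSeq φ) {s m t n k : ℕ}
    (h : s + m < t ∨ t + n ≤ s) : Commute (cyc φ s m) (braidBinom φ t n k) :=
  commute_braidBinom fun _ _ => (hφ.gen_commute_cyc (by omega)).symm

theorem IsBraidSeq.cyc_commute_braidFact (hφ : IsBraidSeq φ) {s m t n : ℕ}
    (h : s + m < t ∨ t + n ≤ s) : Commute (cyc φ s m) (braidFact φ t n) :=
  commute_braidFact fun _ _ => (hφ.gen_commute_cyc (by omega)).symm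

theorem IsBraidSeq.cyc_commute_halfTwist (hφ : IsBraidSeq φ) {s m t n : ℕ}
    (h : s + m < t ∨ t + n ≤ s) : Commute (cyc φ s m) (halfTwist φ t n) :=
  commute_halfTwist fun _ _ => (hφ.gen_commute_cyc (by omega)).symm

theorem IsBraidSeq.cyc_commute_blockSwap (hφ : IsBraidSeq φ) {s m t b c : ℕ}
    (h : s + m < t ∨ t + (b + c) ≤ s) : Commute (cyc φ s m) (blockSwap φ t b c) :=
  commute_blockSwap fun _ _ => (hφ.gen_commute_cyc (by omega)).symm

/-- Pulling a strand across a generator shifts the generator by one position. -/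
theorem IsBraidSeq.cyc_semiconj (hφ : IsBraidSeq φ) {a s m : ℕ} (h : s ≤ a) (h' : a + 1 < s + m) :
    SemiconjBy (cyc φ s m) (φ a) (φ (a + 1)) := by
  obtain ⟨i, rfl⟩ := Nat.exists_eq_add_of_le h
  obtain ⟨r, rfl⟩ := Nat.exists_eq_add_of_le (show i + 2 ≤ m by omega)
  rw [cyc_add, cyc_add]
  refine SemiconjBy.mul_left (SemiconjBy.mul_left (y := φ (s + i + 1)) ?_ ?_) (y := φ (s + i)) ?_
  · exact (hφ.gen_commute_cyc (by omega)).symm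
  · have := hφ.braid (s + i)
    simp only [cyc, SemiconjBy, add_zero, one_mul, ← add_assoc]
    rw [this, mul_assoc]
  · exact (hφ.gen_commute_cyc (by omega)).symm

theorem IsBraidSeq.cyc_semiconj_braidBinom (hφ : IsBraidSeq φ) {s m n k : ℕ} (h : n ≤ m) :
    SemiconjBy (cyc φ s m) (braidBinom φ s n k) (braidBinom φ (s + 1) n k) :=
  braidBinom_pair (semiconjSubring (cyc φ s m)) fun i _ => by
    rw [add_right_comm]; exact hφ.cyc_semiconj (by omega) (by omega)

theorem IsBraidSeq.cyc_semiconj_braidFact (hφ : IsBraidSeq φ) {s m n : ℕ} (h : n ≤ m) :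
    SemiconjBy (cyc φ s m) (braidFact φ s n) (braidFact φ (s + 1) n) :=
  braidFact_pair (semiconjSubring (cyc φ s m)) fun i _ => by
    rw [add_right_comm]; exact hφ.cyc_semiconj (by omega) (by omega)

theorem IsBraidSeq.cyc_semiconj_halfTwist (hφ : IsBraidSeq φ) {s m n : ℕ} (h : n ≤ m) :
    SemiconjBy (cyc φ s m) (halfTwist φ s n) (halfTwist φ (s + 1) n) :=
  halfTwist_pair (semiconjSubring (cyc φ s m)) fun i _ => by
    rw [add_right_comm]; exact hφ.cyc_semiconj (by omega) (by omega)

/-- Splitting into three blocks does not depend on which two neighbouring blocks are split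
last. -/
theorem IsBraidSeq.braidBinom_mul_braidBinom (hφ : IsBraidSeq φ) (s N i m : ℕ) :
    braidBinom φ s (i + m) i * braidBinom φ s N (i + m) =
      braidBinom φ (s + i) (N - i) m * braidBinom φ s N i := by
  induction N generalizing i m with
  | zero =>
    rcases i with _ | i
    · simp
    · rw [braidBinom_eq_zero φ s 0 (i + 1 + m) (by omega)]; simp
  | succ N ih =>
    rcases i with _ | i
    · simp
    rcases m with _ | m
    · simp
    rcases lt_or_ge N i with hN | hN
    · rw [braidBinom_eq_zero φ s (N + 1) (i + 1 + (m + 1)) (by omega),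
        braidBinom_eq_zero φ s (N + 1) (i + 1) (by omega), mul_zero, mul_zero]
    rcases lt_or_ge N (i + m + 1) with hN' | hN'
    · rw [braidBinom_eq_zero φ s (N + 1) (i + 1 + (m + 1)) (by omega),
        braidBinom_eq_zero φ (s + (i + 1)) (N + 1 - (i + 1)) (m + 1) (by omega), mul_zero,
        zero_mul]
    obtain ⟨r, rfl⟩ := Nat.exists_eq_add_of_le hN'
    -- In the main case the last strand ends up in one of the three blocks.
    have h1 := ih (i + 1) (m + 1)
    have h2 := ih (i + 1) m
    have h3 := ih i (m + 1)
    rw [show i + m + 1 + r - (i + 1) = m + r by omega] at h1 h2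
    rw [show i + m + 1 + r - i = m + r + 1 by omega] at h3
    rw [show i + 1 + (m + 1) = i + m + 1 + 1 by omega] at h1 ⊢
    rw [show i + 1 + m = i + m + 1 by omega] at h2
    rw [show i + (m + 1) = i + m + 1 by omega] at h3
    rw [show i + m + 1 + r + 1 - (i + 1) = m + r + 1 by omega]
    rw [braidBinom_succ_succ φ s (i + m + 1 + r) (i + m + 1),
      braidBinom_succ_succ φ s (i + m + 1 + r) i, mul_add, mul_add, h1]
    rw [show i + m + 1 + r - (i + m + 1) = r by omega, show i + m + 1 + r - i = m + 1 + r by omega]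
    -- The strand that moves to the third, the second and the first block, in this order.
    have e1 : braidBinom φ s (i + m + 1 + 1) (i + 1) *
        (cyc φ (s + (i + m + 1)) r * braidBinom φ s (i + m + 1 + r) (i + m + 1)) =
        cyc φ (s + (i + m + 1)) r * (braidBinom φ (s + (i + 1)) (m + r) m *
          braidBinom φ s (i + m + 1 + r) (i + 1)) +
        cyc φ (s + i) (m + 1 + r) * (braidBinom φ (s + i) (m + r + 1) (m + 1) *
          braidBinom φ s (i + m + 1 + r) i) := by
      rw [← h2, ← h3, braidBinom_succ_succ, add_mul, show i + m + 1 - i = m + 1 by omega]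
      congr 1
      · rw [← mul_assoc, ← mul_assoc, (hφ.cyc_commute_braidBinom (Or.inr (by omega))).eq]
      · rw [cyc_add φ (s + i) (m + 1) r, mul_assoc, mul_assoc,
          ← mul_assoc (braidBinom φ s (i + m + 1) i),
          ← (hφ.cyc_commute_braidBinom (Or.inr (by omega))).eq, show s + i + (m + 1) =
            s + (i + m + 1) by omega]
        simp only [mul_assoc]
    have e2 : braidBinom φ (s + (i + 1)) (m + r + 1) (m + 1) *
        (cyc φ (s + i) (m + 1 + r) * braidBinom φ s (i + m + 1 + r) i) =
        cyc φ (s + i) (m + 1 + r) * (braidBinom φ (s + i) (m + r + 1) (m + 1) *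
          braidBinom φ s (i + m + 1 + r) i) := by
      rw [← mul_assoc, ← mul_assoc, (hφ.cyc_semiconj_braidBinom (by omega)).eq]; rfl
    rw [e1, e2, braidBinom_succ_succ φ (s + (i + 1)) (m + r) m, add_mul, ← add_assoc,
      show m + r - m = r by omega, show s + (i + 1) + m = s + (i + m + 1) by omega, mul_assoc]

/-- The braided Vandermonde identity: splitting two consecutive groups of `p` and of `q` strands
separately and exchanging the two inner blocks splits all `p + q` strands. -/
theorem IsBraidSeq.braidBinom_add (hφ : IsBraidSeq φ) (s p q k : ℕ) :
    braidBinom φ s (p + q) k = ∑ x ∈ Finset.HasAntidiagonal.antidiagonal k,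
      blockSwap φ (s + x.1) (p - x.1) x.2 *
        (braidBinom φ s p x.1 * braidBinom φ (s + p) q x.2) := by
  induction q generalizing k with
  | zero =>
    rw [Finset.sum_eq_single (k, 0)]
    · simp
    · rintro ⟨a, c⟩ hx hne
      rw [Finset.HasAntidiagonal.mem_antidiagonal] at hx
      rcases c with _ | c
      · exact absurd (by simpa using hx) hne
      · simp
    · simp
  | succ q ih =>
    rcases k with _ | k
    · simp
    rw [← add_assoc, braidBinom_succ_succ, ih, ih, Finset.Nat.sum_antidiagonal_succ',
      Finset.Nat.sum_antidiagonal_succ', Finset.mul_sum, add_assoc, braidBinom_zero_right,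
      braidBinom_zero_right]
    congr 1
    rw [← Finset.sum_add_distrib]
    refine Finset.sum_congr rfl fun ⟨a, c⟩ hx => ?_
    rw [Finset.HasAntidiagonal.mem_antidiagonal] at hx
    subst hx
    dsimp only
    rw [braidBinom_succ_succ, mul_add, mul_add]
    congr 1
    rcases lt_or_ge p a with hp | hp
    · simp [braidBinom_eq_zero φ s p a hp]
    rcases lt_or_ge q c with hq | hq
    · simp [braidBinom_eq_zero φ (s + p) q c hq]
    obtain ⟨b, rfl⟩ := Nat.exists_eq_add_of_le hp
    obtain ⟨d, rfl⟩ := Nat.exists_eq_add_of_le hq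
    rw [show a + b + (c + d) - (a + c) = b + d by omega, Nat.add_sub_cancel_left,
      Nat.add_sub_cancel_left, cyc_add, blockSwap_succ,
      show s + (a + c) + b = s + (a + b) + c by omega, add_assoc s a c]
    have h1 : Commute (cyc φ (s + (a + b) + c) d) (blockSwap φ (s + a) b c) :=
      hφ.cyc_commute_blockSwap (Or.inr (by omega))
    have h2 : Commute (cyc φ (s + (a + b) + c) d) (braidBinom φ s (a + b) a) :=
      hφ.cyc_commute_braidBinom (Or.inr (by omega))
    simp only [mul_assoc]
    rw [← mul_assoc (cyc φ (s + (a + b) + c) d), h1.eq, mul_assoc, ← mul_assoc (cyc _ _ d), h2.eq]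
    simp only [mul_assoc]

/-- The braided Vandermonde identity as a sum over the splittings of `p` and of `q` instead of those
of `k`: the summands that differ contain a binomial that vanishes. -/
theorem IsBraidSeq.braidBinom_add' (hφ : IsBraidSeq φ) (s p q k : ℕ) :
    braidBinom φ s (p + q) k = ∑ x ∈ Finset.HasAntidiagonal.antidiagonal p,
      ∑ y ∈ Finset.HasAntidiagonal.antidiagonal q, if x.1 + y.1 = k then
        blockSwap φ (s + x.1) x.2 y.1 *
          (braidBinom φ s p x.1 * braidBinom φ (s + p) q y.1) else 0 := by
  rw [hφ.braidBinom_add, Finset.Nat.sum_antidiagonal_eq_sum_range_succ_mk]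
  simp only [Finset.Nat.sum_antidiagonal_eq_sum_range_succ_mk]
  rw [← Finset.Nat.sum_antidiagonal_eq_sum_range_succ_mk (fun x => blockSwap φ (s + x.1) (p - x.1)
      x.2 * (braidBinom φ s p x.1 * braidBinom φ (s + p) q x.2)),
    ← Finset.sum_product' (f := fun a c => if a + c = k then blockSwap φ (s + a) (p - a) c *
      (braidBinom φ s p a * braidBinom φ (s + p) q c) else 0), ← Finset.sum_filter]
  refine (Finset.sum_subset (fun x hx => ?_) fun x hx hx' => ?_).symm
  · simpa using (Finset.mem_filter.1 hx).2
  · rw [Finset.HasAntidiagonal.mem_antidiagonal] at hx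
    simp only [Finset.mem_filter, Finset.mem_product, Finset.mem_range, hx, and_true,
      not_and_or, not_lt] at hx'
    rcases hx' with h | h
    · simp [braidBinom_eq_zero φ s p x.1 (by omega)]
    · simp [braidBinom_eq_zero φ (s + p) q x.2 (by omega)]

theorem blockSwap_zero_left (s c : ℕ) : blockSwap φ s 0 c = 1 := by
  induction c with
  | zero => rfl
  | succ c ih => rw [blockSwap_succ, ih]; simp

/-- Exchanging blocks can also start with the strand next to the second block: this strand is pulled
to the right across all strands of that block. -/
theorem IsBraidSeq.blockSwap_succ_left (hφ : IsBraidSeq φ) (s b c : ℕ) :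
    blockSwap φ s (c + 1) b = blockSwap φ s c b *
      (cyc (fun a => MulOpposite.op (φ a)) (s + c) b).unop := by
  induction b with
  | zero => simp
  | succ b ih =>
    have h : Commute (φ (s + b + c)) (blockSwap φ s c b) :=
      commute_blockSwap fun _ _ => hφ.comm' (by omega)
    rw [blockSwap_succ, ih, blockSwap_succ, cyc_succ, cyc_succ, MulOpposite.unop_mul,
      MulOpposite.unop_op, add_right_comm s c b]
    simp only [mul_assoc]
    rw [← mul_assoc (φ _), h.eq, mul_assoc]

/-- Reversing the exchange of two blocks gives the exchange in the other order. -/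
theorem IsBraidSeq.unop_blockSwap (hφ : IsBraidSeq φ) (s b c : ℕ) :
    (blockSwap (fun a => MulOpposite.op (φ a)) s b c).unop = blockSwap φ s c b := by
  induction c with
  | zero => rw [blockSwap_zero_left]; rfl
  | succ c ih => rw [blockSwap_succ, MulOpposite.unop_mul, ih, hφ.blockSwap_succ_left]

/-- An additional strand multiplies the alternating sum by `1 - cyc φ s n`. This factor is zero for
the first strand, so that the sum vanishes for at least one strand. -/
theorem IsBraidSeq.sum_halfTwist_mul_braidBinom (hφ : IsBraidSeq φ) (s n : ℕ) :
    ∑ k ∈ Finset.range (n + 1 + 1), (-1) ^ k * (halfTwist φ s k * braidBinom φ s (n + 1) k) =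
      0 := by
  have key (n : ℕ) : ∑ k ∈ Finset.range (n + 1 + 1),
      (-1) ^ k * (halfTwist φ s k * braidBinom φ s (n + 1) k) =
      (1 - cyc φ s n) * ∑ k ∈ Finset.range (n + 1),
        (-1) ^ k * (halfTwist φ s k * braidBinom φ s n k) := by
    rw [Finset.sum_range_succ', sub_mul, one_mul]
    simp only [braidBinom_succ_succ, mul_add, Finset.sum_add_distrib]
    rw [add_right_comm, sub_eq_add_neg]
    congr 1
    · rw [Finset.sum_range_succ, braidBinom_eq_zero φ s n (n + 1) (by omega),
        Finset.sum_range_succ' (fun k => (-1) ^ k * (halfTwist φ s k * braidBinom φ s n k))]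
      simp
    · rw [Finset.mul_sum, ← Finset.sum_neg_distrib]
      refine Finset.sum_congr rfl fun k hk => ?_
      obtain ⟨r, rfl⟩ := Nat.exists_eq_add_of_le (Finset.mem_range_succ_iff.1 hk)
      have h : Commute (cyc φ (s + k) r) (halfTwist φ s k) :=
        hφ.cyc_commute_halfTwist (Or.inr le_rfl)
      rw [Nat.add_sub_cancel_left, halfTwist_succ, cyc_add, ← mul_assoc (cyc φ s k * _),
        mul_assoc (cyc φ s k), ← h.eq, pow_succ]
      have h' : Commute ((-1 : R) ^ k) (cyc φ s k * cyc φ (s + k) r) :=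
        (Commute.neg_one_left _).pow_left k
      rw [← mul_assoc (cyc φ s k * _), ← h'.eq]
      simp only [mul_neg, mul_one, neg_mul, mul_assoc]
  induction n with
  | zero => rw [key]; simp
  | succ n ih => rw [key, ih, mul_zero]

/-- The version for half twists of the second block. By the recursion for binomials every summand
splits into two, and the two contributions of each `k` cancel. -/
theorem IsBraidSeq.sum_halfTwist_mul_braidBinom' (hφ : IsBraidSeq φ) (s n : ℕ) :
    ∑ k ∈ Finset.range (n + 1 + 1), (-1) ^ (n + 1 - k) *
      (halfTwist φ (s + k) (n + 1 - k) * braidBinom φ s (n + 1) k) = 0 := by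
  rw [Finset.sum_range_succ']
  simp only [braidBinom_succ_succ, mul_add, Finset.sum_add_distrib]
  rw [add_right_comm]
  have h1 : ∑ k ∈ Finset.range (n + 1), (-1) ^ (n + 1 - (k + 1)) *
      (halfTwist φ (s + (k + 1)) (n + 1 - (k + 1)) * braidBinom φ s n (k + 1)) +
      (-1) ^ (n + 1 - 0) * (halfTwist φ (s + 0) (n + 1 - 0) * braidBinom φ s (n + 1) 0) =
      ∑ k ∈ Finset.range (n + 1), (-1) ^ (n + 1 - k) *
        (halfTwist φ (s + k) (n + 1 - k) * braidBinom φ s n k) := by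
    rw [Finset.sum_range_succ, braidBinom_eq_zero φ s n (n + 1) (by omega),
      Finset.sum_range_succ' (fun k => (-1) ^ (n + 1 - k) *
        (halfTwist φ (s + k) (n + 1 - k) * braidBinom φ s n k))]
    simp
  rw [h1, ← Finset.sum_add_distrib]
  refine Finset.sum_eq_zero fun k hk => ?_
  obtain ⟨r, rfl⟩ := Nat.exists_eq_add_of_le (Finset.mem_range_succ_iff.1 hk)
  have h : halfTwist φ (s + (k + 1)) r * cyc φ (s + k) r = halfTwist φ (s + k) (r + 1) := by
    rw [halfTwist_succ, ← add_assoc, (hφ.cyc_semiconj_halfTwist le_rfl).eq]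
  rw [Nat.add_sub_cancel_left, show k + r + 1 - (k + 1) = r by omega,
    show k + r + 1 - k = r + 1 by omega, ← mul_assoc (halfTwist φ (s + (k + 1)) r), h, pow_succ]
  simp

/-- The factorial of all strands is a binomial followed by the factorials of the two blocks. -/
theorem IsBraidSeq.braidFact_mul_braidBinom (hφ : IsBraidSeq φ) (s k m : ℕ) :
    braidFact φ s k * braidFact φ (s + k) m * braidBinom φ s (k + m) k =
      braidFact φ s (k + m) := by
  induction h : k + m generalizing k m with
  | zero =>
    obtain rfl : k = 0 := by omega
    obtain rfl : m = 0 := by omega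
    simp
  | succ n ih =>
    rcases k with _ | k
    · obtain rfl : m = n + 1 := by omega
      simp
    rcases m with _ | m
    · obtain rfl : n = k := by omega
      simp
    obtain rfl : n = k + 1 + m := by omega
    have e1 : braidFact φ s (k + 1) * braidFact φ (s + (k + 1)) (m + 1) *
        braidBinom φ s (k + 1 + m) (k + 1) =
        (∑ j ∈ Finset.range (m + 1), cyc φ (s + (k + 1) + j) (m - j)) *
          braidFact φ s (k + 1 + m) := by
      have hc : Commute (∑ j ∈ Finset.range (m + 1), cyc φ (s + (k + 1) + j) (m - j))
          (braidFact φ s (k + 1)) :=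
        Commute.sum_left _ _ _ fun j _ => hφ.cyc_commute_braidFact (Or.inr (by omega))
      rw [← ih (k + 1) m rfl, braidFact_succ φ (s + (k + 1)) m, ← mul_assoc (braidFact φ s (k + 1)),
        ← hc.eq]
      simp only [mul_assoc]
    have e2 : braidFact φ s (k + 1) * braidFact φ (s + (k + 1)) (m + 1) *
        (cyc φ (s + k) (m + 1) * braidBinom φ s (k + 1 + m) k) =
        (∑ j ∈ Finset.range (k + 1), cyc φ (s + j) (k + 1 + m - j)) *
          braidFact φ s (k + 1 + m) := by
      have h1 : cyc φ (s + k) (m + 1) * braidFact φ (s + k) (m + 1) =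
          braidFact φ (s + (k + 1)) (m + 1) * cyc φ (s + k) (m + 1) := by
        rw [← add_assoc]; exact hφ.cyc_semiconj_braidFact le_rfl
      have h2 : cyc φ (s + k) (m + 1) * braidFact φ s k =
          braidFact φ s k * cyc φ (s + k) (m + 1) := hφ.cyc_commute_braidFact (Or.inr le_rfl)
      have h3 : ∑ j ∈ Finset.range (k + 1), cyc φ (s + j) (k + 1 + m - j) =
          (∑ j ∈ Finset.range (k + 1), cyc φ (s + j) (k - j)) * cyc φ (s + k) (m + 1) := by
        rw [Finset.sum_mul]
        refine Finset.sum_congr rfl fun j hj => ?_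
        obtain ⟨r, rfl⟩ := Nat.exists_eq_add_of_le (Finset.mem_range_succ_iff.1 hj)
        rw [Nat.add_sub_cancel_left, show j + r + 1 + m - j = r + (m + 1) by omega, cyc_add,
          add_assoc s j r]
      rw [← ih k (m + 1) (by omega), h3, braidFact_succ φ s k]
      simp only [mul_assoc]
      rw [← mul_assoc (braidFact φ (s + (k + 1)) (m + 1)), ← h1,
        ← mul_assoc (cyc _ _ _) (braidFact φ s k), h2]
      simp only [mul_assoc]
    rw [show k + 1 + m + 1 = (k + 1 + m) + 1 from rfl, braidBinom_succ_succ, mul_add, e1,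
      show k + 1 + m - k = m + 1 by omega, e2, braidFact_succ φ s (k + 1 + m), ← add_mul,
      show k + 1 + m + 1 = k + 1 + (m + 1) by omega,
      Finset.sum_range_add (M := R) _ (k + 1) (m + 1),
      add_comm]
    congr 2
    refine Finset.sum_congr rfl fun j _ => ?_
    rw [show k + 1 + m - (k + 1 + j) = m - j by omega, add_assoc s (k + 1)]

end Ring
end BraidedTensor

/-! ### Permutations in terms of the position of the last element -/

namespace BraidedTensor

open Equiv

theorem insPerm_injective {n : ℕ} (p : Fin (n + 1)) (τ : Perm (Fin n)) :
    Function.Injective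
      (Fin.lastCases p fun j => p.succAbove (τ j) : Fin (n + 1) → Fin (n + 1)) := by
  intro x y
  induction x using Fin.lastCases <;> induction y using Fin.lastCases <;>
    simp [p.succAbove_ne, (p.succAbove_ne _).symm]

/-- The permutation of `n + 1` elements that maps the last element to `p` and permutes the other
elements like `τ`, up to the order preserving identification of the complement of `p`. -/
noncomputable def insPerm {n : ℕ} (p : Fin (n + 1)) (τ : Perm (Fin n)) : Perm (Fin (n + 1)) :=
  Equiv.ofBijective _ (Finite.injective_iff_bijective.1 (insPerm_injective p τ))

@[simp] theorem insPerm_last {n : ℕ} (p : Fin (n + 1)) (τ : Perm (Fin n)) :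
    insPerm p τ (Fin.last n) = p := by
  simp [insPerm]

@[simp] theorem insPerm_castSucc {n : ℕ} (p : Fin (n + 1)) (τ : Perm (Fin n)) (j : Fin n) :
    insPerm p τ j.castSucc = p.succAbove (τ j) := by
  simp [insPerm]

theorem insPerm_bijective (n : ℕ) :
    Function.Bijective fun x : Fin (n + 1) × Perm (Fin n) => insPerm x.1 x.2 := by
  constructor
  · rintro ⟨p, τ⟩ ⟨q, υ⟩ h
    dsimp only at h
    obtain rfl : p = q := by simpa using congrArg (· (Fin.last n)) h
    refine Prod.ext rfl (Equiv.ext fun j => ?_)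
    simpa using congrArg (· j.castSucc) h
  · intro σ
    have h (j : Fin n) : ∃ z, (σ (Fin.last n)).succAbove z = σ j.castSucc :=
      Fin.exists_succAbove_eq fun h => (Fin.castSucc_lt_last j).ne (σ.injective h)
    choose τ hτ using h
    have hτ' : Function.Injective τ := fun i j hij => by
      have := hτ i
      rw [hij, hτ j] at this
      exact (Fin.castSucc_injective n (σ.injective this)).symm
    refine ⟨(σ (Fin.last n), Equiv.ofBijective τ (Finite.injective_iff_bijective.1 hτ')), ?_⟩
    ext x : 1
    induction x using Fin.lastCases with
    | last => simp
    | cast j => simp [hτ]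

/-- A permutation of `n + 1` elements is determined by the image of the last element and a
permutation of `n` elements. -/
noncomputable def insEquiv (n : ℕ) : Fin (n + 1) × Perm (Fin n) ≃ Perm (Fin (n + 1)) :=
  Equiv.ofBijective _ (insPerm_bijective n)

theorem exists_insPerm {n : ℕ} (σ : Perm (Fin (n + 1))) : ∃ p τ, insPerm p τ = σ := by
  obtain ⟨⟨p, τ⟩, h⟩ := (insPerm_bijective n).2 σ
  exact ⟨p, τ, h⟩

/-- The number of inversions of a permutation, by recursion on the number of elements. -/
noncomputable def insLength : {n : ℕ} → Perm (Fin n) → ℕ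
  | 0, _ => 0
  | n + 1, σ => (n - ((insEquiv n).symm σ).1) + insLength ((insEquiv n).symm σ).2

theorem insLength_insPerm {n : ℕ} (p : Fin (n + 1)) (τ : Perm (Fin n)) :
    insLength (insPerm p τ) = (n - p) + insLength τ := by
  have : (insEquiv n).symm (insPerm p τ) = (p, τ) := (insEquiv n).symm_apply_apply (p, τ)
  rw [insLength, this]

section Lift

variable {R : Type*} [Ring R] (φ : ℕ → R)

/-- The positive braid lift of a permutation, by recursion on the number of strands. -/
noncomputable def insLift : {n : ℕ} → Perm (Fin n) → R
  | 0, _ => 1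
  | n + 1, σ => cyc φ ((insEquiv n).symm σ).1 (n - ((insEquiv n).symm σ).1) *
      insLift ((insEquiv n).symm σ).2

theorem insLift_insPerm {n : ℕ} (p : Fin (n + 1)) (τ : Perm (Fin n)) :
    insLift φ (insPerm p τ) = cyc φ p (n - p) * insLift φ τ := by
  have : (insEquiv n).symm (insPerm p τ) = (p, τ) := (insEquiv n).symm_apply_apply (p, τ)
  rw [insLift, this]

theorem insPerm_last_one (n : ℕ) : insPerm (Fin.last n) 1 = 1 := by
  ext x : 1
  induction x using Fin.lastCases <;> simp

theorem adjSwap_val {n : ℕ} (a : Fin (n - 1)) (x : Fin n) :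
    (adjSwap n a x : ℕ) =
      if (x : ℕ) = a then (a : ℕ) + 1 else if (x : ℕ) = a + 1 then a else x := by
  rw [adjSwap, Equiv.swap_apply_def]
  simp only [Fin.ext_iff]
  split_ifs <;> rfl

theorem succAbove_val {n : ℕ} (p : Fin (n + 1)) (x : Fin n) :
    (p.succAbove x : ℕ) = if (x : ℕ) < p then (x : ℕ) else x + 1 := by
  rw [Fin.succAbove]
  simp only [Fin.lt_def, Fin.val_castSucc]
  split_ifs <;> simp

theorem adjSwap_mul_insPerm_move {n : ℕ} (a : Fin (n + 1 - 1)) (τ : Perm (Fin n))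
    (p q : Fin (n + 1))
    (h : (p : ℕ) = a ∧ (q : ℕ) = a + 1 ∨ (q : ℕ) = a ∧ (p : ℕ) = a + 1) :
    adjSwap (n + 1) a * insPerm p τ = insPerm q τ := by
  ext x
  induction x using Fin.lastCases with
  | last => simp only [Perm.mul_apply, insPerm_last, adjSwap_val]; split_ifs <;> omega
  | cast j =>
    simp only [Perm.mul_apply, insPerm_castSucc, adjSwap_val, succAbove_val]
    split_ifs <;> omega

theorem adjSwap_mul_insPerm {n : ℕ} (a : Fin (n + 1 - 1)) (b : Fin (n - 1)) (τ : Perm (Fin n))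
    (p : Fin (n + 1))
    (h : (b : ℕ) = a ∧ (a : ℕ) + 1 < p ∨ (a : ℕ) = b + 1 ∧ (p : ℕ) < a) :
    adjSwap (n + 1) a * insPerm p τ = insPerm p (adjSwap n b * τ) := by
  ext x
  induction x using Fin.lastCases with
  | last => simp only [Perm.mul_apply, insPerm_last, adjSwap_val]; split_ifs <;> omega
  | cast j =>
    simp only [Perm.mul_apply, insPerm_castSucc, adjSwap_val, succAbove_val]
    split_ifs <;> omega

/-- `σ'` is obtained from `σ` by an additional crossing at `a`. -/
def IsAscent {n : ℕ} (a : ℕ) (σ σ' : Perm (Fin n)) : Prop :=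
  insLength σ' = insLength σ + 1 ∧ insLift φ σ' = φ a * insLift φ σ

variable {φ}

theorem IsAscent.insPerm (hφ : IsBraidSeq φ) {n : ℕ} {a b : ℕ} {p : Fin (n + 1)}
    (h : b = a ∧ a + 1 < p ∨ a = b + 1 ∧ p < a ∧ a < n)
    {σ σ' : Perm (Fin n)} (hσ : IsAscent φ b σ σ') :
    IsAscent φ a (insPerm p σ) (insPerm p σ') := by
  refine ⟨by rw [insLength_insPerm, insLength_insPerm, hσ.1, add_assoc], ?_⟩
  rw [insLift_insPerm, insLift_insPerm, hσ.2, ← mul_assoc, ← mul_assoc]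
  congr 1
  rcases h with ⟨rfl, h⟩ | ⟨rfl, h, h'⟩
  · exact (hφ.gen_commute_cyc (by omega)).symm
  · exact hφ.cyc_semiconj (by omega) (by omega)

theorem isAscent_move {n a : ℕ} (τ : Perm (Fin n)) (p q : Fin (n + 1))
    (hp : (p : ℕ) = a + 1) (hq : (q : ℕ) = a) :
    IsAscent φ a (insPerm p τ) (insPerm q τ) := by
  have : n - a = n - (a + 1) + 1 := by omega
  constructor
  · rw [insLength_insPerm, insLength_insPerm, hp, hq]; omega
  · rw [insLift_insPerm, insLift_insPerm, hp, hq, this, cyc_succ', mul_assoc]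

/-- Multiplication by an adjacent transposition adds or removes a crossing. -/
theorem isAscent_or_isAscent (hφ : IsBraidSeq φ) {n : ℕ} (a : Fin (n - 1)) (σ : Perm (Fin n)) :
    IsAscent φ a σ (adjSwap n a * σ) ∨ IsAscent φ a (adjSwap n a * σ) σ := by
  induction n with
  | zero => exact a.elim0
  | succ n ih =>
    obtain ⟨p, τ, rfl⟩ := exists_insPerm σ
    rcases lt_trichotomy ((a : ℕ) + 1) p with h | h | h
    · have hb : (a : ℕ) < n - 1 := by omega
      rw [adjSwap_mul_insPerm a ⟨a, hb⟩ τ p (Or.inl ⟨rfl, h⟩)]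
      exact (ih ⟨a, hb⟩ τ).imp (.insPerm hφ (Or.inl ⟨rfl, h⟩)) (.insPerm hφ (Or.inl ⟨rfl, h⟩))
    · rw [adjSwap_mul_insPerm_move a τ p ⟨a, by omega⟩ (Or.inr ⟨rfl, h.symm⟩)]
      exact Or.inl (isAscent_move τ p _ h.symm rfl)
    · rcases lt_or_ge (p : ℕ) a with h' | h'
      · obtain ⟨b, hb⟩ := Nat.exists_eq_succ_of_ne_zero (show (a : ℕ) ≠ 0 by omega)
        have hb' : b < n - 1 := by omega
        have ha := a.2
        rw [adjSwap_mul_insPerm a ⟨b, hb'⟩ τ p (Or.inr ⟨hb, h'⟩)]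
        exact (ih ⟨b, hb'⟩ τ).imp (.insPerm hφ (Or.inr ⟨hb, h', by omega⟩))
          (.insPerm hφ (Or.inr ⟨hb, h', by omega⟩))
      · have ha := a.2
        rw [adjSwap_mul_insPerm_move a τ p ⟨a + 1, by omega⟩ (Or.inl ⟨by omega, rfl⟩)]
        exact Or.inr (isAscent_move τ _ p rfl (by omega))

theorem insLength_one (n : ℕ) : insLength (1 : Perm (Fin n)) = 0 := by
  induction n with
  | zero => rfl
  | succ n ih => rw [← insPerm_last_one, insLength_insPerm, ih]; simp

theorem insLift_one (n : ℕ) : insLift φ (1 : Perm (Fin n)) = 1 := by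
  induction n with
  | zero => rfl
  | succ n ih => rw [← insPerm_last_one, insLift_insPerm, ih]; simp

theorem adjSwap_mul_self {n : ℕ} (a : Fin (n - 1)) : adjSwap n a * adjSwap n a = 1 :=
  Equiv.swap_mul_self _ _

/-- Every permutation but the identity has a crossing that can be removed on the left. -/
theorem exists_descent {n : ℕ} (σ : Perm (Fin n)) (h : σ ≠ 1) :
    ∃ a, insLength σ = insLength (adjSwap n a * σ) + 1 := by
  induction n with
  | zero => exact absurd (Subsingleton.elim _ _) h
  | succ n ih =>
    obtain ⟨p, τ, rfl⟩ := exists_insPerm σ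
    rcases eq_or_ne p (Fin.last n) with rfl | hp
    · obtain ⟨a, ha⟩ := ih τ fun hτ => h (by rw [hτ, insPerm_last_one])
      refine ⟨⟨a, by omega⟩, ?_⟩
      rw [adjSwap_mul_insPerm _ a τ _ (Or.inl ⟨rfl, by simp; omega⟩), insLength_insPerm,
        insLength_insPerm, ha, add_assoc]
    · have hp' : (p : ℕ) < n := Fin.val_lt_last hp
      refine ⟨⟨p, hp'⟩, ?_⟩
      rw [adjSwap_mul_insPerm_move _ τ p ⟨p + 1, by omega⟩ (Or.inl ⟨rfl, rfl⟩), insLength_insPerm,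
        insLength_insPerm]
      dsimp only
      omega

/-- The number `insLength σ` of inversions is attained by a word for `σ`. By `insLength_le` no word
is shorter. -/
theorem exists_word_length {n : ℕ} (σ : Perm (Fin n)) :
    ∃ w : List (Fin (n - 1)), (w.map (adjSwap n)).prod = σ ∧ w.length = insLength σ := by
  induction h : insLength σ using Nat.strong_induction_on generalizing σ with
  | _ l ih =>
    by_cases hσ : σ = 1
    · exact ⟨[], by simp [hσ], by rw [← h, hσ, insLength_one]; rfl⟩
    · obtain ⟨a, ha⟩ := exists_descent σ hσ
      obtain ⟨w, hw, hl⟩ := ih _ (by omega) (adjSwap n a * σ) rfl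
      exact ⟨a :: w, by simp [hw, ← mul_assoc, adjSwap_mul_self], by simp [hl]; omega⟩

theorem insLength_le {n : ℕ} (w : List (Fin (n - 1))) :
    insLength (w.map (adjSwap n)).prod ≤ w.length := by
  induction w with
  | nil => simp [insLength_one]
  | cons a w ih =>
    -- The lengths do not depend on the braid sequence, so any sequence will do here.
    have hz : IsBraidSeq (fun _ => 0 : ℕ → ℤ) := ⟨by simp, by simp⟩
    rw [List.map_cons, List.prod_cons, List.length_cons]
    rcases isAscent_or_isAscent hz a (w.map (adjSwap n)).prod with h | h <;> have := h.1 <;> omega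

theorem insLift_eq_prod (hφ : IsBraidSeq φ) {n : ℕ} (w : List (Fin (n - 1)))
    (hw : w.length = insLength (w.map (adjSwap n)).prod) :
    insLift φ (w.map (adjSwap n)).prod = (w.map fun a : Fin (n - 1) => φ a).prod := by
  induction w with
  | nil => simp [insLift_one]
  | cons a w ih =>
    rw [List.map_cons, List.prod_cons] at hw ⊢
    rw [List.length_cons] at hw
    have hle := insLength_le w
    rcases isAscent_or_isAscent hφ a (w.map (adjSwap n)).prod with h | h
    · have := h.1
      rw [h.2, ih (by omega)]; simp
    · have := h.1
      omega

theorem length_reducedWord {n : ℕ} {σ : Perm (Fin n)} {w : List (Fin (n - 1))}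
    (hw : IsReducedWord σ w) : w.length = insLength σ := by
  obtain ⟨w', hw', hl⟩ := exists_word_length σ
  exact le_antisymm (hl ▸ hw.2 w' hw') (hw.1 ▸ insLength_le w)

/-- The product of a braid sequence along a reduced word depends only on the permutation. -/
theorem prod_reducedWord (hφ : IsBraidSeq φ) {n : ℕ} {σ : Perm (Fin n)} {w : List (Fin (n - 1))}
    (hw : IsReducedWord σ w) : (w.map fun a : Fin (n - 1) => φ a).prod = insLift φ σ := by
  rw [← insLift_eq_prod hφ w, hw.1]
  rw [hw.1, length_reducedWord hw]

theorem isReducedWord_reverse {n : ℕ} {σ : Perm (Fin n)} {w : List (Fin (n - 1))}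
    (hw : IsReducedWord σ w) : IsReducedWord σ⁻¹ w.reverse := by
  have h (w : List (Fin (n - 1))) :
      (w.reverse.map (adjSwap n)).prod = (w.map (adjSwap n)).prod⁻¹ := by
    rw [List.prod_inv_reverse, List.map_map, List.map_reverse]
    congr 3
  refine ⟨by rw [h, hw.1], fun w' hw' => ?_⟩
  rw [List.length_reverse, ← w'.length_reverse]
  exact hw.2 _ (by rw [h, hw', inv_inv])

theorem IsBraidSeq.op (hφ : IsBraidSeq φ) : IsBraidSeq fun a => MulOpposite.op (φ a) :=
  ⟨fun a => by simp only [← MulOpposite.op_mul, ← mul_assoc, hφ.braid],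
    fun a b h => (hφ.comm a b h).op⟩

/-- Reversing a reduced word gives a reduced word of the inverse permutation. -/
theorem insLift_inv (hφ : IsBraidSeq φ) {n : ℕ} (σ : Perm (Fin n)) :
    insLift φ σ⁻¹ = (insLift (fun a => MulOpposite.op (φ a)) σ).unop := by
  obtain ⟨w, hw⟩ := exists_reducedWord σ
  rw [← prod_reducedWord hφ (isReducedWord_reverse hw), ← prod_reducedWord hφ.op hw,
    MulOpposite.unop_list_prod, List.map_map, List.map_reverse]
  rfl

theorem revPerm_succ (n : ℕ) : (Fin.revPerm : Perm (Fin (n + 1))) = insPerm 0 Fin.revPerm := by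
  ext x
  induction x using Fin.lastCases with
  | last => simp
  | cast j => simp [Fin.rev_castSucc]

theorem insLift_revPerm (n : ℕ) : insLift φ (Fin.revPerm : Perm (Fin n)) = halfTwist φ 0 n := by
  induction n with
  | zero => rfl
  | succ n ih =>
    rw [revPerm_succ, insLift_insPerm, ih, halfTwist_succ]
    rfl

/-- The half twist is invariant under reversal, because the order reversing permutation is an
involution. -/
theorem unop_halfTwist (hφ : IsBraidSeq φ) (n : ℕ) :
    (halfTwist (fun a => MulOpposite.op (φ a)) 0 n).unop = halfTwist φ 0 n := by
  rw [← insLift_revPerm, ← insLift_inv hφ, ← insLift_revPerm]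
  rfl

/-! ### Alternating sums over shuffles -/

theorem isShuffle_iff {n : ℕ} (b : Fin n → ℕ) (σ : Perm (Fin n)) :
    IsShuffle b σ ↔ ∀ x y, b (σ x) = b (σ y) → σ x < σ y → x < y := by
  constructor
  · intro h x y hb hσ
    simpa using h _ _ hb hσ
  · intro h i j hb hij
    exact h _ _ (by simpa using hb) (by simpa using hij)

/-- A permutation is a shuffle if the last element goes to the last position of some block and the
other elements form a shuffle of the remaining positions. -/
theorem isShuffle_insPerm {n : ℕ} (b : Fin (n + 1) → ℕ) (p : Fin (n + 1)) (τ : Perm (Fin n)) :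
    IsShuffle b (insPerm p τ) ↔
      (∀ j, b j = b p → j ≤ p) ∧ IsShuffle (fun i => b (p.succAbove i)) τ := by
  rw [isShuffle_iff, isShuffle_iff]
  constructor
  · refine fun h => ⟨fun j hj => ?_, fun x y hb hτ => ?_⟩
    · by_contra! hlt
      obtain ⟨z, rfl⟩ := Fin.exists_succAbove_eq hlt.ne'
      have := h (Fin.last n) (τ.symm z).castSucc (by simpa using hj.symm) (by simpa using hlt)
      exact absurd this (Fin.castSucc_lt_last _).not_gt
    · simpa using h x.castSucc y.castSucc (by simpa using hb) (by simpa using hτ)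
  · rintro ⟨h1, h2⟩ x y hb hxy
    induction y using Fin.lastCases with
    | last =>
      induction x using Fin.lastCases with
      | last => simp at hxy
      | cast x => exact Fin.castSucc_lt_last x
    | cast y =>
      induction x using Fin.lastCases with
      | last =>
        simp only [insPerm_last, insPerm_castSucc] at hb hxy
        exact absurd hxy (h1 _ hb.symm).not_gt
      | cast x => simpa using h2 x y (by simpa using hb) (by simpa using hxy)

variable (φ) in
open Classical in
/-- The sum of the positive braid lifts of the shuffle permutations. -/
noncomputable def shuffleSum {n : ℕ} (b : Fin n → ℕ) : R :=
  ∑ σ : Perm (Fin n), if IsShuffle b σ then insLift φ σ else 0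

theorem shuffleSum_zero (b : Fin 0 → ℕ) : shuffleSum φ b = 1 := by
  rw [shuffleSum, Fintype.sum_unique, if_pos (show IsShuffle b default from fun i => i.elim0)]
  rfl

open Classical in
theorem shuffleSum_succ {n : ℕ} (b : Fin (n + 1) → ℕ) :
    shuffleSum φ b = ∑ p : Fin (n + 1), if ∀ j, b j = b p → j ≤ p then
      cyc φ p (n - p) * shuffleSum φ (fun i => b (p.succAbove i)) else 0 := by
  rw [shuffleSum, ← (insEquiv n).sum_comp, Fintype.sum_prod_type]
  refine Finset.sum_congr rfl fun p _ => ?_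
  have (τ : Perm (Fin n)) : insEquiv n (p, τ) = insPerm p τ := rfl
  simp only [this, isShuffle_insPerm, insLift_insPerm, ite_and]
  split_ifs
  · rw [shuffleSum, Finset.mul_sum]
    exact Finset.sum_congr rfl fun τ _ => by split_ifs <;> simp
  · simp

/-- If all blocks have one element, all permutations are shuffles. -/
theorem shuffleSum_of_injective {n : ℕ} (b : Fin n → ℕ) (hb : Function.Injective b) :
    shuffleSum φ b = braidFact φ 0 n := by
  induction n with
  | zero =>
    rw [shuffleSum_zero, braidFact_zero]
  | succ n ih =>
    rw [shuffleSum_succ, braidFact_succ, Finset.sum_mul, Finset.sum_range]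
    refine Finset.sum_congr rfl fun p _ => ?_
    rw [if_pos fun j hj => (hb hj).le, ih (fun i => b (p.succAbove i))
      (hb.comp p.succAbove_right_injective), zero_add]

/-- The last element goes to the last position of the first or of the second block, which gives the
two summands of the recursion for binomials. -/
theorem shuffleSum_twoBlocks (n k : ℕ) (hk : k ≤ n) :
    shuffleSum φ (fun i : Fin n => if (i : ℕ) < k then 0 else 1) = braidBinom φ 0 n k := by
  induction n generalizing k with
  | zero =>
    obtain rfl : k = 0 := by omega
    rw [shuffleSum_zero, braidBinom_self]
  | succ n ih =>
    have hlast : (∀ j : Fin (n + 1), (if (j : ℕ) < k then 0 else 1) =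
        (if ((Fin.last n : Fin (n + 1)) : ℕ) < k then 0 else 1) → j ≤ Fin.last n) :=
      fun j _ => Fin.le_last j
    have hsucc (p : Fin (n + 1)) (i : Fin n) :
        (if (p.succAbove i : ℕ) < k then 0 else 1) =
          if (i : ℕ) < (if (p : ℕ) < k then k - 1 else k) then 0 else 1 := by
      rw [succAbove_val]
      split_ifs <;> omega
    simp only [shuffleSum_succ, hsucc]
    rw [Fin.sum_univ_castSucc, if_pos hlast]
    have hn (p : Fin n) (hp : (p : ℕ) + 1 ≠ k) : ¬ ∀ j : Fin (n + 1),
        (if (j : ℕ) < k then 0 else 1) =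
          (if (p.castSucc : ℕ) < k then 0 else 1) → j ≤ p.castSucc := by
      intro h
      have := h p.succ (by simp only [Fin.val_succ, Fin.val_castSucc]; split_ifs <;> omega)
      exact absurd this (Fin.castSucc_lt_succ (i := p)).not_ge
    rcases k with _ | k
    · rw [Finset.sum_eq_zero fun p _ => if_neg (hn p (by omega))]
      simpa using ih 0 (by omega)
    · rcases eq_or_lt_of_le (Nat.le_of_succ_le_succ hk) with rfl | hk'
      · rw [Finset.sum_eq_zero fun p _ => if_neg (hn p (by omega))]
        simpa using ih k le_rfl
      · rw [Finset.sum_eq_single_of_mem (⟨k, hk'⟩ : Fin n) (Finset.mem_univ _)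
          fun p _ hp => if_neg (hn p fun h => hp (Fin.ext (by simpa using h))), if_pos,
          braidBinom_succ_succ, add_comm]
        · simp only [Fin.val_last, Fin.val_castSucc, Nat.sub_self, cyc_zero, one_mul]
          simp only [if_neg (show ¬ n < k + 1 by omega), if_pos (show k < k + 1 by omega),
            Nat.add_sub_cancel]
          rw [ih _ (by omega), ih _ (by omega), zero_add]
        · intro j hj
          rw [Fin.le_def]
          simp only [Fin.val_castSucc] at hj ⊢
          split_ifs at hj <;> omega

open Classical in
/-- A sum over inverses of shuffles is a sum over shuffles in the opposite ring. -/
theorem sum_shuffle_inv (hφ : IsBraidSeq φ) {n : ℕ} (b : Fin n → ℕ) :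
    (∑ σ : Perm (Fin n), if IsShuffle b σ⁻¹ then insLift φ σ else 0) =
      (shuffleSum (fun a => MulOpposite.op (φ a)) b).unop := by
  rw [shuffleSum, ← _root_.Equiv.sum_comp (Equiv.inv (Perm (Fin n))), Finset.unop_sum]
  refine Finset.sum_congr rfl fun σ _ => ?_
  simp only [Equiv.inv_apply, inv_inv, insLift_inv hφ]
  split_ifs <;> rfl

theorem isShuffle_val {n : ℕ} (σ : Perm (Fin n)) : IsShuffle (fun i => (i : ℕ)) σ :=
  fun _ _ h h' => absurd (Fin.ext h) h'.ne

/-- The factorial is invariant under reversal, because inversion permutes its summands. -/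
theorem unop_braidFact (hφ : IsBraidSeq φ) (n : ℕ) :
    (braidFact (fun a => MulOpposite.op (φ a)) 0 n).unop = braidFact φ 0 n := by
  rw [← shuffleSum_of_injective (fun i : Fin n => (i : ℕ)) Fin.val_injective,
    ← sum_shuffle_inv hφ, ← shuffleSum_of_injective (fun i : Fin n => (i : ℕ)) Fin.val_injective,
    shuffleSum]
  simp only [isShuffle_val]

end Lift
end BraidedTensor

/-! ### The summands of tensor products of graded objects -/

namespace BraidedTensor

section Summands

variable {C : Type u} [Category.{v} C] [Abelian C] [MonoidalCategory C] [MonoidalPreadditive C]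

open GradedObject.Monoidal

theorem graded_ι₃_associator (X Y Z : GradedObject ℕ C) (i j l k : ℕ) (h : i + j + l = k) :
    ιTensorObj₃' X Y Z i j l k h ≫ (GradedObject.Monoidal.associator X Y Z).hom k =
      (α_ _ _ _).hom ≫ ιTensorObj₃ X Y Z i j l k h :=
  ιTensorObj₃'_associator_hom X Y Z i j l k h

/-- The object of degree `i` of a graded object. -/
def ob (X : NGraded C) (i : ℕ) : C := X i

/-- The component of degree `k` of a morphism of graded objects. -/
def ap {X Y : NGraded C} (f : X ⟶ Y) (k : ℕ) : ob X k ⟶ ob Y k := f k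

theorem hom_ext {X Y : NGraded C} {f g : X ⟶ Y} (h : ∀ k, ap f k = ap g k) : f = g := funext h

theorem ap_comp {X Y Z : NGraded C} (f : X ⟶ Y) (g : Y ⟶ Z) (k : ℕ) :
    ap (f ≫ g) k = ap f k ≫ ap g k := rfl

theorem ap_id (X : NGraded C) (k : ℕ) : ap (𝟙 X) k = 𝟙 (ob X k) := rfl

/-- The inclusion of the summand `X i ⊗ Y j` into `(X ⊗ Y) k`, which is zero by convention if
`i + j ≠ k`. -/
noncomputable def inc (X Y : NGraded C) (i j k : ℕ) : ob X i ⊗ ob Y j ⟶ ob (X ⊗ Y) k :=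
  if h : i + j = k then ιTensorObj (C := C) X Y i j k h else 0

theorem inc_eq (X Y : NGraded C) {i j k : ℕ} (h : i + j = k) :
    inc X Y i j k = ιTensorObj (C := C) X Y i j k h := dif_pos h

theorem inc_ne (X Y : NGraded C) {i j k : ℕ} (h : i + j ≠ k) : inc X Y i j k = 0 := dif_neg h

theorem tensor_hom_ext {X Y : NGraded C} {k : ℕ} {A : C} {f g : ob (X ⊗ Y) k ⟶ A}
    (h : ∀ i j, i + j = k → inc X Y i j k ≫ f = inc X Y i j k ≫ g) : f = g :=
  tensorObj_ext (C := C) (X₁ := X) (X₂ := Y) f g fun i j hij => by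
    have := h i j hij
    rw [inc_eq X Y hij] at this
    exact this

theorem inc_tensorHom {X Y X' Y' : NGraded C} (f : X ⟶ X') (g : Y ⟶ Y') (i j k : ℕ) :
    inc X Y i j k ≫ ap (f ⊗ₘ g) k = (ap f i ⊗ₘ ap g j) ≫ inc X' Y' i j k := by
  by_cases h : i + j = k
  · rw [inc_eq _ _ h, inc_eq _ _ h]
    exact ι_tensorHom (C := C) f g i j k h
  · rw [inc_ne _ _ h, inc_ne _ _ h, zero_comp, comp_zero]

theorem inc_whiskerRight {X X' : NGraded C} (f : X ⟶ X') (Y : NGraded C) (i j k : ℕ) :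
    inc X Y i j k ≫ ap (f ▷ Y) k = (ap f i ▷ ob Y j) ≫ inc X' Y i j k := by
  rw [← tensorHom_id, inc_tensorHom, ap_id, tensorHom_id]

theorem inc_whiskerLeft (X : NGraded C) {Y Y' : NGraded C} (f : Y ⟶ Y') (i j k : ℕ) :
    inc X Y i j k ≫ ap (X ◁ f) k = (ob X i ◁ ap f j) ≫ inc X Y' i j k := by
  rw [← id_tensorHom, inc_tensorHom, ap_id, id_tensorHom]

theorem inc_associator (X Y Z : NGraded C) {i j l a b k : ℕ} (h₁ : i + j = a) (h₂ : j + l = b)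
    (h : a + l = k) :
    (inc X Y i j a ▷ ob Z l) ≫ inc (X ⊗ Y) Z a l k ≫ ap (α_ X Y Z).hom k =
      (α_ (ob X i) (ob Y j) (ob Z l)).hom ≫ (ob X i ◁ inc Y Z j l b) ≫ inc X (Y ⊗ Z) i b k := by
  have h' : i + j + l = k := by omega
  rw [inc_eq X Y h₁, inc_eq (X ⊗ Y) Z h, inc_eq Y Z h₂, inc_eq X (Y ⊗ Z) (by omega)]
  have := graded_ι₃_associator X Y Z i j l k h'
  rw [ιTensorObj₃'_eq (C := C) X Y Z i j l k h' a h₁,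
    ιTensorObj₃_eq (C := C) X Y Z i j l k h' b h₂, Category.assoc] at this
  exact this

theorem inc_associator_inv (X Y Z : NGraded C) {i j l a b k : ℕ} (h₁ : i + j = a) (h₂ : j + l = b)
    (h : a + l = k) :
    (ob X i ◁ inc Y Z j l b) ≫ inc X (Y ⊗ Z) i b k ≫ ap (α_ X Y Z).inv k =
      (α_ (ob X i) (ob Y j) (ob Z l)).inv ≫ (inc X Y i j a ▷ ob Z l) ≫ inc (X ⊗ Y) Z a l k := by
  rw [Iso.eq_inv_comp, ← reassoc_of% inc_associator X Y Z h₁ h₂ h, ← ap_comp, Iso.hom_inv_id,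
    ap_id, Category.comp_id]

/-- The unit of the graded tensor product in degree `0`. -/
noncomputable def unit₀ : ob (𝟙_ (NGraded C)) 0 ≅ 𝟙_ C := tensorUnit₀ (I := ℕ) (C := C)

theorem leftUnitor_inv_eq (X : NGraded C) (k : ℕ) : ap (λ_ X).inv k = (λ_ (ob X k)).inv ≫
    unit₀.inv ▷ ob X k ≫ inc (𝟙_ (NGraded C)) X 0 k k := by
  rw [inc_eq _ _ (zero_add k)]; exact leftUnitor_inv_apply (C := C) X k

theorem rightUnitor_inv_eq (X : NGraded C) (k : ℕ) : ap (ρ_ X).inv k = (ρ_ (ob X k)).inv ≫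
    ob X k ◁ unit₀.inv ≫ inc X (𝟙_ (NGraded C)) k 0 k := by
  rw [inc_eq _ _ (add_zero k)]; exact rightUnitor_inv_apply (C := C) X k

theorem inc_leftUnitor (X : NGraded C) (k : ℕ) :
    inc (𝟙_ (NGraded C)) X 0 k k ≫ ap (λ_ X).hom k = unit₀.hom ▷ ob X k ≫ (λ_ (ob X k)).hom := by
  have h' : ap (λ_ X).inv k ≫ ap (λ_ X).hom k = 𝟙 _ := by rw [← ap_comp, Iso.inv_hom_id]; rfl
  rw [leftUnitor_inv_eq] at h'
  rw [← cancel_epi ((λ_ (ob X k)).inv ≫ unit₀.inv ▷ ob X k)]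
  simp only [Category.assoc] at h' ⊢
  rw [h', inv_hom_whiskerRight_assoc, Iso.inv_hom_id]

theorem isZero_tensorUnit_succ (k : ℕ) : IsZero (ob (𝟙_ (NGraded C)) (k + 1)) :=
  (isInitialTensorUnitApply (C := C) (k + 1) k.succ_ne_zero).isZero

/-- The projection of `(X ⊗ Y) k` to the summand `X i ⊗ Y j`. -/
noncomputable def prj (X Y : NGraded C) (i j k : ℕ) : ob (X ⊗ Y) k ⟶ ob X i ⊗ ob Y j :=
  tensorObjDesc (C := C) (X₁ := X) (X₂ := Y) fun i' j' _ =>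
    if h : i' = i ∧ j' = j then eqToHom (by rw [h.1, h.2]; rfl) else 0

theorem inc_prj (X Y : NGraded C) {i j k i' j' : ℕ} (h : i + j = k) :
    inc X Y i j k ≫ prj X Y i' j' k =
      if h : i = i' ∧ j = j' then eqToHom (by rw [h.1, h.2]) else 0 := by
  rw [inc_eq _ _ h]
  exact ι_tensorObjDesc (C := C) (X₁ := X) (X₂ := Y) _ i j h

theorem inc_prj_self (X Y : NGraded C) {i j k : ℕ} (h : i + j = k) :
    inc X Y i j k ≫ prj X Y i j k = 𝟙 _ := by
  rw [inc_prj _ _ h, dif_pos ⟨rfl, rfl⟩, eqToHom_refl]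

theorem inc_prj_of_ne (X Y : NGraded C) {i j i' j' k : ℕ} (h : i ≠ i') :
    inc X Y i j k ≫ prj X Y i' j' k = 0 := by
  by_cases hk : i + j = k
  · rw [inc_prj _ _ hk, dif_neg fun h' => h h'.1]
  · rw [inc_ne _ _ hk, zero_comp]

theorem sum_prj_inc (X Y : NGraded C) (k : ℕ) :
    ∑ x ∈ Finset.HasAntidiagonal.antidiagonal k, prj X Y x.1 x.2 k ≫ inc X Y x.1 x.2 k =
      𝟙 (ob (X ⊗ Y) k) := by
  refine tensor_hom_ext fun i j h => ?_
  rw [Preadditive.comp_sum, Finset.sum_eq_single (i, j)]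
  · rw [reassoc_of% inc_prj_self X Y h, Category.comp_id]
  · rintro ⟨i', j'⟩ hx hne
    rw [Finset.HasAntidiagonal.mem_antidiagonal] at hx
    rw [reassoc_of% inc_prj_of_ne X Y (i := i) (i' := i') (fun h' => hne (Prod.ext h'.symm (by
      dsimp only at hx ⊢; omega))), zero_comp]
  · exact fun h' => absurd (Finset.HasAntidiagonal.mem_antidiagonal.2 h) h'

theorem tensor_hom_ext' {X Y : NGraded C} {k : ℕ} {A : C} {f g : A ⟶ ob (X ⊗ Y) k}
    (h : ∀ i j, i + j = k → f ≫ prj X Y i j k = g ≫ prj X Y i j k) : f = g := by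
  rw [← Category.comp_id f, ← Category.comp_id g, ← sum_prj_inc, Preadditive.comp_sum,
    Preadditive.comp_sum]
  refine Finset.sum_congr rfl fun x hx => ?_
  rw [← Category.assoc, h _ _ (Finset.HasAntidiagonal.mem_antidiagonal.1 hx), Category.assoc]

theorem tensorHom_prj {X Y X' Y' : NGraded C} (f : X ⟶ X') (g : Y ⟶ Y') {i j k : ℕ}
    (h : i + j = k) : ap (f ⊗ₘ g) k ≫ prj X' Y' i j k = prj X Y i j k ≫ (ap f i ⊗ₘ ap g j) := by
  refine tensor_hom_ext fun i' j' h' => ?_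
  rw [reassoc_of% @inc_tensorHom]
  by_cases hi : i' = i
  · subst hi
    obtain rfl : j' = j := by omega
    rw [inc_prj_self _ _ h, reassoc_of% inc_prj_self _ _ h, Category.comp_id]
  · rw [inc_prj_of_ne _ _ hi, reassoc_of% inc_prj_of_ne _ _ hi, comp_zero, zero_comp]

/-- The morphism with given components into a tensor product of graded objects. -/
noncomputable def incSum {X Y : NGraded C} {A : C} {k : ℕ} (f : ∀ i j, A ⟶ ob X i ⊗ ob Y j) :
    A ⟶ ob (X ⊗ Y) k :=
  ∑ x ∈ Finset.HasAntidiagonal.antidiagonal k, f x.1 x.2 ≫ inc X Y x.1 x.2 k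

theorem tensorObjLift_eq_incSum {X Y : NGraded C} {A : C} {k : ℕ}
    (f : ∀ i j : ℕ, i + j = k → (A ⟶ (X i ⊗ Y j : C))) :
    tensorObjLift f = incSum fun i j => if h : i + j = k then f i j h else 0 := by
  refine (Finset.sum_congr rfl fun x _ => ?_).trans (Finset.sum_coe_sort (M := A ⟶ ob (X ⊗ Y) k)
    (Finset.HasAntidiagonal.antidiagonal k) fun x => (if h : x.1 + x.2 = k then f x.1 x.2 h
      else (0 : A ⟶ ob X x.1 ⊗ ob Y x.2)) ≫ inc X Y x.1 x.2 k)
  have h := Finset.HasAntidiagonal.mem_antidiagonal.1 x.2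
  exact (congrArg₂ (fun (f : A ⟶ ob X x.1.1 ⊗ ob Y x.1.2) g => f ≫ g) (dif_pos h)
    (inc_eq X Y h)).symm

theorem incSum_prj {X Y : NGraded C} {A : C} {i j k : ℕ} (f : ∀ i j, A ⟶ ob X i ⊗ ob Y j)
    (h : i + j = k) : incSum f ≫ prj X Y i j k = f i j := by
  rw [incSum, Preadditive.sum_comp, Finset.sum_eq_single (i, j)]
  · rw [Category.assoc, inc_prj_self X Y h, Category.comp_id]
  · rintro ⟨i', j'⟩ hx hne
    rw [Finset.HasAntidiagonal.mem_antidiagonal] at hx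
    rw [Category.assoc, inc_prj_of_ne X Y (fun h' => hne (Prod.ext h' (by
      dsimp only at hx ⊢; omega))), comp_zero]
  · exact fun h' => absurd (Finset.HasAntidiagonal.mem_antidiagonal.2 h) h'

variable [BraidedCategory C]

theorem inc_braiding (X Y : NGraded C) (i j k : ℕ) :
    inc X Y i j k ≫ ap (β_ X Y).hom k =
      ((-1 : ℤ) ^ (i * j)) • ((β_ (ob X i) (ob Y j)).hom ≫ inc Y X j i k) := by
  by_cases h : i + j = k
  · rw [inc_eq _ _ h, inc_eq _ _ (by omega)]
    exact ι_signedBraiding_hom (C := C) X Y i j k h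
  · rw [inc_ne _ _ h, inc_ne _ _ (by omega), zero_comp, comp_zero, smul_zero]

theorem inc_tensorμ (X Y Z W : NGraded C) {a b c d p q k l N : ℕ} (hp : a + b = p) (hq : c + d = q)
    (hk : a + c = k) (hl : b + d = l) (hN : p + q = N) :
    (inc X Y a b p ⊗ₘ inc Z W c d q) ≫ inc (X ⊗ Y) (Z ⊗ W) p q N ≫ ap (tensorμ X Y Z W) N =
      ((-1 : ℤ) ^ (b * c)) • (tensorμ (ob X a) (ob Y b) (ob Z c) (ob W d) ≫
        (inc X Z a c k ⊗ₘ inc Y W b d l) ≫ inc (X ⊗ Z) (Y ⊗ W) k l N) := by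
  obtain ⟨m, hm⟩ : ∃ m, b + q = m := ⟨_, rfl⟩
  obtain ⟨r, hr⟩ : ∃ r, b + c = r := ⟨_, rfl⟩
  -- The braiding acts on the two inner factors only.
  have inner : (ob Y b ◁ inc Z W c d q) ≫ inc Y (Z ⊗ W) b q m ≫
      ap ((α_ Y Z W).inv ≫ (β_ Y Z).hom ▷ W ≫ (α_ Z Y W).hom) m =
      ((-1 : ℤ) ^ (b * c)) • ((α_ (ob Y b) (ob Z c) (ob W d)).inv ≫
        (β_ (ob Y b) (ob Z c)).hom ▷ ob W d ≫ (α_ (ob Z c) (ob Y b) (ob W d)).hom ≫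
          (ob Z c ◁ inc Y W b d l) ≫ inc Z (Y ⊗ W) c l m) := by
    rw [ap_comp, ap_comp, reassoc_of% inc_associator_inv Y Z W hr hq (by omega),
      reassoc_of% @inc_whiskerRight,
      ← comp_whiskerRight_assoc, inc_braiding, zsmul_whiskerRight', comp_whiskerRight,
      Preadditive.zsmul_comp, Preadditive.comp_zsmul, Category.assoc,
      inc_associator Z Y W (by omega) hl (by omega)]
  have e : tensorμ X Y Z W = (α_ X Y (Z ⊗ W)).hom ≫
      X ◁ ((α_ Y Z W).inv ≫ (β_ Y Z).hom ▷ W ≫ (α_ Z Y W).hom) ≫ (α_ X Z (Y ⊗ W)).inv := by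
    simp [tensorμ]
  rw [e, ap_comp, ap_comp, MonoidalCategory.tensorHom_def'_assoc,
    reassoc_of% inc_associator X Y (Z ⊗ W) hp hm hN, tensor_whiskerLeft_assoc]
  simp only [Category.assoc, Iso.inv_hom_id_assoc]
  rw [reassoc_of% @inc_whiskerLeft, ← whiskerLeft_comp_assoc, ← whiskerLeft_comp_assoc,
    Category.assoc, inner, whiskerLeft_zsmul', Preadditive.zsmul_comp, Preadditive.comp_zsmul]
  congr 1
  simp only [MonoidalCategory.whiskerLeft_comp, Category.assoc, tensorμ]
  rw [inc_associator_inv X Z (Y ⊗ W) hk (by omega) (by omega),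
    associator_inv_naturality_right_assoc, MonoidalCategory.tensorHom_def'_assoc]

end Summands
end BraidedTensor

/-! ### Hopf algebras in graded objects in terms of components -/

namespace BraidedTensor

section Components

variable {C : Type u} [Category.{v} C] [Abelian C] [MonoidalCategory C] [MonoidalPreadditive C]

theorem tensor_hom_ext₃ {X Y Z : NGraded C} {k : ℕ} {A : C} {f g : ob ((X ⊗ Y) ⊗ Z) k ⟶ A}
    (h : ∀ i j l a, i + j = a → a + l = k →
      (inc X Y i j a ▷ ob Z l) ≫ inc (X ⊗ Y) Z a l k ≫ f =
        (inc X Y i j a ▷ ob Z l) ≫ inc (X ⊗ Y) Z a l k ≫ g) : f = g := by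
  refine tensor_hom_ext fun a l hk => ?_
  have key : ∑ x ∈ Finset.HasAntidiagonal.antidiagonal a,
      prj X Y x.1 x.2 a ▷ ob Z l ≫ inc X Y x.1 x.2 a ▷ ob Z l = 𝟙 (ob (X ⊗ Y) a ⊗ ob Z l) := by
    rw [← id_whiskerRight, ← sum_prj_inc, sum_whiskerRight]
    simp
  rw [← Category.id_comp (_ ≫ f), ← Category.id_comp (_ ≫ g), ← key, Preadditive.sum_comp,
    Preadditive.sum_comp]
  refine Finset.sum_congr rfl fun x hx => ?_
  rw [Category.assoc, h _ _ _ _ (Finset.HasAntidiagonal.mem_antidiagonal.1 hx) hk, Category.assoc]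

theorem sum_antidiagonal_assoc {M : Type*} [AddCommMonoid M] (k : ℕ) (f : ℕ → ℕ → ℕ → M) :
    ∑ x ∈ Finset.HasAntidiagonal.antidiagonal k, ∑ y ∈ Finset.HasAntidiagonal.antidiagonal x.1,
      f y.1 y.2 x.2 =
    ∑ x ∈ Finset.HasAntidiagonal.antidiagonal k, ∑ y ∈ Finset.HasAntidiagonal.antidiagonal x.2,
      f x.1 y.1 y.2 := by
  rw [Finset.sum_sigma', Finset.sum_sigma']
  refine Finset.sum_bij' (fun x _ => ⟨(x.2.1, x.2.2 + x.1.2), (x.2.2, x.1.2)⟩)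
    (fun x _ => ⟨(x.1.1 + x.2.1, x.2.2), (x.1.1, x.2.1)⟩) ?_ ?_ ?_ ?_ ?_
  · rintro ⟨⟨a, b⟩, ⟨c, d⟩⟩ h
    simp only [Finset.mem_sigma, Finset.HasAntidiagonal.mem_antidiagonal] at h ⊢
    exact ⟨by omega, trivial⟩
  · rintro ⟨⟨a, b⟩, ⟨c, d⟩⟩ h
    simp only [Finset.mem_sigma, Finset.HasAntidiagonal.mem_antidiagonal] at h ⊢
    exact ⟨by omega, trivial⟩
  · rintro ⟨⟨a, b⟩, ⟨c, d⟩⟩ h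
    simp only [Finset.mem_sigma, Finset.HasAntidiagonal.mem_antidiagonal] at h
    obtain ⟨rfl, rfl⟩ := h
    rfl
  · rintro ⟨⟨a, b⟩, ⟨c, d⟩⟩ h
    simp only [Finset.mem_sigma, Finset.HasAntidiagonal.mem_antidiagonal] at h
    obtain ⟨rfl, rfl⟩ := h
    rfl
  · rintro ⟨⟨a, b⟩, ⟨c, d⟩⟩ _
    rfl

/-- The component `A i ⊗ A j ⟶ B k` of a morphism `A ⊗ A ⟶ B`. -/
noncomputable def mulc {A B : NGraded C} (M : A ⊗ A ⟶ B) (i j k : ℕ) : ob A i ⊗ ob A j ⟶ ob B k :=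
  inc A A i j k ≫ ap M k

/-- The component `A k ⟶ B i ⊗ B j` of a morphism `A ⟶ B ⊗ B`. -/
noncomputable def comc {A B : NGraded C} (D : A ⟶ B ⊗ B) (i j k : ℕ) : ob A k ⟶ ob B i ⊗ ob B j :=
  ap D k ≫ prj B B i j k

theorem ap_eq_sum_comc {A B : NGraded C} (D : A ⟶ B ⊗ B) (k : ℕ) :
    ap D k = ∑ x ∈ Finset.HasAntidiagonal.antidiagonal k, comc D x.1 x.2 k ≫ inc B B x.1 x.2 k := by
  conv_lhs => rw [← Category.comp_id (ap D k), ← sum_prj_inc, Preadditive.comp_sum]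
  simp only [comc, Category.assoc]

variable {A : NGraded C} (M : A ⊗ A ⟶ A) (D : A ⟶ A ⊗ A) (U : 𝟙_ (NGraded C) ⟶ A)
  (E : A ⟶ 𝟙_ (NGraded C)) (S : A ⟶ A)

theorem unit_ext {B : NGraded C} {f g : 𝟙_ (NGraded C) ⟶ B} (h : ap f 0 = ap g 0) : f = g :=
  hom_ext fun k => match k with
    | 0 => h
    | k + 1 => (isZero_tensorUnit_succ k).eq_of_src _ _

theorem counit_ext {B : NGraded C} {f g : B ⟶ 𝟙_ (NGraded C)} (h : ap f 0 = ap g 0) : f = g :=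
  hom_ext fun k => match k with
    | 0 => h
    | k + 1 => (isZero_tensorUnit_succ k).eq_of_tgt _ _

variable {M D U E S}

theorem one_mul_of_components {u : 𝟙_ C ⟶ ob A 0} (hU : ap U 0 = unit₀.hom ≫ u)
    (h : ∀ k, u ▷ ob A k ≫ mulc M 0 k k = (λ_ (ob A k)).hom) : U ▷ A ≫ M = (λ_ A).hom := by
  rw [← cancel_epi (λ_ A).inv, Iso.inv_hom_id]
  refine hom_ext fun k => ?_
  rw [ap_comp, ap_comp, leftUnitor_inv_eq, Category.assoc, Category.assoc,
    reassoc_of% @inc_whiskerRight,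
    hU, ← comp_whiskerRight_assoc, Iso.inv_hom_id_assoc]
  erw [h k, Iso.inv_hom_id]
  rfl

theorem mul_one_of_components {u : 𝟙_ C ⟶ ob A 0} (hU : ap U 0 = unit₀.hom ≫ u)
    (h : ∀ k, ob A k ◁ u ≫ mulc M k 0 k = (ρ_ (ob A k)).hom) : A ◁ U ≫ M = (ρ_ A).hom := by
  rw [← cancel_epi (ρ_ A).inv, Iso.inv_hom_id]
  refine hom_ext fun k => ?_
  rw [ap_comp, ap_comp, rightUnitor_inv_eq, Category.assoc, Category.assoc,
    reassoc_of% @inc_whiskerLeft,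
    hU, ← whiskerLeft_comp_assoc, Iso.inv_hom_id_assoc]
  erw [h k, Iso.inv_hom_id]
  rfl

theorem mul_assoc_of_components
    (h : ∀ i j l a b k, i + j = a → j + l = b → a + l = k →
      mulc M i j a ▷ ob A l ≫ mulc M a l k =
        (α_ (ob A i) (ob A j) (ob A l)).hom ≫ ob A i ◁ mulc M j l b ≫ mulc M i b k) :
    M ▷ A ≫ M = (α_ A A A).hom ≫ A ◁ M ≫ M := by
  refine hom_ext fun k => tensor_hom_ext₃ fun i j l a ha hk => ?_
  rw [ap_comp, ap_comp, ap_comp, reassoc_of% @inc_whiskerRight, ← comp_whiskerRight_assoc,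
    reassoc_of% inc_associator A A A ha rfl hk, reassoc_of% @inc_whiskerLeft,
    ← whiskerLeft_comp_assoc]
  exact h i j l a _ k ha rfl hk

theorem counit_comul_of_components {e : ob A 0 ⟶ 𝟙_ C} (hE : ap E 0 = e ≫ unit₀.inv)
    (h : ∀ k, comc D 0 k k ≫ e ▷ ob A k = (λ_ (ob A k)).inv) : D ≫ E ▷ A = (λ_ A).inv := by
  refine hom_ext fun k => ?_
  rw [ap_comp, leftUnitor_inv_eq, ap_eq_sum_comc, Preadditive.sum_comp,
    Finset.sum_eq_single (0, k)]
  · rw [Category.assoc, inc_whiskerRight, hE, comp_whiskerRight_assoc, ← h k, Category.assoc]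
  · rintro ⟨i, j⟩ hx hne
    rw [Finset.HasAntidiagonal.mem_antidiagonal] at hx
    rcases i with _ | i
    · exact absurd (by simpa using hx) hne
    · rw [Category.assoc, inc_whiskerRight, (isZero_tensorUnit_succ i).eq_of_tgt (ap E (i + 1)) 0,
        MonoidalPreadditive.zero_whiskerRight, zero_comp, comp_zero]
  · exact fun h' => absurd (by simp) h'

theorem comul_counit_of_components {e : ob A 0 ⟶ 𝟙_ C} (hE : ap E 0 = e ≫ unit₀.inv)
    (h : ∀ k, comc D k 0 k ≫ ob A k ◁ e = (ρ_ (ob A k)).inv) : D ≫ A ◁ E = (ρ_ A).inv := by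
  refine hom_ext fun k => ?_
  rw [ap_comp, rightUnitor_inv_eq, ap_eq_sum_comc, Preadditive.sum_comp,
    Finset.sum_eq_single (k, 0)]
  · rw [Category.assoc, inc_whiskerLeft, hE, whiskerLeft_comp_assoc, ← h k, Category.assoc]
  · rintro ⟨i, j⟩ hx hne
    rw [Finset.HasAntidiagonal.mem_antidiagonal] at hx
    rcases j with _ | j
    · exact absurd (by simpa using hx) hne
    · rw [Category.assoc, inc_whiskerLeft, (isZero_tensorUnit_succ j).eq_of_tgt (ap E (j + 1)) 0,
        MonoidalPreadditive.whiskerLeft_zero, zero_comp, comp_zero]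
  · exact fun h' => absurd (by simp) h'

theorem comul_assoc_of_components
    (h : ∀ i j l a b k, i + j = a → j + l = b → a + l = k →
      comc D a l k ≫ comc D i j a ▷ ob A l ≫ (α_ (ob A i) (ob A j) (ob A l)).hom =
        comc D i b k ≫ ob A i ◁ comc D j l b) :
    D ≫ A ◁ D = D ≫ D ▷ A ≫ (α_ A A A).hom := by
  refine hom_ext fun k => ?_
  simp only [ap_comp]
  have hL : ap D k ≫ ap (A ◁ D) k =
      ∑ x ∈ Finset.HasAntidiagonal.antidiagonal k, ∑ y ∈ Finset.HasAntidiagonal.antidiagonal x.2,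
        comc D x.1 (y.1 + y.2) k ≫ (ob A x.1 ◁ comc D y.1 y.2 (y.1 + y.2)) ≫
          (ob A x.1 ◁ inc A A y.1 y.2 (y.1 + y.2)) ≫ inc A (A ⊗ A) x.1 (y.1 + y.2) k := by
    rw [ap_eq_sum_comc, Preadditive.sum_comp]
    refine Finset.sum_congr rfl fun x _ => ?_
    rw [Category.assoc, inc_whiskerLeft, ap_eq_sum_comc, whiskerLeft_sum, Preadditive.sum_comp,
      Preadditive.comp_sum]
    refine Finset.sum_congr rfl fun y hy => ?_
    rw [Finset.HasAntidiagonal.mem_antidiagonal.1 hy, whiskerLeft_comp_assoc]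
  have hR : ap D k ≫ ap (D ▷ A) k ≫ ap (α_ A A A).hom k =
      ∑ x ∈ Finset.HasAntidiagonal.antidiagonal k, ∑ y ∈ Finset.HasAntidiagonal.antidiagonal x.1,
        comc D y.1 (y.2 + x.2) k ≫ (ob A y.1 ◁ comc D y.2 x.2 (y.2 + x.2)) ≫
          (ob A y.1 ◁ inc A A y.2 x.2 (y.2 + x.2)) ≫ inc A (A ⊗ A) y.1 (y.2 + x.2) k := by
    rw [ap_eq_sum_comc, Preadditive.sum_comp]
    refine Finset.sum_congr rfl fun x hx => ?_
    rw [Category.assoc, reassoc_of% @inc_whiskerRight, ap_eq_sum_comc, sum_whiskerRight,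
      Preadditive.sum_comp, Preadditive.comp_sum]
    refine Finset.sum_congr rfl fun y hy => ?_
    have hx' := Finset.HasAntidiagonal.mem_antidiagonal.1 hx
    have hy' := Finset.HasAntidiagonal.mem_antidiagonal.1 hy
    rw [comp_whiskerRight_assoc, inc_associator A A A hy' rfl hx',
      ← reassoc_of% h y.1 y.2 x.2 x.1 _ k hy' rfl hx']
  rw [hL, hR, sum_antidiagonal_assoc k fun i j l => comc D i (j + l) k ≫
    (ob A i ◁ comc D j l (j + l)) ≫ (ob A i ◁ inc A A j l (j + l)) ≫ inc A (A ⊗ A) i (j + l) k]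

theorem one_comul_of_components {u : 𝟙_ C ⟶ ob A 0} (hU : ap U 0 = unit₀.hom ≫ u)
    (h : u ≫ comc D 0 0 0 = (λ_ (𝟙_ C)).inv ≫ (u ⊗ₘ u)) :
    U ≫ D = (λ_ (𝟙_ (NGraded C))).inv ≫ (U ⊗ₘ U) := by
  refine unit_ext ?_
  rw [ap_comp, ap_comp, ap_eq_sum_comc, leftUnitor_inv_eq, hU]
  simp only [Finset.HasAntidiagonal.antidiagonal_zero, Finset.sum_singleton, Category.assoc]
  rw [reassoc_of% h, inc_tensorHom, hU, ← MonoidalCategory.tensorHom_comp_tensorHom_assoc,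
    MonoidalCategory.tensorHom_def unit₀.hom, Category.assoc, inv_hom_whiskerRight_assoc,
    leftUnitor_inv_naturality_assoc]

theorem mul_counit_of_components {e : ob A 0 ⟶ 𝟙_ C} (hE : ap E 0 = e ≫ unit₀.inv)
    (h : mulc M 0 0 0 ≫ e = (e ⊗ₘ e) ≫ (λ_ (𝟙_ C)).hom) :
    M ≫ E = (E ⊗ₘ E) ≫ (λ_ (𝟙_ (NGraded C))).hom := by
  refine counit_ext (tensor_hom_ext fun i j hij => ?_)
  obtain rfl : i = 0 := by omega
  obtain rfl : j = 0 := by omega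
  have h' := h =≫ unit₀.inv
  simp only [mulc, Category.assoc] at h'
  rw [ap_comp, ap_comp, reassoc_of% @inc_tensorHom, inc_leftUnitor, hE, h',
    ← MonoidalCategory.tensorHom_comp_tensorHom_assoc, MonoidalCategory.tensorHom_def' unit₀.inv,
    Category.assoc, inv_hom_whiskerRight_assoc, leftUnitor_naturality]

theorem antipode_left_of_components {u : 𝟙_ C ⟶ ob A 0} {e : ob A 0 ⟶ 𝟙_ C}
    (hU : ap U 0 = unit₀.hom ≫ u) (hE : ap E 0 = e ≫ unit₀.inv)
    (h₀ : comc D 0 0 0 ≫ ap S 0 ▷ ob A 0 ≫ mulc M 0 0 0 = e ≫ u)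
    (h : ∀ k, ∑ x ∈ Finset.HasAntidiagonal.antidiagonal (k + 1), comc D x.1 x.2 (k + 1) ≫
      ap S x.1 ▷ ob A x.2 ≫ mulc M x.1 x.2 (k + 1) = 0) :
    D ≫ S ▷ A ≫ M = E ≫ U := by
  refine hom_ext fun k => ?_
  have e : ap (D ≫ S ▷ A ≫ M) k = ∑ x ∈ Finset.HasAntidiagonal.antidiagonal k, comc D x.1 x.2 k ≫
      ap S x.1 ▷ ob A x.2 ≫ mulc M x.1 x.2 k := by
    rw [ap_comp, ap_comp, ap_eq_sum_comc, Preadditive.sum_comp]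
    refine Finset.sum_congr rfl fun x _ => ?_
    rw [Category.assoc, reassoc_of% @inc_whiskerRight]
    rfl
  rw [e]
  rcases k with _ | k
  · simp only [Finset.HasAntidiagonal.antidiagonal_zero, Finset.sum_singleton]
    rw [h₀, ap_comp, hU, hE, Category.assoc, Iso.inv_hom_id_assoc]
  · rw [h, ap_comp, (isZero_tensorUnit_succ k).eq_of_tgt (ap E (k + 1)) 0, zero_comp]

theorem antipode_right_of_components {u : 𝟙_ C ⟶ ob A 0} {e : ob A 0 ⟶ 𝟙_ C}
    (hU : ap U 0 = unit₀.hom ≫ u) (hE : ap E 0 = e ≫ unit₀.inv)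
    (h₀ : comc D 0 0 0 ≫ ob A 0 ◁ ap S 0 ≫ mulc M 0 0 0 = e ≫ u)
    (h : ∀ k, ∑ x ∈ Finset.HasAntidiagonal.antidiagonal (k + 1), comc D x.1 x.2 (k + 1) ≫
      ob A x.1 ◁ ap S x.2 ≫ mulc M x.1 x.2 (k + 1) = 0) :
    D ≫ A ◁ S ≫ M = E ≫ U := by
  refine hom_ext fun k => ?_
  have e : ap (D ≫ A ◁ S ≫ M) k = ∑ x ∈ Finset.HasAntidiagonal.antidiagonal k, comc D x.1 x.2 k ≫
      ob A x.1 ◁ ap S x.2 ≫ mulc M x.1 x.2 k := by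
    rw [ap_comp, ap_comp, ap_eq_sum_comc, Preadditive.sum_comp]
    refine Finset.sum_congr rfl fun x _ => ?_
    rw [Category.assoc, reassoc_of% @inc_whiskerLeft]
    rfl
  rw [e]
  rcases k with _ | k
  · simp only [Finset.HasAntidiagonal.antidiagonal_zero, Finset.sum_singleton]
    rw [h₀, ap_comp, hU, hE, Category.assoc, Iso.inv_hom_id_assoc]
  · rw [h, ap_comp, (isZero_tensorUnit_succ k).eq_of_tgt (ap E (k + 1)) 0, zero_comp]

variable [BraidedCategory C]

/-- In degrees `p, q` and `k, l` the compatibility of multiplication and comultiplication is a sum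
over the ways to split `p` and `q`. Only the summands with `x.1 + y.1 = k` contribute, since the
components `mulc M i j k` with `i + j ≠ k` vanish. -/
theorem mul_comul_of_components
    (h : ∀ p q k l N, p + q = N → k + l = N → mulc M p q N ≫ comc D k l N =
      ∑ x ∈ Finset.HasAntidiagonal.antidiagonal p, ∑ y ∈ Finset.HasAntidiagonal.antidiagonal q,
        ((-1 : ℤ) ^ (x.2 * y.1)) • ((comc D x.1 x.2 p ⊗ₘ comc D y.1 y.2 q) ≫
          tensorμ (ob A x.1) (ob A x.2) (ob A y.1) (ob A y.2) ≫
            (mulc M x.1 y.1 k ⊗ₘ mulc M x.2 y.2 l))) :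
    M ≫ D = (D ⊗ₘ D) ≫ tensorμ A A A A ≫ (M ⊗ₘ M) := by
  refine hom_ext fun N => tensor_hom_ext fun p q hpq => tensor_hom_ext' fun k l hkl => ?_
  have e : inc A A p q N ≫ ap (M ≫ D) N ≫ prj A A k l N = mulc M p q N ≫ comc D k l N := by
    simp only [mulc, comc, ap_comp, Category.assoc]
  rw [Category.assoc, e, h p q k l N hpq hkl, ap_comp, ap_comp]
  simp only [Category.assoc]
  rw [reassoc_of% @inc_tensorHom]
  rw [ap_eq_sum_comc D p, ap_eq_sum_comc D q, sum_tensor, Preadditive.sum_comp]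
  refine Finset.sum_congr rfl fun x hx => ?_
  rw [tensor_sum, Preadditive.sum_comp]
  refine Finset.sum_congr rfl fun y hy => ?_
  rw [Finset.HasAntidiagonal.mem_antidiagonal] at hx hy
  have hμ := inc_tensorμ A A A A (a := x.1) (b := x.2) (c := y.1) (d := y.2) hx hy rfl rfl hpq
  rw [← MonoidalCategory.tensorHom_comp_tensorHom_assoc, reassoc_of% hμ]
  rw [Preadditive.zsmul_comp, Preadditive.comp_zsmul]
  simp only [Category.assoc]
  congr 3
  rw [reassoc_of% @inc_tensorHom, mulc, mulc]
  by_cases hk : x.1 + y.1 = k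
  · have hl' : x.2 + y.2 = l := by omega
    rw [hk, hl', inc_prj_self _ _ hkl, Category.comp_id, MonoidalCategory.tensorHom_comp_tensorHom]
  · rw [inc_prj_of_ne _ _ hk, comp_zero, comp_zero, inc_ne _ _ hk]
    simp

/-- The Hopf algebra with given structure morphisms. -/
@[reducible] noncomputable def hopfObjMk (one_mul : U ▷ A ≫ M = (λ_ A).hom)
    (mul_one : A ◁ U ≫ M = (ρ_ A).hom) (mul_assoc : M ▷ A ≫ M = (α_ A A A).hom ≫ A ◁ M ≫ M)
    (counit_comul : D ≫ E ▷ A = (λ_ A).inv) (comul_counit : D ≫ A ◁ E = (ρ_ A).inv)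
    (comul_assoc : D ≫ A ◁ D = D ≫ D ▷ A ≫ (α_ A A A).hom)
    (mul_comul : M ≫ D = (D ⊗ₘ D) ≫ tensorμ A A A A ≫ (M ⊗ₘ M))
    (one_comul : U ≫ D = (λ_ (𝟙_ (NGraded C))).inv ≫ (U ⊗ₘ U))
    (mul_counit : M ≫ E = (E ⊗ₘ E) ≫ (λ_ (𝟙_ (NGraded C))).hom)
    (one_counit : U ≫ E = 𝟙 _)
    (antipode_left : D ≫ S ▷ A ≫ M = E ≫ U) (antipode_right : D ≫ A ◁ S ≫ M = E ≫ U) :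
    HopfObj A where
  one := U
  mul := M
  one_mul := one_mul
  mul_one := mul_one
  mul_assoc := mul_assoc
  counit := E
  comul := D
  counit_comul := counit_comul
  comul_counit := comul_counit
  comul_assoc := comul_assoc
  mul_comul := mul_comul
  one_comul := one_comul
  mul_counit := mul_counit
  one_counit := one_counit
  antipode := S
  antipode_left := antipode_left
  antipode_right := antipode_right

end Components
end BraidedTensor

/-! ### Braids on tensor powers -/

namespace BraidedTensor

section Map

variable {R S : Type*} [Ring R] [Ring S] (f : R →+* S) {φ : ℕ → R} {ψ : ℕ → S}

/-- The graph of a ring homomorphism. -/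
def graphSubring : Subring (R × S) where
  carrier := {p | f p.1 = p.2}
  mul_mem' h h' := (map_mul f _ _).trans (congrArg₂ _ h h')
  one_mem' := map_one f
  add_mem' h h' := (map_add f _ _).trans (congrArg₂ _ h h')
  zero_mem' := map_zero f
  neg_mem' h := (map_neg f _).trans (congrArg _ h)

theorem map_cyc {s t m : ℕ} (h : ∀ i < m, f (φ (s + i)) = ψ (t + i)) :
    f (cyc φ s m) = cyc ψ t m :=
  cyc_pair (graphSubring f) h

theorem map_braidBinom {s t n k : ℕ} (h : ∀ i, i + 1 < n → f (φ (s + i)) = ψ (t + i)) :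
    f (braidBinom φ s n k) = braidBinom ψ t n k :=
  braidBinom_pair (graphSubring f) h

theorem map_braidFact {s t n : ℕ} (h : ∀ i, i + 1 < n → f (φ (s + i)) = ψ (t + i)) :
    f (braidFact φ s n) = braidFact ψ t n :=
  braidFact_pair (graphSubring f) h

theorem map_halfTwist {s t n : ℕ} (h : ∀ i, i + 1 < n → f (φ (s + i)) = ψ (t + i)) :
    f (halfTwist φ s n) = halfTwist ψ t n :=
  halfTwist_pair (graphSubring f) h

theorem map_blockSwap {s t b c : ℕ} (h : ∀ i, i + 1 < b + c → f (φ (s + i)) = ψ (t + i)) :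
    f (blockSwap φ s b c) = blockSwap ψ t b c :=
  blockSwap_pair (graphSubring f) h

theorem map_unop_braidBinom {s t n k : ℕ} (h : ∀ i, i + 1 < n → f (φ (s + i)) = ψ (t + i)) :
    f (braidBinom (fun a => MulOpposite.op (φ a)) s n k).unop =
      (braidBinom (fun a => MulOpposite.op (ψ a)) t n k).unop :=
  congrArg MulOpposite.unop (map_braidBinom f.op (φ := fun a => MulOpposite.op (φ a))
    (ψ := fun a => MulOpposite.op (ψ a)) fun i hi => congrArg MulOpposite.op (h i hi))

end Map

section Tpow

variable {C : Type u} [Category.{v} C] [MonoidalCategory C] (X : C)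

/-- The canonical isomorphism `X ^ ⊗ n ⊗ X ^ ⊗ m ≅ X ^ ⊗ k` for `n + m = k`. -/
def tadd (n m k : ℕ) (h : n + m = k) : tpow X n ⊗ tpow X m ≅ tpow X k :=
  tpowAdd X n m ≪≫ eqToIso (congrArg (tpow X) h)

theorem tadd_zero (n : ℕ) : (tadd X n 0 n rfl).hom = (ρ_ (tpow X n)).hom := by
  exact Category.comp_id _

theorem tadd_rfl (n m : ℕ) : tadd X n m (n + m) rfl = tpowAdd X n m := by
  ext; simp [tadd]

theorem tadd_succ (n m k : ℕ) (h : n + m = k) : (tadd X n (m + 1) (k + 1) (by omega)).hom =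
    (α_ (tpow X n) (tpow X m) X).inv ≫ (tadd X n m k h).hom ▷ X := by
  subst h
  rw [tadd_rfl]
  exact (congrArg Iso.hom (tadd_rfl X n (m + 1))).trans rfl

theorem tadd_zero_left (n : ℕ) (h : 0 + n = n) :
    (tadd X 0 n n h).hom = (λ_ (tpow X n)).hom := by
  induction n with
  | zero => exact (tadd_zero X 0).trans unitors_equal.symm
  | succ n ih => rw [tadd_succ X 0 n n (by omega), ih]; exact (leftUnitor_tensor_hom _ _).symm

theorem tadd_assoc (i j l a b k : ℕ) (ha : i + j = a) (hb : j + l = b) (hk : a + l = k)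
    (hk' : i + b = k) :
    (tadd X i j a ha).hom ▷ tpow X l ≫ (tadd X a l k hk).hom =
      (α_ (tpow X i) (tpow X j) (tpow X l)).hom ≫ tpow X i ◁ (tadd X j l b hb).hom ≫
        (tadd X i b k hk').hom := by
  induction l generalizing b k with
  | zero =>
    obtain rfl : b = j := by omega
    obtain rfl : k = a := by omega
    rw [tadd_zero, tadd_zero]
    have := rightUnitor_naturality (tadd X i b k ha).hom
    simp only [tpow]
    rw [this]
    simp
  | succ l ih =>
    obtain ⟨b', rfl⟩ : ∃ b', b = b' + 1 := ⟨j + l, by omega⟩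
    obtain ⟨k', rfl⟩ : ∃ k', k = k' + 1 := ⟨a + l, by omega⟩
    rw [tadd_succ X a l k' (by omega), tadd_succ X j l b' (by omega),
      tadd_succ X i b' k' (by omega)]
    have := (α_ _ _ _).inv ≫= congrArg (fun f => f ▷ X)
      (ih b' k' (by omega) (by omega) (by omega))
    simp only [comp_whiskerRight, MonoidalCategory.whiskerLeft_comp, Category.assoc] at this ⊢
    simp only [tpow]
    rw [← associator_inv_naturality_left_assoc] at this
    rw [this]
    simp

end Tpow
end BraidedTensor

/-! ### The generators of the braid groups on tensor powers -/

namespace BraidedTensor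

section TpowBraid

variable {C : Type u} [Category.{v} C] [Abelian C] [MonoidalCategory C] [MonoidalPreadditive C]
  (X : C)

theorem end_mul {A : C} (f g : End A) : f * g = (g ≫ f : A ⟶ A) := rfl

theorem neg_whiskerRight' {Y Z : C} (f : Y ⟶ Z) (W : C) : (-f) ▷ W = -(f ▷ W) :=
  Functor.map_neg (tensorRight W)

theorem whiskerLeft_neg' (W : C) {Y Z : C} (f : Y ⟶ Z) : W ◁ (-f) = -(W ◁ f) :=
  Functor.map_neg (tensorLeft W)

/-- Conjugation by an isomorphism as a ring homomorphism. -/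
def conjEnd {A B : C} (t : A ≅ B) : End A →+* End B where
  toFun f := (t.inv ≫ (f : A ⟶ A) ≫ t.hom : B ⟶ B)
  map_one' := show t.inv ≫ 𝟙 A ≫ t.hom = 𝟙 B by simp
  map_mul' f g := show t.inv ≫ ((g : A ⟶ A) ≫ (f : A ⟶ A)) ≫ t.hom =
    (t.inv ≫ (g : A ⟶ A) ≫ t.hom) ≫ (t.inv ≫ (f : A ⟶ A) ≫ t.hom) by simp
  map_zero' := show t.inv ≫ (0 : A ⟶ A) ≫ t.hom = (0 : B ⟶ B) by simp
  map_add' := fun f g : A ⟶ A => show t.inv ≫ (f + g) ≫ t.hom =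
    t.inv ≫ f ≫ t.hom + t.inv ≫ g ≫ t.hom by simp

/-- The ring homomorphism `f ↦ f ▷ B` between endomorphism rings. -/
def whiskerRightEnd (A B : C) : End A →+* End (A ⊗ B) where
  toFun f := (f : A ⟶ A) ▷ B
  map_one' := id_whiskerRight _ _
  map_mul' f g := comp_whiskerRight (g : A ⟶ A) (f : A ⟶ A) B
  map_zero' := MonoidalPreadditive.zero_whiskerRight
  map_add' _ _ := MonoidalPreadditive.add_whiskerRight ..

/-- The ring homomorphism `f ↦ A ◁ f` between endomorphism rings. -/
def whiskerLeftEnd (A B : C) : End B →+* End (A ⊗ B) where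
  toFun f := A ◁ (f : B ⟶ B)
  map_one' := MonoidalCategory.whiskerLeft_id _ _
  map_mul' f g := MonoidalCategory.whiskerLeft_comp A (g : B ⟶ B) (f : B ⟶ B)
  map_zero' := MonoidalPreadditive.whiskerLeft_zero
  map_add' _ _ := MonoidalPreadditive.whiskerLeft_add ..

/-- The ring homomorphism that lets endomorphisms of `X ^ ⊗ n` act on the first `n` factors of
`X ^ ⊗ k`. -/
def actLeft (n m k : ℕ) (h : n + m = k) : End (tpow X n) →+* End (tpow X k) :=
  (conjEnd (tadd X n m k h)).comp (whiskerRightEnd _ _)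

/-- The ring homomorphism that lets endomorphisms of `X ^ ⊗ m` act on the last `m` factors of
`X ^ ⊗ k`. -/
def actRight (n m k : ℕ) (h : n + m = k) : End (tpow X m) →+* End (tpow X k) :=
  (conjEnd (tadd X n m k h)).comp (whiskerLeftEnd _ _)

/-- The ring homomorphism that lets endomorphisms of `X ^ ⊗ n` act on `X ^ ⊗ n ⊗ X`. -/
def whiskerEnd (n : ℕ) : End (tpow X n) →+* End (tpow X (n + 1)) :=
  whiskerRightEnd (tpow X n) X

theorem whiskerRight_tadd (n m k : ℕ) (h : n + m = k) (f : End (tpow X n)) :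
    (f : tpow X n ⟶ tpow X n) ▷ tpow X m ≫ (tadd X n m k h).hom =
      (tadd X n m k h).hom ≫ (actLeft X n m k h f : tpow X k ⟶ tpow X k) :=
  (Iso.hom_inv_id_assoc (tadd X n m k h) _).symm

theorem whiskerLeft_tadd (n m k : ℕ) (h : n + m = k) (f : End (tpow X m)) :
    tpow X n ◁ (f : tpow X m ⟶ tpow X m) ≫ (tadd X n m k h).hom =
      (tadd X n m k h).hom ≫ (actRight X n m k h f : tpow X k ⟶ tpow X k) :=
  (Iso.hom_inv_id_assoc (tadd X n m k h) _).symm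

variable [BraidedCategory C]

/-- The operator `-ψ_a` on `X ^ ⊗ n`, extended by `0` to all indices `a`. -/
noncomputable def gen (n a : ℕ) : End (tpow X n) := if a + 1 < n then -adjBraid X n a else 0

theorem gen_of_lt {n a : ℕ} (h : a + 1 < n) : gen X n a = -adjBraid X n a := if_pos h

theorem gen_of_le {n a : ℕ} (h : n ≤ a + 1) : gen X n a = 0 := if_neg h.not_gt

theorem gen_last (n : ℕ) : gen X (n + 2) n =
    -((α_ (tpow X n) X X).hom ≫ tpow X n ◁ (β_ X X).hom ≫ (α_ (tpow X n) X X).inv) := by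
  rw [gen_of_lt X (by omega)]
  exact congrArg Neg.neg (if_pos rfl)

theorem whiskerEnd_gen {n a : ℕ} (h : a + 1 < n) :
    whiskerEnd X n (gen X n a) = gen X (n + 1) a := by
  rw [gen_of_lt X h, gen_of_lt X (by omega)]
  obtain ⟨n, rfl⟩ : ∃ m, n = m + 1 := ⟨n - 1, by omega⟩
  have : adjBraid X (n + 2) a = adjBraid X (n + 1) a ▷ X := if_neg (by omega)
  erw [this]
  exact neg_whiskerRight' _ _

/-- The Yang-Baxter equation for the braiding of the last two and of the preceding two factors of
`P ⊗ X ⊗ X ⊗ X`. -/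
theorem braid_relation (P : C) :
    let s₀ := ((α_ P X X).hom ≫ P ◁ (β_ X X).hom ≫ (α_ P X X).inv) ▷ X
    let s₁ := (α_ (P ⊗ X) X X).hom ≫ (P ⊗ X) ◁ (β_ X X).hom ≫ (α_ (P ⊗ X) X X).inv
    s₀ ≫ s₁ ≫ s₀ = s₁ ≫ s₀ ≫ s₁ := by
  intro s₀ s₁
  -- Both operators act on the factor `(X ⊗ X) ⊗ X` of `P ⊗ ((X ⊗ X) ⊗ X)`.
  let φ : ((P ⊗ X) ⊗ X) ⊗ X ≅ P ⊗ ((X ⊗ X) ⊗ X) :=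
    whiskerRightIso (α_ P X X) X ≪≫ α_ P (X ⊗ X) X
  have h₀ : s₀ = φ.hom ≫ P ◁ ((β_ X X).hom ▷ X) ≫ φ.inv := by
    simp [φ, s₀]
  have h₁ : s₁ = φ.hom ≫ P ◁ ((α_ X X X).hom ≫ X ◁ (β_ X X).hom ≫ (α_ X X X).inv) ≫ φ.inv := by
    simp only [s₁, φ, Iso.trans_hom, Iso.trans_inv, whiskerRightIso_hom, whiskerRightIso_inv]
    monoidal
  have yb := φ.hom ≫= (congrArg (fun f => P ◁ f)
    ((α_ X X X).hom ≫= BraidedCategory.yang_baxter X X X =≫ (α_ X X X).inv)) =≫ φ.inv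
  simp only [MonoidalCategory.whiskerLeft_comp, Category.assoc] at yb
  rw [h₀, h₁]
  simp only [Iso.inv_hom_id_assoc, MonoidalCategory.whiskerLeft_comp, Category.assoc]
  simpa using yb

theorem gen_braid_last (n : ℕ) :
    gen X (n + 3) n * gen X (n + 3) (n + 1) * gen X (n + 3) n =
      gen X (n + 3) (n + 1) * gen X (n + 3) n * gen X (n + 3) (n + 1) := by
  have key (a b : End (tpow X (n + 3))) (ha : gen X (n + 3) n = -a)
      (hb : gen X (n + 3) (n + 1) = -b) (h : a * b * a = b * a * b) :
      gen X (n + 3) n * gen X (n + 3) (n + 1) * gen X (n + 3) n =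
        gen X (n + 3) (n + 1) * gen X (n + 3) n * gen X (n + 3) (n + 1) := by
    rw [ha, hb]
    simp only [neg_mul, mul_neg, neg_neg, h]
  refine key _ _ ?_ (gen_last X (n + 1)) (braid_relation X (tpow X n))
  rw [← whiskerEnd_gen X (by omega), gen_last]
  exact neg_whiskerRight' _ _

theorem whiskerRight_commute {P : C} (f : P ⟶ P) (b : X ⊗ X ⟶ X ⊗ X) :
    ((α_ P X X).hom ≫ P ◁ b ≫ (α_ P X X).inv) ≫ f ▷ X ▷ X =
      f ▷ X ▷ X ≫ (α_ P X X).hom ≫ P ◁ b ≫ (α_ P X X).inv := by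
  rw [associator_naturality_left_assoc, ← whisker_exchange_assoc]
  simp

/-- Tensoring the braiding of the last two factors with `P` on the left gives the braiding of the
last two factors again. -/
theorem whiskerLeft_last {P Q R : C} (t : P ⊗ Q ⟶ R) (b : X ⊗ X ⟶ X ⊗ X) :
    P ◁ ((α_ Q X X).hom ≫ Q ◁ b ≫ (α_ Q X X).inv) ≫
        (α_ P (Q ⊗ X) X).inv ≫ ((α_ P Q X).inv ≫ t ▷ X) ▷ X =
      ((α_ P (Q ⊗ X) X).inv ≫ ((α_ P Q X).inv ≫ t ▷ X) ▷ X) ≫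
        (α_ R X X).hom ≫ R ◁ b ≫ (α_ R X X).inv := by
  simp only [comp_whiskerRight, Category.assoc]
  rw [associator_naturality_left_assoc, ← whisker_exchange_assoc]
  simp

/-- Generators that do not involve the last factor come from `X ^ ⊗ n` by `whiskerEnd`, so that only
the relations with the last generator are to be checked. -/
theorem isBraidSeq_gen (n : ℕ) : IsBraidSeq (gen X n) := by
  induction n with
  | zero =>
    exact ⟨fun a => by simp [gen_of_le X (Nat.zero_le _)],
      fun a b _ => by rw [gen_of_le X (Nat.zero_le _)]; exact Commute.zero_left _⟩
  | succ n ih =>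
    constructor
    · intro a
      rcases lt_trichotomy (a + 2) n with h | h | h
      · rw [← whiskerEnd_gen X (by omega), ← whiskerEnd_gen X (by omega), ← map_mul, ← map_mul,
          ih.braid, map_mul, map_mul]
      · subst h
        exact gen_braid_last X a
      · rw [gen_of_le X (a := a + 1) (by omega)]
        simp
    · intro a b hab
      rcases lt_trichotomy (b + 1) n with h | h | h
      · rw [← whiskerEnd_gen X (by omega), ← whiskerEnd_gen X (by omega)]
        exact (ih.comm a b hab).map (whiskerEnd X n)
      · subst h
        rw [gen_last, ← whiskerEnd_gen X (n := b + 1) (by omega),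
          ← whiskerEnd_gen X (n := b) (by omega)]
        exact Commute.neg_right (whiskerRight_commute X (gen X b a : tpow X b ⟶ tpow X b) _)
      · rw [gen_of_le X (a := b) (by omega)]
        exact Commute.zero_right _

theorem actLeft_gen {n m k : ℕ} (h : n + m = k) {a : ℕ} (ha : a + 1 < n) :
    actLeft X n m k h (gen X n a) = gen X k a := by
  suffices (gen X n a : tpow X n ⟶ tpow X n) ▷ tpow X m ≫ (tadd X n m k h).hom =
      (tadd X n m k h).hom ≫ (gen X k a : tpow X k ⟶ tpow X k) by
    rw [whiskerRight_tadd, Iso.cancel_iso_hom_left] at this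
    exact this
  induction m generalizing k with
  | zero =>
    obtain rfl : k = n := by omega
    rw [tadd_zero]
    exact rightUnitor_naturality _
  | succ m ih =>
    obtain ⟨k', rfl⟩ : ∃ k', k = k' + 1 := ⟨n + m, by omega⟩
    rw [tadd_succ X n m k' (by omega), ← whiskerEnd_gen X (by omega)]
    have := congrArg (fun f => (α_ _ _ X).inv ≫ f ▷ X) (ih (k := k') (by omega))
    simp only [comp_whiskerRight] at this
    rw [← associator_inv_naturality_left_assoc] at this
    exact this.trans (Category.assoc _ _ _).symm

theorem actRight_gen {n m k : ℕ} (h : n + m = k) {a : ℕ} (ha : a + 1 < m) :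
    actRight X n m k h (gen X m a) = gen X k (n + a) := by
  suffices tpow X n ◁ (gen X m a : tpow X m ⟶ tpow X m) ≫ (tadd X n m k h).hom =
      (tadd X n m k h).hom ≫ (gen X k (n + a) : tpow X k ⟶ tpow X k) by
    rw [whiskerLeft_tadd, Iso.cancel_iso_hom_left] at this
    exact this
  induction m generalizing k with
  | zero => omega
  | succ m ih =>
    obtain ⟨k', rfl⟩ : ∃ k', k = k' + 1 := ⟨n + m, by omega⟩
    rcases lt_or_ge (a + 1) m with h' | h'
    · rw [tadd_succ X n m k' (by omega), ← whiskerEnd_gen X (by omega),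
          ← whiskerEnd_gen X (by omega)]
      have := congrArg (fun f => (α_ _ _ X).inv ≫ f ▷ X) (ih (k := k') (by omega) h')
      simp only [comp_whiskerRight] at this
      rw [← associator_inv_naturality_middle_assoc] at this
      exact this.trans (Category.assoc _ _ _).symm
    · obtain rfl : m = a + 1 := by omega
      obtain ⟨k, rfl⟩ : ∃ k, k' = k + 1 := ⟨n + a, by omega⟩
      obtain rfl : n + a = k := by omega
      rw [tadd_succ X n (a + 1) (n + a + 1) (by omega), tadd_succ X n a (n + a) rfl, gen_last,
        gen_last]
      refine (congrArg (· ≫ _) (whiskerLeft_neg' _ _)).trans ((Preadditive.neg_comp _ _).trans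
        (Eq.trans ?_ (Preadditive.comp_neg _ _).symm))
      exact congrArg Neg.neg (whiskerLeft_last X _ _)

end TpowBraid
end BraidedTensor

/-! ### Permutations and the braiding of tensor powers -/

namespace BraidedTensor

section PermBraid

variable {C : Type u} [Category.{v} C] [Abelian C] [MonoidalCategory C] [MonoidalPreadditive C]
  [BraidedCategory C] (X : C)

theorem sign_smul_wordBraid {n : ℕ} (w : List (Fin (n - 1))) :
    ((-1 : ℤ) ^ w.length) • wordBraid X n w =
      ((w.map fun a : Fin (n - 1) => gen X n a).prod : tpow X n ⟶ tpow X n) := by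
  induction w with
  | nil => exact one_smul _ _
  | cons a w ih =>
    rw [List.map_cons, List.prod_cons, end_mul, ← ih, gen_of_lt X (by omega), List.length_cons,
      pow_succ, mul_neg_one, neg_smul]
    exact ((Preadditive.comp_neg _ _).trans (congrArg Neg.neg (Preadditive.zsmul_comp _ _ _))).symm

/-- The sign of a permutation turns the product of the `ψ_a` into the product of the generators
`-ψ_a`. -/
theorem sign_smul_permBraid {n : ℕ} (σ : Equiv.Perm (Fin n)) :
    ((-1 : ℤ) ^ permLength σ) • permBraid X σ = (insLift (gen X n) σ : End (tpow X n)) := by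
  have h := (exists_reducedWord σ).choose_spec
  rw [← prod_reducedWord (isBraidSeq_gen X n) h]
  exact sign_smul_wordBraid X _

theorem multinomial_eq {n : ℕ} (b : Fin n → ℕ) :
    multinomial X b = (shuffleSum (gen X n) b : End (tpow X n)) := by
  classical
  rw [multinomial, Finset.sum_filter, shuffleSum]
  refine Finset.sum_congr rfl fun σ _ => ?_
  rw [sign_smul_permBraid]

theorem multinomial_twoBlocks (n m : ℕ) :
    multinomial X (twoBlocks n m) =
      (braidBinom (gen X (n + m)) 0 (n + m) n : End (tpow X (n + m))) := by
  rw [multinomial_eq, ← shuffleSum_twoBlocks (n + m) n (by omega)]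
  rfl

theorem dualMultinomial_twoBlocks (n m : ℕ) :
    dualMultinomial X (twoBlocks n m) =
      ((braidBinom (fun a => MulOpposite.op (gen X (n + m) a)) 0 (n + m) n).unop :
        End (tpow X (n + m))) := by
  classical
  rw [← shuffleSum_twoBlocks (n + m) n (by omega), ← sum_shuffle_inv (isBraidSeq_gen X (n + m)),
    dualMultinomial, Finset.sum_filter]
  refine Finset.sum_congr rfl fun σ _ => ?_
  rw [sign_smul_permBraid]
  rfl

theorem braidedFactorial_eq (n : ℕ) :
    braidedFactorial X n = (braidFact (gen X n) 0 n : End (tpow X n)) := by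
  rw [braidedFactorial, multinomial_eq, shuffleSum_of_injective _ Fin.val_injective]

theorem permLength_revPerm (n : ℕ) :
    permLength (Fin.revPerm : Equiv.Perm (Fin n)) = n.choose 2 := by
  refine (length_reducedWord (exists_reducedWord _).choose_spec).trans ?_
  induction n with
  | zero => rfl
  | succ n ih =>
    rw [revPerm_succ, insLength_insPerm, ih, Nat.choose_succ_succ', Nat.choose_one_right]
    rfl

theorem antipodeComponent_eq (n : ℕ) :
    antipodeComponent X n = ((-1) ^ n * halfTwist (gen X n) 0 n : End (tpow X n)) := by
  rw [antipodeComponent, ← insLift_revPerm, ← sign_smul_permBraid, permLength_revPerm, pow_add,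
    mul_smul]
  rcases neg_one_pow_eq_or ℤ n with h | h
  · have h' : ((-1) ^ n : End (tpow X n)) = 1 := by
      simpa using congrArg (Int.cast : ℤ → End (tpow X n)) h
    rw [h, h', one_mul, one_smul]
  · have h' : ((-1) ^ n : End (tpow X n)) = -1 := by
      simpa using congrArg (Int.cast : ℤ → End (tpow X n)) h
    rw [h, h', neg_one_mul, neg_one_smul]

end PermBraid

section BlockBraiding

variable {C : Type u} [Category.{v} C] [MonoidalCategory C] (X : C)

/-- The canonical morphism `X ⊗ X ^ ⊗ n ⟶ X ^ ⊗ (n + 1)`. -/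
def tcons : (n : ℕ) → (X ⊗ tpow X n ⟶ tpow X (n + 1))
  | 0 => (ρ_ X).hom ≫ (λ_ X).inv
  | n + 1 => (α_ X (tpow X n) X).inv ≫ tcons n ▷ X

/-- The factor `X` between two tensor powers can be joined to either of them. -/
theorem associator_inv_tadd (m n k : ℕ) (h : m + 1 + n = k) (h' : m + (n + 1) = k) :
    (α_ (tpow X m) X (tpow X n)).inv ≫ (tadd X (m + 1) n k h).hom =
      tpow X m ◁ tcons X n ≫ (tadd X m (n + 1) k h').hom := by
  induction n generalizing k with
  | zero =>
    obtain rfl : k = m + 1 := by omega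
    rw [tadd_zero, tadd_succ X m 0 m rfl, tadd_zero]
    simp only [tpow, tcons]
    monoidal
  | succ n ih =>
    obtain ⟨k', rfl⟩ : ∃ k', k = k' + 1 := ⟨m + n + 1, by omega⟩
    rw [tadd_succ X (m + 1) n k' (by omega), tadd_succ X m (n + 1) k' (by omega)]
    have := (α_ (tpow X m) (X ⊗ tpow X n) X).inv ≫=
      congrArg (fun f => f ▷ X) (ih k' (by omega) (by omega))
    simp only [comp_whiskerRight, ← associator_inv_naturality_middle_assoc] at this
    simp only [tpow, tcons, MonoidalCategory.whiskerLeft_comp, Category.assoc]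
    erw [← this]
    simp [tpow]

variable [Abelian C] [MonoidalPreadditive C] [BraidedCategory C]

theorem braiding_tensor_tcons {P R : C} (t : X ⊗ P ⟶ R) (x : ℤ) :
    -(x • ((β_ (P ⊗ X) X).hom ≫ (α_ X P X).inv ≫ t ▷ X)) =
      (-((α_ P X X).hom ≫ P ◁ (β_ X X).hom ≫ (α_ P X X).inv)) ≫
        (x • ((β_ P X).hom ≫ t)) ▷ X := by
  rw [zsmul_whiskerRight', Preadditive.neg_comp, Preadditive.comp_zsmul, comp_whiskerRight,
    BraidedCategory.braiding_tensor_left_hom]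
  simp

/-- The induction step for `braiding_tadd`: the braiding of `P` and `Q ⊗ X` is the braiding of `P`
and `Q`, followed by the braiding of `P` and `X`. -/
theorem braiding_tensor_tadd {P Q R : C} {B : R ⟶ R} {t : P ⊗ Q ⟶ R} {s : Q ⊗ P ⟶ R}
    {s' : (Q ⊗ X) ⊗ P ⟶ R ⊗ X} {w : X ⊗ P ⟶ P ⊗ X} {c : P ⊗ X ⟶ P ⊗ X} {E : R ⊗ X ⟶ R ⊗ X}
    {x y : ℤ} (hB : x • ((β_ P Q).hom ≫ s) = t ≫ B) (hc : y • ((β_ P X).hom ≫ w) = c)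
    (hE : Q ◁ c ≫ (α_ Q P X).inv ≫ s ▷ X = ((α_ Q P X).inv ≫ s ▷ X) ≫ E)
    (hs : (α_ Q X P).inv ≫ s' = Q ◁ w ≫ (α_ Q P X).inv ≫ s ▷ X) :
    (x * y) • ((β_ P (Q ⊗ X)).hom ≫ s') = ((α_ P Q X).inv ≫ t ▷ X) ≫ B ▷ X ≫ E := by
  have h₁ := hE
  rw [← hc, whiskerLeft_zsmul', MonoidalCategory.whiskerLeft_comp, Preadditive.zsmul_comp,
    Category.assoc, ← hs, Category.assoc] at h₁
  rw [Category.assoc, ← comp_whiskerRight_assoc, ← hB, zsmul_whiskerRight', comp_whiskerRight,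
    Preadditive.zsmul_comp, Category.assoc, ← Iso.hom_inv_id_assoc (α_ Q P X) (s ▷ X ≫ E), ← h₁]
  simp [mul_smul]

/-- The signed braiding of `X ^ ⊗ n` and `X` pulls the last strand across the first `n` strands. -/
theorem braiding_tcons (n : ℕ) : ((-1 : ℤ) ^ n) • ((β_ (tpow X n) X).hom ≫ tcons X n) =
    (cyc (gen X (n + 1)) 0 n : End (tpow X (n + 1))) := by
  induction n with
  | zero =>
    change (1 : ℤ) • ((β_ (𝟙_ C) X).hom ≫ (ρ_ X).hom ≫ (λ_ X).inv) = 𝟙 (𝟙_ C ⊗ X)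
    rw [one_smul]
    simp
  | succ n ih =>
    have h₁ : cyc (gen X (n + 2)) 0 n = whiskerEnd X (n + 1) (cyc (gen X (n + 1)) 0 n) :=
      (map_cyc _ fun i hi => by simpa using whiskerEnd_gen X (by omega)).symm
    have h₂ : (cyc (gen X (n + 2)) 0 (n + 1) : End (tpow X (n + 2))) =
        (-((α_ (tpow X n) X X).hom ≫ tpow X n ◁ (β_ X X).hom ≫ (α_ (tpow X n) X X).inv)) ≫
          ((cyc (gen X (n + 1)) 0 n : End (tpow X (n + 1))) :
            tpow X (n + 1) ⟶ tpow X (n + 1)) ▷ X := by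
      rw [cyc_succ, h₁, zero_add, gen_last]
      rfl
    rw [pow_succ, mul_neg_one, neg_smul]
    refine (braiding_tensor_tcons X (tcons X n) _).trans (Eq.trans ?_ h₂.symm)
    exact congrArg (fun f : tpow X (n + 1) ⟶ tpow X (n + 1) => (-((α_ (tpow X n) X X).hom ≫
      tpow X n ◁ (β_ X X).hom ≫ (α_ (tpow X n) X X).inv)) ≫ f ▷ X) ih

/-- The signed braiding of `X ^ ⊗ n` and `X ^ ⊗ m` exchanges the first `n` with the last `m`
strands. -/
theorem braiding_tadd (n m k : ℕ) (h : n + m = k) (h' : m + n = k) :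
    ((-1 : ℤ) ^ (n * m)) • ((β_ (tpow X n) (tpow X m)).hom ≫ (tadd X m n k h').hom) =
      (tadd X n m k h).hom ≫ (blockSwap (gen X k) 0 n m : End (tpow X k)) := by
  induction m generalizing k with
  | zero =>
    obtain rfl : k = n := by omega
    rw [tadd_zero, tadd_zero_left, mul_zero, pow_zero, one_smul]
    change (β_ (tpow X k) (𝟙_ C)).hom ≫ _ = (ρ_ (tpow X k)).hom ≫ 𝟙 _
    simp
  | succ m ih =>
    obtain ⟨k', rfl⟩ : ∃ k', k = k' + 1 := ⟨n + m, by omega⟩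
    have h₁ : blockSwap (gen X (k' + 1)) 0 n m = whiskerEnd X k' (blockSwap (gen X k') 0 n m) :=
      (map_blockSwap _ fun i hi => by simpa using whiskerEnd_gen X (by omega)).symm
    have h₂ : cyc (gen X (k' + 1)) m n =
        actRight X m (n + 1) (k' + 1) (by omega) (cyc (gen X (n + 1)) 0 n) :=
      (map_cyc _ fun i hi => by simpa using actRight_gen X _ (by omega)).symm
    have h₃ : (blockSwap (gen X (k' + 1)) 0 n (m + 1) : End (tpow X (k' + 1))) =
        ((blockSwap (gen X k') 0 n m : End (tpow X k')) : tpow X k' ⟶ tpow X k') ▷ X ≫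
          (actRight X m (n + 1) (k' + 1) (by omega) (cyc (gen X (n + 1)) 0 n) :
            tpow X (k' + 1) ⟶ tpow X (k' + 1)) := by
      rw [blockSwap_succ, zero_add, h₁, h₂]
      rfl
    have hE := whiskerLeft_tadd X m (n + 1) (k' + 1) (by omega) (cyc (gen X (n + 1)) 0 n)
    have hs := associator_inv_tadd X m n (k' + 1) (by omega) (by omega)
    rw [tadd_succ X m n k' (by omega)] at hE hs
    rw [h₃, tadd_succ X n m k' (by omega), mul_add_one, pow_add]
    exact braiding_tensor_tadd X (ih k' (by omega) (by omega)) (braiding_tcons X n) hE hs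

/-- The interchange of the two inner factors of `(X ^ ⊗ a ⊗ X ^ ⊗ b) ⊗ (X ^ ⊗ c ⊗ X ^ ⊗ d)`, with
the sign of the graded braiding, exchanges the inner blocks of strands. -/
theorem tensorμ_tadd {a b c d p q k l N : ℕ} (hp : a + b = p) (hq : c + d = q)
    (hk : a + c = k) (hl : b + d = l) (hN : p + q = N) (hN' : k + l = N) :
    ((-1 : ℤ) ^ (b * c)) • (tensorμ (tpow X a) (tpow X b) (tpow X c) (tpow X d) ≫
      ((tadd X a c k hk).hom ⊗ₘ (tadd X b d l hl).hom) ≫ (tadd X k l N hN').hom) =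
    ((tadd X a b p hp).hom ⊗ₘ (tadd X c d q hq).hom) ≫ (tadd X p q N hN).hom ≫
      (blockSwap (gen X N) a b c : End (tpow X N)) := by
  obtain ⟨r, hr⟩ : ∃ r, b + c = r := ⟨_, rfl⟩
  obtain ⟨m, hm⟩ : ∃ m, r + d = m := ⟨_, rfl⟩
  have h₁ : blockSwap (gen X m) 0 b c = actLeft X r d m hm (blockSwap (gen X r) 0 b c) :=
    (map_blockSwap _ fun i hi => by simpa using actLeft_gen X hm (by omega)).symm
  have h₂ : blockSwap (gen X N) a b c =
      actRight X a m N (by omega) (blockSwap (gen X m) 0 b c) :=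
    (map_blockSwap _ fun i hi => by simpa using actRight_gen X _ (by omega)).symm
  -- The braiding acts on the two inner factors only.
  have inner : ((-1 : ℤ) ^ (b * c)) • ((α_ (tpow X b) (tpow X c) (tpow X d)).inv ≫
      (β_ (tpow X b) (tpow X c)).hom ▷ tpow X d ≫ (α_ (tpow X c) (tpow X b) (tpow X d)).hom ≫
        tpow X c ◁ (tadd X b d l hl).hom ≫ (tadd X c l m (by omega)).hom) =
      tpow X b ◁ (tadd X c d q hq).hom ≫ (tadd X b q m (by omega)).hom ≫
        (blockSwap (gen X m) 0 b c : End (tpow X m)) := by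
    rw [← tadd_assoc X c b d r l m (by omega) hl hm (by omega), h₁, ← comp_whiskerRight_assoc,
      ← Preadditive.comp_zsmul, ← Preadditive.zsmul_comp, ← zsmul_whiskerRight',
      braiding_tadd X b c r hr (by omega), comp_whiskerRight_assoc,
      whiskerRight_tadd, reassoc_of% tadd_assoc X b c d r q m hr hq hm (by omega)]
    simp
  have outer := congrArg (fun f => (α_ _ _ _).hom ≫ tpow X a ◁ f ≫
    (tadd X a m N (by omega)).hom) inner
  simp only [whiskerLeft_zsmul', MonoidalCategory.whiskerLeft_comp, Category.assoc,
    Preadditive.zsmul_comp, Preadditive.comp_zsmul] at outer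
  rw [whiskerLeft_tadd, ← h₂] at outer
  simp only [tensorμ, Category.assoc]
  have e₁ := tadd_assoc X a c l k m N hk (by omega) (by omega) (by omega)
  have e₂ := tadd_assoc X a b q p m N hp (by omega) (by omega) (by omega)
  rw [MonoidalCategory.tensorHom_def', MonoidalCategory.tensorHom_def', Category.assoc,
    Category.assoc, e₁, reassoc_of% e₂, tensor_whiskerLeft, tensor_whiskerLeft]
  simp only [Category.assoc, Iso.inv_hom_id_assoc]
  exact outer

end BlockBraiding
end BraidedTensor

/-! ### The tensor Hopf algebra and its dual -/

namespace BraidedTensor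

/-- Both sides sum over the `2 × 2` matrices of natural numbers with row sums `p`, `q` and column
sums `k`, `l`. -/
theorem sum_antidiagonal_transpose {M : Type*} [AddCommMonoid M] {p q k l : ℕ} (h : p + q = k + l)
    (f : ℕ → ℕ → ℕ → ℕ → M) :
    (∑ x ∈ Finset.HasAntidiagonal.antidiagonal p, ∑ y ∈ Finset.HasAntidiagonal.antidiagonal q,
      if x.1 + y.1 = k then f x.1 x.2 y.1 y.2 else 0) =
    ∑ x ∈ Finset.HasAntidiagonal.antidiagonal k, ∑ y ∈ Finset.HasAntidiagonal.antidiagonal l,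
      if x.1 + y.1 = p then f x.1 y.1 x.2 y.2 else 0 := by
  rw [← Finset.sum_product', ← Finset.sum_product', ← Finset.sum_filter, ← Finset.sum_filter]
  refine Finset.sum_bij' (fun x _ => ((x.1.1, x.2.1), (x.1.2, x.2.2)))
    (fun x _ => ((x.1.1, x.2.1), (x.1.2, x.2.2))) ?_ ?_ (fun _ _ => rfl) (fun _ _ => rfl)
    (fun _ _ => rfl)
  · rintro ⟨⟨a, b⟩, ⟨c, d⟩⟩ h
    simp only [Finset.mem_filter, Finset.mem_product,
      Finset.HasAntidiagonal.mem_antidiagonal] at h ⊢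
    omega
  · rintro ⟨⟨a, b⟩, ⟨c, d⟩⟩ h
    simp only [Finset.mem_filter, Finset.mem_product,
      Finset.HasAntidiagonal.mem_antidiagonal] at h ⊢
    omega

section Binom

variable {C : Type u} [Category.{v} C] [Abelian C] [MonoidalCategory C] [MonoidalPreadditive C]
  [BraidedCategory C] (X : C)

/-- The braided binomial as an endomorphism of `X ^ ⊗ n`. -/
noncomputable def binom (n k : ℕ) : End (tpow X n) := braidBinom (gen X n) 0 n k

/-- The dual braided binomial as an endomorphism of `X ^ ⊗ n`. -/
noncomputable def dualBinom (n k : ℕ) : End (tpow X n) :=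
  (braidBinom (fun a => MulOpposite.op (gen X n a)) 0 n k).unop

theorem actLeft_binom {n m k : ℕ} (h : n + m = k) (i : ℕ) :
    actLeft X n m k h (binom X n i) = braidBinom (gen X k) 0 n i :=
  map_braidBinom _ fun i hi => by simpa using actLeft_gen X h (by omega)

theorem actRight_binom {n m k : ℕ} (h : n + m = k) (i : ℕ) :
    actRight X n m k h (binom X m i) = braidBinom (gen X k) n m i :=
  map_braidBinom _ fun i hi => by simpa using actRight_gen X h (by omega)

theorem actLeft_dualBinom {n m k : ℕ} (h : n + m = k) (i : ℕ) :
    actLeft X n m k h (dualBinom X n i) =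
      (braidBinom (fun a => MulOpposite.op (gen X k a)) 0 n i).unop :=
  map_unop_braidBinom _ fun i hi => by simpa using actLeft_gen X h (by omega)

theorem actRight_dualBinom {n m k : ℕ} (h : n + m = k) (i : ℕ) :
    actRight X n m k h (dualBinom X m i) =
      (braidBinom (fun a => MulOpposite.op (gen X k a)) n m i).unop :=
  map_unop_braidBinom _ fun i hi => by simpa using actRight_gen X h (by omega)

/-- The identity behind the coassociativity of the tensor algebra. -/
theorem binom_assoc {i j l a b k : ℕ} (ha : i + j = a) (hb : j + l = b) (hk : a + l = k)
    (hk' : i + b = k) :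
    actLeft X a l k hk (binom X a i) * binom X k a =
      actRight X i b k hk' (binom X b j) * binom X k i := by
  rw [actLeft_binom, actRight_binom]
  subst ha
  obtain rfl : k - i = b := by omega
  simpa only [binom, zero_add] using (isBraidSeq_gen X k).braidBinom_mul_braidBinom 0 k i j

/-- The identity behind the associativity of the dual tensor algebra. -/
theorem dualBinom_assoc {i j l a b k : ℕ} (ha : i + j = a) (hb : j + l = b) (hk : a + l = k)
    (hk' : i + b = k) :
    dualBinom X k a * actLeft X a l k hk (dualBinom X a i) =
      dualBinom X k i * actRight X i b k hk' (dualBinom X b j) := by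
  rw [actLeft_dualBinom, actRight_dualBinom]
  subst ha
  obtain rfl : k - i = b := by omega
  simpa only [dualBinom, MulOpposite.unop_mul, zero_add] using congrArg MulOpposite.unop
    ((isBraidSeq_gen X k).op.braidBinom_mul_braidBinom 0 k i j)

/-- The identity behind the compatibility of multiplication and comultiplication in the tensor
algebra. -/
theorem binom_add {p q N : ℕ} (h : p + q = N) (k : ℕ) :
    binom X N k = ∑ x ∈ Finset.HasAntidiagonal.antidiagonal p,
      ∑ y ∈ Finset.HasAntidiagonal.antidiagonal q, if x.1 + y.1 = k then
        blockSwap (gen X N) x.1 x.2 y.1 *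
          (actLeft X p q N h (binom X p x.1) * actRight X p q N h (binom X q y.1)) else 0 := by
  simp only [actLeft_binom, actRight_binom]
  subst h
  simpa only [binom, zero_add] using (isBraidSeq_gen X (p + q)).braidBinom_add' 0 p q k

/-- The identity behind the compatibility of multiplication and comultiplication in the dual tensor
algebra. Reversal exchanges the roles of the two splittings `p + q` and `k + l`. -/
theorem dualBinom_add {p q k l N : ℕ} (h : p + q = N) (h' : k + l = N) :
    dualBinom X N p = ∑ x ∈ Finset.HasAntidiagonal.antidiagonal p,
      ∑ y ∈ Finset.HasAntidiagonal.antidiagonal q, if x.1 + y.1 = k then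
        (actRight X k l N h' (dualBinom X l x.2) * actLeft X k l N h' (dualBinom X k x.1)) *
          blockSwap (gen X N) x.1 x.2 y.1 else 0 := by
  rw [sum_antidiagonal_transpose (h.trans h'.symm) fun a b c _ =>
    (actRight X k l N h' (dualBinom X l b) * actLeft X k l N h' (dualBinom X k a)) *
      blockSwap (gen X N) a b c]
  simp only [actLeft_dualBinom, actRight_dualBinom, ← (isBraidSeq_gen X N).unop_blockSwap,
    ← MulOpposite.unop_mul]
  subst h'
  have := congrArg MulOpposite.unop ((isBraidSeq_gen X (k + l)).op.braidBinom_add' 0 k l p)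
  simp only [zero_add, Finset.unop_sum] at this
  refine this.trans (Finset.sum_congr rfl fun x _ => Finset.sum_congr rfl fun y _ => ?_)
  split_ifs <;> rfl

/-- The antipode in degree `n` as an endomorphism of `X ^ ⊗ n`. -/
noncomputable def antipodeEnd (n : ℕ) : End (tpow X n) := (-1) ^ n * halfTwist (gen X n) 0 n

theorem actLeft_antipodeEnd {n m k : ℕ} (h : n + m = k) :
    actLeft X n m k h (antipodeEnd X n) = (-1) ^ n * halfTwist (gen X k) 0 n := by
  rw [antipodeEnd, map_mul, map_pow, map_neg, map_one]
  exact congrArg _ (map_halfTwist _ fun i hi => by simpa using actLeft_gen X h (by omega))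

theorem actRight_antipodeEnd {n m k : ℕ} (h : n + m = k) :
    actRight X n m k h (antipodeEnd X m) = (-1) ^ m * halfTwist (gen X k) n m := by
  rw [antipodeEnd, map_mul, map_pow, map_neg, map_one]
  exact congrArg _ (map_halfTwist _ fun i hi => by simpa using actRight_gen X h (by omega))

theorem unop_halfTwist_gen {s n k : ℕ} (h : s + n ≤ k) :
    (halfTwist (fun a => MulOpposite.op (gen X k a)) s n).unop = halfTwist (gen X k) s n := by
  obtain ⟨j, hj⟩ := Nat.exists_eq_add_of_le h
  obtain ⟨m, hm⟩ : ∃ m, s + n = m := ⟨_, rfl⟩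
  have hk : m + j = k := by omega
  have hf (i : ℕ) (hi : i + 1 < n) :
      actLeft X m j k hk (actRight X s n m hm (gen X n (0 + i))) = gen X k (s + i) := by
    rw [zero_add, actRight_gen X hm (by omega), actLeft_gen X hk (by omega)]
  have h₁ := map_halfTwist ((actLeft X m j k hk).comp (actRight X s n m hm))
    (φ := gen X n) (ψ := gen X k) hf
  have h₂ := map_halfTwist ((actLeft X m j k hk).comp (actRight X s n m hm)).op
    (φ := fun a => MulOpposite.op (gen X n a)) (ψ := fun a => MulOpposite.op (gen X k a))
    fun i hi => congrArg MulOpposite.op (hf i hi)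
  rw [← h₁, ← h₂, ← unop_halfTwist (isBraidSeq_gen X n)]
  rfl

theorem sum_antipode_left (n : ℕ) (f : ℕ → ℕ → End (tpow X (n + 1)))
    (h : ∀ i j (h : i + j = n + 1),
      f i j = actLeft X i j (n + 1) h (antipodeEnd X i) * binom X (n + 1) i) :
    ∑ x ∈ Finset.HasAntidiagonal.antidiagonal (n + 1), f x.1 x.2 = 0 := by
  rw [Finset.Nat.sum_antidiagonal_eq_sum_range_succ,
    ← (isBraidSeq_gen X (n + 1)).sum_halfTwist_mul_braidBinom 0 n]
  refine Finset.sum_congr rfl fun i hi => ?_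
  rw [h _ _ (by simp at hi; omega), actLeft_antipodeEnd, mul_assoc]
  rfl

theorem sum_antipode_right (n : ℕ) (f : ℕ → ℕ → End (tpow X (n + 1)))
    (h : ∀ i j (h : i + j = n + 1),
      f i j = actRight X i j (n + 1) h (antipodeEnd X j) * binom X (n + 1) i) :
    ∑ x ∈ Finset.HasAntidiagonal.antidiagonal (n + 1), f x.1 x.2 = 0 := by
  rw [Finset.Nat.sum_antidiagonal_eq_sum_range_succ,
    ← (isBraidSeq_gen X (n + 1)).sum_halfTwist_mul_braidBinom' 0 n]
  refine Finset.sum_congr rfl fun i hi => ?_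
  rw [h _ _ (by simp at hi; omega), actRight_antipodeEnd, mul_assoc, zero_add]
  rfl

theorem sum_dual_antipode_left (n : ℕ) (f : ℕ → ℕ → End (tpow X (n + 1)))
    (h : ∀ i j (h : i + j = n + 1),
      f i j = dualBinom X (n + 1) i * actLeft X i j (n + 1) h (antipodeEnd X i)) :
    ∑ x ∈ Finset.HasAntidiagonal.antidiagonal (n + 1), f x.1 x.2 = 0 := by
  have := congrArg MulOpposite.unop
    ((isBraidSeq_gen X (n + 1)).op.sum_halfTwist_mul_braidBinom 0 n)
  rw [Finset.unop_sum] at this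
  rw [Finset.Nat.sum_antidiagonal_eq_sum_range_succ]
  refine (Finset.sum_congr rfl fun i hi => ?_).trans this
  rw [h _ _ (by simp at hi; omega), actLeft_antipodeEnd, MulOpposite.unop_mul, MulOpposite.unop_mul,
    MulOpposite.unop_pow, MulOpposite.unop_neg, MulOpposite.unop_one,
    unop_halfTwist_gen X (s := 0) (n := i) (by simp at hi; omega),
    ((Commute.neg_one_left _).pow_left _).eq, ← mul_assoc]
  rfl

theorem sum_dual_antipode_right (n : ℕ) (f : ℕ → ℕ → End (tpow X (n + 1)))
    (h : ∀ i j (h : i + j = n + 1),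
      f i j = dualBinom X (n + 1) i * actRight X i j (n + 1) h (antipodeEnd X j)) :
    ∑ x ∈ Finset.HasAntidiagonal.antidiagonal (n + 1), f x.1 x.2 = 0 := by
  have := congrArg MulOpposite.unop
    ((isBraidSeq_gen X (n + 1)).op.sum_halfTwist_mul_braidBinom' 0 n)
  rw [Finset.unop_sum] at this
  rw [Finset.Nat.sum_antidiagonal_eq_sum_range_succ]
  refine (Finset.sum_congr rfl fun i hi => ?_).trans this
  rw [h _ _ (by simp at hi; omega), actRight_antipodeEnd, MulOpposite.unop_mul,
    MulOpposite.unop_mul, MulOpposite.unop_pow, MulOpposite.unop_neg,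
    MulOpposite.unop_one, zero_add,
    unop_halfTwist_gen X (s := i) (by simp at hi; omega),
    ((Commute.neg_one_left _).pow_left _).eq, ← mul_assoc]
  rfl

end Binom
end BraidedTensor

/-! ### The laws of the tensor algebras -/

namespace BraidedTensor

section TensorHopf

variable {C : Type u} [Category.{v} C] [Abelian C] [MonoidalCategory C] [MonoidalPreadditive C]
  (X : C)

theorem tadd_inv_whiskerRight {n m k : ℕ} (h : n + m = k) (f : End (tpow X n)) :
    (tadd X n m k h).inv ≫ (f : tpow X n ⟶ tpow X n) ▷ tpow X m =
      (actLeft X n m k h f : tpow X k ⟶ tpow X k) ≫ (tadd X n m k h).inv := by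
  rw [Iso.inv_comp_eq, ← Category.assoc, ← whiskerRight_tadd, Category.assoc, Iso.hom_inv_id,
    Category.comp_id]

theorem tadd_inv_whiskerLeft {n m k : ℕ} (h : n + m = k) (f : End (tpow X m)) :
    (tadd X n m k h).inv ≫ tpow X n ◁ (f : tpow X m ⟶ tpow X m) =
      (actRight X n m k h f : tpow X k ⟶ tpow X k) ≫ (tadd X n m k h).inv := by
  rw [Iso.inv_comp_eq, ← Category.assoc, ← whiskerLeft_tadd, Category.assoc, Iso.hom_inv_id,
    Category.comp_id]

theorem tensorHom_tadd {n m k : ℕ} (h : n + m = k) (f : End (tpow X n)) (g : End (tpow X m)) :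
    ((f : tpow X n ⟶ tpow X n) ⊗ₘ (g : tpow X m ⟶ tpow X m)) ≫ (tadd X n m k h).hom =
      (tadd X n m k h).hom ≫ (actLeft X n m k h f * actRight X n m k h g : End (tpow X k)) := by
  rw [MonoidalCategory.tensorHom_def', Category.assoc, whiskerRight_tadd, end_mul,
    reassoc_of% whiskerLeft_tadd X n m k h g]

theorem tensorHom_tadd' {n m k : ℕ} (h : n + m = k) (f : End (tpow X n)) (g : End (tpow X m)) :
    ((f : tpow X n ⟶ tpow X n) ⊗ₘ (g : tpow X m ⟶ tpow X m)) ≫ (tadd X n m k h).hom =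
      (tadd X n m k h).hom ≫ (actRight X n m k h g * actLeft X n m k h f : End (tpow X k)) := by
  rw [MonoidalCategory.tensorHom_def, Category.assoc, whiskerLeft_tadd, end_mul,
    reassoc_of% whiskerRight_tadd X n m k h f]

theorem tadd_assoc_inv (i j l a b k : ℕ) (ha : i + j = a) (hb : j + l = b) (hk : a + l = k)
    (hk' : i + b = k) :
    (tadd X a l k hk).inv ≫ (tadd X i j a ha).inv ▷ tpow X l ≫
        (α_ (tpow X i) (tpow X j) (tpow X l)).hom =
      (tadd X i b k hk').inv ≫ tpow X i ◁ (tadd X j l b hb).inv := by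
  have e := tadd_assoc X i j l a b k ha hb hk hk'
  rw [Iso.inv_comp_eq, ← cancel_epi ((tadd X i j a ha).hom ▷ tpow X l), reassoc_of% e]
  simp

theorem ap_unitHom_tensor : ap (X := 𝟙_ (NGraded C)) (Y := tensorAlg X) (fun n => unitHom X n) 0 =
    unit₀.hom ≫ (𝟙 (𝟙_ C) : 𝟙_ C ⟶ ob (tensorAlg X) 0) := (Category.comp_id _).symm

theorem ap_unitHom_dual : ap (X := 𝟙_ (NGraded C)) (Y := dualTensorAlg X) (fun n => unitHom X n) 0 =
    unit₀.hom ≫ (𝟙 (𝟙_ C) : 𝟙_ C ⟶ ob (dualTensorAlg X) 0) := (Category.comp_id _).symm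

theorem ap_counitHom_tensor :
    ap (X := tensorAlg X) (Y := 𝟙_ (NGraded C)) (fun n => counitHom X n) 0 =
      (𝟙 (𝟙_ C) : ob (tensorAlg X) 0 ⟶ 𝟙_ C) ≫ unit₀.inv := (Category.id_comp _).symm

theorem ap_counitHom_dual :
    ap (X := dualTensorAlg X) (Y := 𝟙_ (NGraded C)) (fun n => counitHom X n) 0 =
      (𝟙 (𝟙_ C) : ob (dualTensorAlg X) 0 ⟶ 𝟙_ C) ≫ unit₀.inv := (Category.id_comp _).symm

variable [BraidedCategory C]

theorem mulc_of_desc {A B : NGraded C} (M : A ⊗ A ⟶ B) {i j k : ℕ} (h : i + j = k)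
    (f : ∀ i j : ℕ, i + j = k → ((A i : C) ⊗ (A j : C) ⟶ B k))
    (hM : ap M k = GradedObject.Monoidal.tensorObjDesc (C := C) (X₁ := A) (X₂ := A) f) :
    mulc M i j k = f i j h := by
  rw [mulc, inc_eq _ _ h, hM]
  exact GradedObject.Monoidal.ι_tensorObjDesc (C := C) (X₁ := A) (X₂ := A) f i j h

theorem comc_of_lift {A B : NGraded C} (D : A ⟶ B ⊗ B) {i j k : ℕ} (h : i + j = k)
    (f : ∀ i j : ℕ, i + j = k → ((A k : C) ⟶ (B i ⊗ B j : C)))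
    (hD : ap D k = tensorObjLift f) : comc D i j k = f i j h := by
  rw [comc, hD, tensorObjLift_eq_incSum]
  exact (incSum_prj _ h).trans (dif_pos h)

theorem mulc_mulT {i j k : ℕ} (h : i + j = k) : mulc (mulT X) i j k = (tadd X i j k h).hom :=
  mulc_of_desc (mulT X) h (fun n m h => (tadd X n m k h).hom) rfl

theorem comc_comulT {i j k : ℕ} (h : i + j = k) :
    comc (comulT X) i j k = (binom X k i : tpow X k ⟶ tpow X k) ≫ (tadd X i j k h).inv := by
  refine (comc_of_lift (comulT X) h (fun n m h => eqToHom (congrArg (tpow X) h.symm) ≫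
    multinomial X (twoBlocks n m) ≫ (tpowAdd X n m).inv) rfl).trans ?_
  subst h
  rw [multinomial_twoBlocks, tadd_rfl]
  exact Category.id_comp _

theorem mulc_mulTDual {i j k : ℕ} (h : i + j = k) : mulc (mulTDual X) i j k =
    (tadd X i j k h).hom ≫ (dualBinom X k i : tpow X k ⟶ tpow X k) := by
  refine (mulc_of_desc (mulTDual X) h (fun n m h => (tpowAdd X n m).hom ≫
    dualMultinomial X (twoBlocks n m) ≫ eqToHom (congrArg (tpow X) h)) rfl).trans ?_
  subst h
  rw [dualMultinomial_twoBlocks, tadd_rfl]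
  exact congrArg _ (Category.comp_id _)

theorem comc_comulTDual {i j k : ℕ} (h : i + j = k) :
    comc (comulTDual X) i j k = (tadd X i j k h).inv := by
  refine (comc_of_lift (comulTDual X) h (fun n m h => eqToHom (congrArg (tpow X) h.symm) ≫
    (tpowAdd X n m).inv) rfl).trans ?_
  subst h
  rw [tadd_rfl]
  exact Category.id_comp _

theorem mulc_of_ne {A B : NGraded C} (M : A ⊗ A ⟶ B) {i j k : ℕ} (h : i + j ≠ k) :
    mulc M i j k = 0 := by
  rw [mulc, inc_ne _ _ h, zero_comp]

theorem binom_zero_right (n : ℕ) : binom X n 0 = 1 := braidBinom_zero_right ..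

theorem binom_self (n : ℕ) : binom X n n = 1 := braidBinom_self ..

theorem dualBinom_zero_right (n : ℕ) : dualBinom X n 0 = 1 :=
  congrArg MulOpposite.unop (braidBinom_zero_right ..)

theorem dualBinom_self (n : ℕ) : dualBinom X n n = 1 :=
  congrArg MulOpposite.unop (braidBinom_self ..)

theorem mulT_assoc : mulT X ▷ tensorAlg X ≫ mulT X =
    (α_ _ _ _).hom ≫ tensorAlg X ◁ mulT X ≫ mulT X := by
  refine mul_assoc_of_components fun i j l a b k ha hb hk => ?_
  rw [mulc_mulT X ha, mulc_mulT X hb, mulc_mulT X hk, mulc_mulT X (by omega : i + b = k)]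
  exact tadd_assoc X i j l a b k ha hb hk _

theorem comulT_assoc : comulT X ≫ tensorAlg X ◁ comulT X =
    comulT X ≫ comulT X ▷ tensorAlg X ≫ (α_ _ _ _).hom := by
  refine comul_assoc_of_components fun i j l a b k ha hb hk => ?_
  have hk' : i + b = k := by omega
  rw [comc_comulT X ha, comc_comulT X hb, comc_comulT X hk, comc_comulT X hk']
  change ((binom X k a : tpow X k ⟶ tpow X k) ≫ (tadd X a l k hk).inv) ≫
    ((binom X a i : tpow X a ⟶ tpow X a) ≫ (tadd X i j a ha).inv) ▷ tpow X l ≫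
      (α_ (tpow X i) (tpow X j) (tpow X l)).hom =
    ((binom X k i : tpow X k ⟶ tpow X k) ≫ (tadd X i b k hk').inv) ≫
      tpow X i ◁ ((binom X b j : tpow X b ⟶ tpow X b) ≫ (tadd X j l b hb).inv)
  rw [comp_whiskerRight_assoc, MonoidalCategory.whiskerLeft_comp, Category.assoc, Category.assoc,
    reassoc_of% tadd_inv_whiskerRight X hk (binom X a i),
    reassoc_of% tadd_inv_whiskerLeft X hk' (binom X b j),
    tadd_assoc_inv X i j l a b k ha hb hk hk', ← Category.assoc, ← Category.assoc (binom X k i)]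
  exact congrArg (· ≫ _) (binom_assoc X ha hb hk hk')

theorem mulTDual_assoc : mulTDual X ▷ dualTensorAlg X ≫ mulTDual X =
    (α_ _ _ _).hom ≫ dualTensorAlg X ◁ mulTDual X ≫ mulTDual X := by
  refine mul_assoc_of_components fun i j l a b k ha hb hk => ?_
  have hk' : i + b = k := by omega
  rw [mulc_mulTDual X ha, mulc_mulTDual X hb, mulc_mulTDual X hk, mulc_mulTDual X hk']
  change ((tadd X i j a ha).hom ≫ (dualBinom X a i : tpow X a ⟶ tpow X a)) ▷ tpow X l ≫
      (tadd X a l k hk).hom ≫ (dualBinom X k a : tpow X k ⟶ tpow X k) =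
    (α_ (tpow X i) (tpow X j) (tpow X l)).hom ≫
      tpow X i ◁ ((tadd X j l b hb).hom ≫ (dualBinom X b j : tpow X b ⟶ tpow X b)) ≫
        (tadd X i b k hk').hom ≫ (dualBinom X k i : tpow X k ⟶ tpow X k)
  rw [comp_whiskerRight_assoc, MonoidalCategory.whiskerLeft_comp_assoc,
    reassoc_of% whiskerRight_tadd X a l k hk (dualBinom X a i),
    reassoc_of% whiskerLeft_tadd X i b k hk' (dualBinom X b j),
    reassoc_of% tadd_assoc X i j l a b k ha hb hk hk']
  exact congrArg (fun f : tpow X k ⟶ tpow X k => (α_ (tpow X i) (tpow X j) (tpow X l)).hom ≫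
    tpow X i ◁ (tadd X j l b hb).hom ≫ (tadd X i b k hk').hom ≫ f) (dualBinom_assoc X ha hb hk hk')

theorem comulTDual_assoc : comulTDual X ≫ dualTensorAlg X ◁ comulTDual X =
    comulTDual X ≫ comulTDual X ▷ dualTensorAlg X ≫ (α_ _ _ _).hom := by
  refine comul_assoc_of_components fun i j l a b k ha hb hk => ?_
  rw [comc_comulTDual X ha, comc_comulTDual X hb, comc_comulTDual X hk,
    comc_comulTDual X (by omega : i + b = k)]
  exact tadd_assoc_inv X i j l a b k ha hb hk _

theorem tensorμ_tadd_inv {a b c d p q k l N : ℕ} (hp : a + b = p) (hq : c + d = q)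
    (hk : a + c = k) (hl : b + d = l) (hN : p + q = N) (hN' : k + l = N) :
    ((-1 : ℤ) ^ (b * c)) • (((tadd X a b p hp).inv ⊗ₘ (tadd X c d q hq).inv) ≫
      tensorμ (tpow X a) (tpow X b) (tpow X c) (tpow X d) ≫
        ((tadd X a c k hk).hom ⊗ₘ (tadd X b d l hl).hom)) =
    (tadd X p q N hN).hom ≫ (blockSwap (gen X N) a b c : End (tpow X N)) ≫
      (tadd X k l N hN').inv := by
  have h := ((tadd X a b p hp).inv ⊗ₘ (tadd X c d q hq).inv) ≫=
    tensorμ_tadd X hp hq hk hl hN hN' =≫ (tadd X k l N hN').inv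
  simpa [Preadditive.zsmul_comp, Preadditive.comp_zsmul] using h

theorem mulT_comulT : mulT X ≫ comulT X =
    (comulT X ⊗ₘ comulT X) ≫ tensorμ _ _ _ _ ≫ (mulT X ⊗ₘ mulT X) := by
  refine mul_comul_of_components fun p q k l N hN hN' => ?_
  rw [mulc_mulT X hN, comc_comulT X hN']
  have h := congrArg (fun f : tpow X N ⟶ tpow X N => (tadd X p q N hN).hom ≫ f ≫
    (tadd X k l N hN').inv) (binom_add X hN k)
  refine h.trans ?_
  rw [Preadditive.sum_comp, Preadditive.comp_sum]
  refine Finset.sum_congr rfl fun x hx => ?_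
  rw [Preadditive.sum_comp, Preadditive.comp_sum]
  refine Finset.sum_congr rfl fun y hy => ?_
  rw [Finset.HasAntidiagonal.mem_antidiagonal] at hx hy
  by_cases hk : x.1 + y.1 = k
  · have hl : x.2 + y.2 = l := by omega
    rw [if_pos hk, comc_comulT X hx, comc_comulT X hy, mulc_mulT X hk, mulc_mulT X hl]
    have e := tensorHom_tadd X hN (binom X p x.1) (binom X q y.1)
    have m := ((binom X p x.1 : tpow X p ⟶ tpow X p) ⊗ₘ (binom X q y.1 : tpow X q ⟶ tpow X q)) ≫=
      tensorμ_tadd_inv X hx hy hk hl hN hN'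
    rw [Preadditive.comp_zsmul, reassoc_of% e] at m
    change (tadd X p q N hN).hom ≫ ((_ : tpow X N ⟶ tpow X N) ≫ (_ : tpow X N ⟶ tpow X N)) ≫
      (tadd X k l N hN').inv = ((-1 : ℤ) ^ (x.2 * y.1)) •
        ((((binom X p x.1 : tpow X p ⟶ tpow X p) ≫ (tadd X x.1 x.2 p hx).inv) ⊗ₘ
          ((binom X q y.1 : tpow X q ⟶ tpow X q) ≫ (tadd X y.1 y.2 q hy).inv)) ≫
        tensorμ (tpow X x.1) (tpow X x.2) (tpow X y.1) (tpow X y.2) ≫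
        ((tadd X x.1 y.1 k hk).hom ⊗ₘ (tadd X x.2 y.2 l hl).hom))
    rw [← MonoidalCategory.tensorHom_comp_tensorHom, Category.assoc, Category.assoc, m]
  · rw [if_neg hk, mulc_of_ne _ hk]
    simp
    rfl

theorem mulTDual_comulTDual : mulTDual X ≫ comulTDual X =
    (comulTDual X ⊗ₘ comulTDual X) ≫ tensorμ _ _ _ _ ≫ (mulTDual X ⊗ₘ mulTDual X) := by
  refine mul_comul_of_components fun p q k l N hN hN' => ?_
  rw [mulc_mulTDual X hN, comc_comulTDual X hN']
  have h := congrArg (fun f : tpow X N ⟶ tpow X N => ((tadd X p q N hN).hom ≫ f) ≫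
    (tadd X k l N hN').inv) (dualBinom_add X hN hN')
  refine h.trans ?_
  rw [Category.assoc, Preadditive.sum_comp, Preadditive.comp_sum]
  refine Finset.sum_congr rfl fun x hx => ?_
  rw [Preadditive.sum_comp, Preadditive.comp_sum]
  refine Finset.sum_congr rfl fun y hy => ?_
  rw [Finset.HasAntidiagonal.mem_antidiagonal] at hx hy
  by_cases hk : x.1 + y.1 = k
  · have hl : x.2 + y.2 = l := by omega
    rw [if_pos hk, comc_comulTDual X hx, comc_comulTDual X hy, mulc_mulTDual X hk,
      mulc_mulTDual X hl]
    have e := tensorHom_tadd' X hN' (dualBinom X k x.1) (dualBinom X l x.2)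
    rw [← Iso.eq_comp_inv, Category.assoc] at e
    have m := tensorμ_tadd_inv X hx hy hk hl hN hN'
    change (tadd X p q N hN).hom ≫ ((_ : tpow X N ⟶ tpow X N) ≫ (_ : tpow X N ⟶ tpow X N)) ≫
      (tadd X k l N hN').inv = ((-1 : ℤ) ^ (x.2 * y.1)) •
        (((tadd X x.1 x.2 p hx).inv ⊗ₘ (tadd X y.1 y.2 q hy).inv) ≫
        tensorμ (tpow X x.1) (tpow X x.2) (tpow X y.1) (tpow X y.2) ≫
        (((tadd X x.1 y.1 k hk).hom ≫ (dualBinom X k x.1 : tpow X k ⟶ tpow X k)) ⊗ₘ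
          ((tadd X x.2 y.2 l hl).hom ≫ (dualBinom X l x.2 : tpow X l ⟶ tpow X l))))
    rw [← MonoidalCategory.tensorHom_comp_tensorHom, ← Category.assoc (tensorμ _ _ _ _),
      ← Category.assoc (_ ⊗ₘ _), ← Preadditive.zsmul_comp, m, e]
    simp
  · rw [if_neg hk, mulc_of_ne _ hk]
    simp
    rfl

end TensorHopf
end BraidedTensor

/-! ### Units, antipodes and the Hopf algebra structures -/

namespace BraidedTensor

section TensorHopf

variable {C : Type u} [Category.{v} C] [Abelian C] [MonoidalCategory C] [MonoidalPreadditive C]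
  [BraidedCategory C] (X : C)

theorem end_one_comp {A B : C} (f : A ⟶ B) : (1 : End A) ≫ f = f := Category.id_comp f

theorem comp_end_one {A B : C} (f : A ⟶ B) : f ≫ (1 : End B) = f := Category.comp_id f

theorem mulT_zero_left (k : ℕ) : mulc (mulT X) 0 k k = (λ_ (tpow X k)).hom :=
  (mulc_mulT X (zero_add k)).trans (tadd_zero_left X k (zero_add k))

theorem mulT_zero_right (k : ℕ) : mulc (mulT X) k 0 k = (ρ_ (tpow X k)).hom :=
  (mulc_mulT X (add_zero k)).trans (tadd_zero X k)

theorem mulTDual_zero_left (k : ℕ) : mulc (mulTDual X) 0 k k = (λ_ (tpow X k)).hom := by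
  rw [mulc_mulTDual X (zero_add k), dualBinom_zero_right, tadd_zero_left]
  exact comp_end_one _

theorem mulTDual_zero_right (k : ℕ) : mulc (mulTDual X) k 0 k = (ρ_ (tpow X k)).hom := by
  rw [mulc_mulTDual X (add_zero k), dualBinom_self, tadd_zero]
  exact comp_end_one _

theorem tadd_zero_left_inv (k : ℕ) :
    (tadd X 0 k k (zero_add k)).inv = (λ_ (tpow X k)).inv :=
  (Iso.inv_eq_inv (tadd X 0 k k (zero_add k)) (λ_ (tpow X k))).2 (tadd_zero_left X k _)

theorem tadd_zero_inv (k : ℕ) : (tadd X k 0 k (add_zero k)).inv = (ρ_ (tpow X k)).inv :=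
  (Iso.inv_eq_inv (tadd X k 0 k (add_zero k)) (ρ_ (tpow X k))).2 (tadd_zero X k)

theorem comulT_zero_left (k : ℕ) : comc (comulT X) 0 k k = (λ_ (tpow X k)).inv := by
  rw [comc_comulT X (zero_add k), binom_zero_right, tadd_zero_left_inv]
  exact end_one_comp _

theorem comulT_zero_right (k : ℕ) : comc (comulT X) k 0 k = (ρ_ (tpow X k)).inv := by
  rw [comc_comulT X (add_zero k), binom_self, tadd_zero_inv]
  exact end_one_comp _

theorem comulTDual_zero_left (k : ℕ) : comc (comulTDual X) 0 k k = (λ_ (tpow X k)).inv :=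
  (comc_comulTDual X (zero_add k)).trans (tadd_zero_left_inv X k)

theorem comulTDual_zero_right (k : ℕ) : comc (comulTDual X) k 0 k = (ρ_ (tpow X k)).inv :=
  (comc_comulTDual X (add_zero k)).trans (tadd_zero_inv X k)

theorem antipodeEnd_zero : antipodeEnd X 0 = 1 := mul_one (1 : End (𝟙_ C))

theorem comulT_antipode_mulT {S : tensorAlg X ⟶ tensorAlg X}
    (hS : ∀ n, ap S n = antipodeEnd X n) {i j k : ℕ} (h : i + j = k) :
    comc (comulT X) i j k ≫ ap S i ▷ ob (tensorAlg X) j ≫ mulc (mulT X) i j k =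
      (actLeft X i j k h (antipodeEnd X i) * binom X k i : End (tpow X k)) := by
  rw [comc_comulT X h, mulc_mulT X h, hS]
  change ((binom X k i : tpow X k ⟶ tpow X k) ≫ (tadd X i j k h).inv) ≫
    (antipodeEnd X i : tpow X i ⟶ tpow X i) ▷ tpow X j ≫ (tadd X i j k h).hom = _
  rw [Category.assoc, reassoc_of% tadd_inv_whiskerRight X h (antipodeEnd X i), Iso.inv_hom_id,
    Category.comp_id]
  rfl

theorem comulT_antipode_mulT' {S : tensorAlg X ⟶ tensorAlg X}
    (hS : ∀ n, ap S n = antipodeEnd X n) {i j k : ℕ} (h : i + j = k) :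
    comc (comulT X) i j k ≫ ob (tensorAlg X) i ◁ ap S j ≫ mulc (mulT X) i j k =
      (actRight X i j k h (antipodeEnd X j) * binom X k i : End (tpow X k)) := by
  rw [comc_comulT X h, mulc_mulT X h, hS]
  change ((binom X k i : tpow X k ⟶ tpow X k) ≫ (tadd X i j k h).inv) ≫
    tpow X i ◁ (antipodeEnd X j : tpow X j ⟶ tpow X j) ≫ (tadd X i j k h).hom = _
  rw [Category.assoc, reassoc_of% tadd_inv_whiskerLeft X h (antipodeEnd X j), Iso.inv_hom_id,
    Category.comp_id]
  rfl

theorem comulTDual_antipode_mulTDual {S : dualTensorAlg X ⟶ dualTensorAlg X}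
    (hS : ∀ n, ap S n = antipodeEnd X n) {i j k : ℕ} (h : i + j = k) :
    comc (comulTDual X) i j k ≫ ap S i ▷ ob (dualTensorAlg X) j ≫ mulc (mulTDual X) i j k =
      (dualBinom X k i * actLeft X i j k h (antipodeEnd X i) : End (tpow X k)) := by
  rw [comc_comulTDual X h, mulc_mulTDual X h, hS]
  change (tadd X i j k h).inv ≫ (antipodeEnd X i : tpow X i ⟶ tpow X i) ▷ tpow X j ≫
      (tadd X i j k h).hom ≫ (dualBinom X k i : tpow X k ⟶ tpow X k) = _
  rw [reassoc_of% tadd_inv_whiskerRight X h (antipodeEnd X i), Iso.inv_hom_id_assoc]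
  rfl

theorem comulTDual_antipode_mulTDual' {S : dualTensorAlg X ⟶ dualTensorAlg X}
    (hS : ∀ n, ap S n = antipodeEnd X n) {i j k : ℕ} (h : i + j = k) :
    comc (comulTDual X) i j k ≫ ob (dualTensorAlg X) i ◁ ap S j ≫ mulc (mulTDual X) i j k =
      (dualBinom X k i * actRight X i j k h (antipodeEnd X j) : End (tpow X k)) := by
  rw [comc_comulTDual X h, mulc_mulTDual X h, hS]
  change (tadd X i j k h).inv ≫ tpow X i ◁ (antipodeEnd X j : tpow X j ⟶ tpow X j) ≫
      (tadd X i j k h).hom ≫ (dualBinom X k i : tpow X k ⟶ tpow X k) = _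
  rw [reassoc_of% tadd_inv_whiskerLeft X h (antipodeEnd X j), Iso.inv_hom_id_assoc]
  rfl

/-- The tensor Hopf algebra. -/
@[reducible] noncomputable def tensorHopf : HopfObj (tensorAlg X) :=
  hopfObjMk (M := mulT X) (D := comulT X) (U := fun n => unitHom X n)
    (E := fun n => counitHom X n) (S := fun n => antipodeComponent X n)
    (one_mul_of_components (ap_unitHom_tensor X) fun k => by
      rw [mulT_zero_left]
      exact (congrArg (· ≫ _) (id_whiskerRight _ _)).trans (Category.id_comp _))
    (mul_one_of_components (ap_unitHom_tensor X) fun k => by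
      rw [mulT_zero_right]
      exact (congrArg (· ≫ _) (MonoidalCategory.whiskerLeft_id _ _)).trans (Category.id_comp _))
    (mulT_assoc X)
    (counit_comul_of_components (ap_counitHom_tensor X) fun k => by
      rw [comulT_zero_left]
      exact (congrArg (_ ≫ ·) (id_whiskerRight _ _)).trans (Category.comp_id _))
    (comul_counit_of_components (ap_counitHom_tensor X) fun k => by
      rw [comulT_zero_right]
      exact (congrArg (_ ≫ ·) (MonoidalCategory.whiskerLeft_id _ _)).trans (Category.comp_id _))
    (comulT_assoc X)
    (mulT_comulT X)
    (one_comul_of_components (ap_unitHom_tensor X) (by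
      rw [comulT_zero_left]
      exact (Category.id_comp _).trans ((congrArg (_ ≫ ·) (id_tensorHom_id _ _)).trans
        (Category.comp_id _)).symm))
    (mul_counit_of_components (ap_counitHom_tensor X) (by
      rw [mulT_zero_left]
      exact (Category.comp_id _).trans ((congrArg (· ≫ _) (id_tensorHom_id _ _)).trans
        (Category.id_comp _)).symm))
    (unit_ext (unit₀.hom_inv_id))
    (antipode_left_of_components (ap_unitHom_tensor X) (ap_counitHom_tensor X)
      ((comulT_antipode_mulT X (antipodeComponent_eq X) (zero_add 0)).trans (by
        rw [antipodeEnd_zero, map_one, binom_self, one_mul]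
        exact (Category.id_comp _).symm))
      fun k => sum_antipode_left X k _ fun i j h =>
        comulT_antipode_mulT X (antipodeComponent_eq X) h)
    (antipode_right_of_components (ap_unitHom_tensor X) (ap_counitHom_tensor X)
      ((comulT_antipode_mulT' X (antipodeComponent_eq X) (zero_add 0)).trans (by
        rw [antipodeEnd_zero, map_one, binom_self, one_mul]
        exact (Category.id_comp _).symm))
      fun k => sum_antipode_right X k _ fun i j h =>
        comulT_antipode_mulT' X (antipodeComponent_eq X) h)

/-- The dual tensor Hopf algebra. -/
@[reducible] noncomputable def dualTensorHopf : HopfObj (dualTensorAlg X) :=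
  hopfObjMk (M := mulTDual X) (D := comulTDual X) (U := fun n => unitHom X n)
    (E := fun n => counitHom X n) (S := fun n => antipodeComponent X n)
    (one_mul_of_components (ap_unitHom_dual X) fun k => by
      rw [mulTDual_zero_left]
      exact (congrArg (· ≫ _) (id_whiskerRight _ _)).trans (Category.id_comp _))
    (mul_one_of_components (ap_unitHom_dual X) fun k => by
      rw [mulTDual_zero_right]
      exact (congrArg (· ≫ _) (MonoidalCategory.whiskerLeft_id _ _)).trans (Category.id_comp _))
    (mulTDual_assoc X)
    (counit_comul_of_components (ap_counitHom_dual X) fun k => by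
      rw [comulTDual_zero_left]
      exact (congrArg (_ ≫ ·) (id_whiskerRight _ _)).trans (Category.comp_id _))
    (comul_counit_of_components (ap_counitHom_dual X) fun k => by
      rw [comulTDual_zero_right]
      exact (congrArg (_ ≫ ·) (MonoidalCategory.whiskerLeft_id _ _)).trans (Category.comp_id _))
    (comulTDual_assoc X)
    (mulTDual_comulTDual X)
    (one_comul_of_components (ap_unitHom_dual X) (by
      rw [comulTDual_zero_left]
      exact (Category.id_comp _).trans ((congrArg (_ ≫ ·) (id_tensorHom_id _ _)).trans
        (Category.comp_id _)).symm))
    (mul_counit_of_components (ap_counitHom_dual X) (by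
      rw [mulTDual_zero_left]
      exact (Category.comp_id _).trans ((congrArg (· ≫ _) (id_tensorHom_id _ _)).trans
        (Category.id_comp _)).symm))
    (unit_ext (unit₀.hom_inv_id))
    (antipode_left_of_components (ap_unitHom_dual X) (ap_counitHom_dual X)
      ((comulTDual_antipode_mulTDual X (antipodeComponent_eq X) (zero_add 0)).trans (by
        rw [antipodeEnd_zero, map_one, dualBinom_self, one_mul]
        exact (Category.id_comp _).symm))
      fun k => sum_dual_antipode_left X k _ fun i j h =>
        comulTDual_antipode_mulTDual X (antipodeComponent_eq X) h)
    (antipode_right_of_components (ap_unitHom_dual X) (ap_counitHom_dual X)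
      ((comulTDual_antipode_mulTDual' X (antipodeComponent_eq X) (zero_add 0)).trans (by
        rw [antipodeEnd_zero, map_one, dualBinom_self, one_mul]
        exact (Category.id_comp _).symm))
      fun k => sum_dual_antipode_right X k _ fun i j h =>
        comulTDual_antipode_mulTDual' X (antipodeComponent_eq X) h)

theorem isTensorHopf : IsTensorHopf X (tensorHopf X) := ⟨rfl, rfl, rfl, rfl, rfl⟩

theorem isDualTensorHopf : IsDualTensorHopf X (dualTensorHopf X) := ⟨rfl, rfl, rfl, rfl, rfl⟩

end TensorHopf
end BraidedTensor

/-! ### Hopf algebra structures on images -/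

namespace BraidedTensor

section HopfImage

variable {D : Type u} [Category.{v} D] [MonoidalCategory D] [BraidedCategory D]

theorem hopfObj_ext {W : D} (h h' : HopfObj W) (mul : h.mul = h'.mul) (one : h.one = h'.one)
    (comul : h.comul = h'.comul) (counit : h.counit = h'.counit)
    (antipode : h.antipode = h'.antipode) : h = h' := by
  obtain @⟨@⟨⟨⟩, ⟨⟩⟩, _⟩ := h
  obtain @⟨@⟨⟨⟩, ⟨⟩⟩, _⟩ := h'
  cases mul
  cases one
  cases comul
  cases counit
  cases antipode
  rfl

theorem IsHopfHom.structure_eq {A W : D} [HopfObj A] [HopfObj W] {p : A ⟶ W} (hp : IsHopfHom p) :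
    (p ⊗ₘ p) ≫ μ[W] = μ[A] ≫ p ∧ η[W] = η[A] ≫ p ∧ p ≫ Δ[W] = Δ[A] ≫ (p ⊗ₘ p) ∧
      p ≫ ε[W] = ε[A] ∧
        p ≫ HopfObj.antipode (X := W) = HopfObj.antipode (X := A) ≫ p :=
  ⟨hp.isBimonHom.mul_hom.symm, hp.isBimonHom.one_hom.symm, hp.isBimonHom.hom_comul,
    hp.isBimonHom.hom_counit, hp.antipode_comp.symm⟩

/-- There is at most one Hopf algebra structure on the target of an epimorphism `p` that makes `p` a
morphism of Hopf algebras, provided that `p ⊗ p` is an epimorphism, too. -/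
theorem hopfObj_eq_of_epi {A W : D} [HopfObj A] (p : A ⟶ W) [Epi p] [Epi (p ⊗ₘ p)]
    (h h' : HopfObj W) (hp : @IsHopfHom D _ _ _ A W _ h p) (hp' : @IsHopfHom D _ _ _ A W _ h' p) :
    h = h' := by
  obtain ⟨m, o, c, e, a⟩ := @IsHopfHom.structure_eq _ _ _ _ _ _ _ h _ hp
  obtain ⟨m', o', c', e', a'⟩ := @IsHopfHom.structure_eq _ _ _ _ _ _ _ h' _ hp'
  exact hopfObj_ext h h' ((cancel_epi (p ⊗ₘ p)).1 (m.trans m'.symm)) (o.trans o'.symm)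
    ((cancel_epi p).1 (c.trans c'.symm)) ((cancel_epi p).1 (e.trans e'.symm))
    ((cancel_epi p).1 (a.trans a'.symm))

/-- A subobject that is closed under unit and multiplication is an algebra. -/
@[reducible] def monObjOfMono {W B : D} [MonObj B] (i : W ⟶ B) [Mono i] (U : 𝟙_ D ⟶ W)
    (hU : U ≫ i = η[B]) (M : W ⊗ W ⟶ W) (hM : M ≫ i = (i ⊗ₘ i) ≫ μ[B]) : MonObj W where
  one := U
  mul := M
  one_mul := by
    rw [← cancel_mono i, Category.assoc, hM, ← leftUnitor_naturality, ← MonObj.one_mul B, ← hU]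
    simp only [← tensorHom_id, ← id_tensorHom, MonoidalCategory.tensorHom_comp_tensorHom_assoc,
      Category.id_comp, Category.comp_id]
  mul_one := by
    rw [← cancel_mono i, Category.assoc, hM, ← rightUnitor_naturality, ← MonObj.mul_one B, ← hU]
    simp only [← tensorHom_id, ← id_tensorHom, MonoidalCategory.tensorHom_comp_tensorHom_assoc,
      Category.id_comp, Category.comp_id]
  mul_assoc := by
    have h := ((i ⊗ₘ i) ⊗ₘ i) ≫= MonObj.mul_assoc B
    rw [associator_naturality_assoc] at h
    rw [← cancel_mono i]
    simp only [← tensorHom_id, ← id_tensorHom, MonoidalCategory.tensorHom_comp_tensorHom_assoc,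
      Category.id_comp, Category.comp_id, Category.assoc, hM] at h ⊢
    exact h

/-- A quotient to which counit and comultiplication descend is a coalgebra. -/
@[reducible] def comonObjOfEpi {A W : D} [ComonObj A] (p : A ⟶ W) [Epi p] (E : W ⟶ 𝟙_ D)
    (hE : p ≫ E = ε[A]) (Δ' : W ⟶ W ⊗ W) (hD : p ≫ Δ' = Δ[A] ≫ (p ⊗ₘ p)) : ComonObj W where
  counit := E
  comul := Δ'
  counit_comul := by
    rw [← cancel_epi p, reassoc_of% hD, leftUnitor_inv_naturality, ← ComonObj.counit_comul A, ← hE]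
    simp only [← tensorHom_id, ← id_tensorHom, MonoidalCategory.tensorHom_comp_tensorHom,
      Category.id_comp, Category.comp_id, Category.assoc]
  comul_counit := by
    rw [← cancel_epi p, reassoc_of% hD, rightUnitor_inv_naturality, ← ComonObj.comul_counit A, ← hE]
    simp only [← tensorHom_id, ← id_tensorHom, MonoidalCategory.tensorHom_comp_tensorHom,
      Category.id_comp, Category.comp_id, Category.assoc]
  comul_assoc := by
    have h := ComonObj.comul_assoc A =≫ (p ⊗ₘ (p ⊗ₘ p))
    simp only [Category.assoc] at h
    rw [← associator_naturality] at h
    rw [← cancel_epi p, reassoc_of% hD, reassoc_of% hD]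
    simp only [← tensorHom_id, ← id_tensorHom, MonoidalCategory.tensorHom_comp_tensorHom,
      MonoidalCategory.tensorHom_comp_tensorHom_assoc,
      Category.id_comp, Category.comp_id, Category.assoc, hD] at h ⊢
    exact h

/-- If the structure morphisms restrict to the image `W` of a morphism of Hopf algebras, they make
`W` a Hopf algebra: the laws of an algebra hold because `W` is a subobject of `B`, those of a
coalgebra because `W` is a quotient of `A`. -/
theorem exists_hopfObj_image {A W B : D} [HopfObj A] [HopfObj B] (p : A ⟶ W) (i : W ⟶ B)
    (hf : IsBimonHom (p ≫ i)) [Epi p] [Mono i] [Mono (i ⊗ₘ i)]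
    (M : W ⊗ W ⟶ W) (hM : (p ⊗ₘ p) ≫ M = μ[A] ≫ p) (hM' : M ≫ i = (i ⊗ₘ i) ≫ μ[B])
    (Δ' : W ⟶ W ⊗ W) (hD : p ≫ Δ' = Δ[A] ≫ (p ⊗ₘ p)) (hD' : Δ' ≫ (i ⊗ₘ i) = i ≫ Δ[B])
    (S : W ⟶ W) (hS : p ≫ S = HopfObj.antipode (X := A) ≫ p)
    (hS' : S ≫ i = i ≫ HopfObj.antipode (X := B)) :
    ∃ _ : HopfObj W, IsHopfHom p ∧ IsHopfHom i := by
  have hU : (η[A] ≫ p) ≫ i = η[B] := by rw [Category.assoc]; exact IsMonHom.one_hom (p ≫ i)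
  have hE : p ≫ i ≫ ε[B] = ε[A] := by
    rw [← Category.assoc]; exact IsComonHom.hom_counit (p ≫ i)
  have antipode_aux (T : W ⊗ W ⟶ W ⊗ W) (T' : B ⊗ B ⟶ B ⊗ B) (h : T ≫ (i ⊗ₘ i) = (i ⊗ₘ i) ≫ T')
      (h' : Δ[B] ≫ T' ≫ μ[B] = ε[B] ≫ η[B]) : Δ' ≫ T ≫ M = (i ≫ ε[B]) ≫ η[A] ≫ p := by
    rw [← cancel_mono i]
    simp only [Category.assoc] at hU ⊢
    rw [hM', reassoc_of% h, reassoc_of% hD', h', hU]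
  let hW : HopfObj W :=
    { monObjOfMono i (η[A] ≫ p) hU M hM', comonObjOfEpi p (i ≫ ε[B]) hE Δ' hD with
      mul_comul := by
        change M ≫ Δ' = (Δ' ⊗ₘ Δ') ≫ tensorμ W W W W ≫ (M ⊗ₘ M)
        rw [← cancel_mono (i ⊗ₘ i)]
        simp only [Category.assoc, MonoidalCategory.tensorHom_comp_tensorHom, hM', hD']
        rw [reassoc_of% hM', BimonObj.mul_comul, ← MonoidalCategory.tensorHom_comp_tensorHom,
          ← tensorμ_natural_assoc, MonoidalCategory.tensorHom_comp_tensorHom_assoc,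
          MonoidalCategory.tensorHom_comp_tensorHom_assoc, hD']
      one_comul := by
        change (η[A] ≫ p) ≫ Δ' = (λ_ (𝟙_ D)).inv ≫ ((η[A] ≫ p) ⊗ₘ (η[A] ≫ p))
        rw [← cancel_mono (i ⊗ₘ i)]
        simp only [Category.assoc, MonoidalCategory.tensorHom_comp_tensorHom, hD'] at hU ⊢
        rw [hU, reassoc_of% hU]
        exact BimonObj.one_comul B
      mul_counit := by
        change M ≫ i ≫ ε[B] = ((i ≫ ε[B]) ⊗ₘ (i ≫ ε[B])) ≫ (λ_ (𝟙_ D)).hom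
        rw [reassoc_of% hM', ← MonoidalCategory.tensorHom_comp_tensorHom, Category.assoc,
          BimonObj.mul_counit]
        rfl
      one_counit := (Category.assoc _ _ _).trans ((congrArg _ hE).trans (BimonObj.one_counit A))
      antipode := S
      antipode_left := antipode_aux _ (HopfObj.antipode ▷ B) (by
        simp only [← tensorHom_id, MonoidalCategory.tensorHom_comp_tensorHom, hS',
          Category.id_comp, Category.comp_id]) (HopfObj.antipode_left B)
      antipode_right := antipode_aux _ (B ◁ HopfObj.antipode) (by
        simp only [← id_tensorHom, MonoidalCategory.tensorHom_comp_tensorHom, hS',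
          Category.id_comp, Category.comp_id]) (HopfObj.antipode_right B) }
  exact ⟨hW, ⟨{ one_hom := rfl, mul_hom := hM.symm, hom_counit := hE, hom_comul := hD }, hS.symm⟩,
    ⟨{ one_hom := hU, mul_hom := hM', hom_counit := rfl, hom_comul := hD'.symm }, hS'⟩⟩

end HopfImage
end BraidedTensor

/-! ### Epimorphisms and monomorphisms of graded objects -/

namespace BraidedTensor

section EpiMono

variable {C : Type u} [Category.{v} C] [Abelian C] [MonoidalCategory C] [MonoidalPreadditive C]

theorem epi_of_ap {X Y : NGraded C} (p : X ⟶ Y) (hp : ∀ k, Epi (ap p k)) : Epi p :=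
  ⟨fun _ _ h => hom_ext fun k => (cancel_epi (ap p k)).1 (congrArg (fun f => ap f k) h)⟩

theorem mono_of_ap {X Y : NGraded C} (i : X ⟶ Y) (hi : ∀ k, Mono (ap i k)) : Mono i :=
  ⟨fun _ _ h => hom_ext fun k => (cancel_mono (ap i k)).1 (congrArg (fun f => ap f k) h)⟩

/-- In each degree an epimorphism of an abelian category is orthogonal to a monomorphism. -/
theorem exists_lift {A W' W B : NGraded C} (p : A ⟶ W') (i : W ⟶ B) (hp : ∀ k, Epi (ap p k))
    (hi : ∀ k, Mono (ap i k)) (f : A ⟶ W) (g : W' ⟶ B) (h : f ≫ i = p ≫ g) :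
    ∃ l : W' ⟶ W, p ≫ l = f ∧ l ≫ i = g := by
  have key (k : ℕ) : ∃ l : ob W' k ⟶ ob W k, ap p k ≫ l = ap f k ∧ l ≫ ap i k = ap g k := by
    have := strongEpi_of_epi (ap p k)
    have sq : CommSq (ap f k) (ap p k) (ap i k) (ap g k) := ⟨congrArg (fun f => ap f k) h⟩
    exact ⟨sq.lift, sq.fac_left, sq.fac_right⟩
  choose l hl using key
  exact ⟨l, hom_ext fun k => (hl k).1, hom_ext fun k => (hl k).2⟩

variable [TensorFactor C]

theorem epi_ap_tensorHom {X Y X' Y' : NGraded C} (p : X ⟶ X') (q : Y ⟶ Y')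
    (hp : ∀ k, Epi (ap p k)) (hq : ∀ k, Epi (ap q k)) (k : ℕ) : Epi (ap (p ⊗ₘ q) k) := by
  refine ⟨fun f g h => tensor_hom_ext fun i j _ => ?_⟩
  have := TensorFactor.epi_tensorHom (ap p i) (ap q j)
  rw [← cancel_epi (ap p i ⊗ₘ ap q j), ← reassoc_of% @inc_tensorHom,
    ← reassoc_of% @inc_tensorHom, h]

theorem mono_ap_tensorHom {X Y X' Y' : NGraded C} (p : X ⟶ X') (q : Y ⟶ Y')
    (hp : ∀ k, Mono (ap p k)) (hq : ∀ k, Mono (ap q k)) (k : ℕ) : Mono (ap (p ⊗ₘ q) k) := by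
  refine ⟨fun f g h => tensor_hom_ext' fun i j hij => ?_⟩
  have := TensorFactor.mono_tensorHom (ap p i) (ap q j)
  rw [← cancel_mono (ap p i ⊗ₘ ap q j), Category.assoc, Category.assoc, ← tensorHom_prj p q hij,
    reassoc_of% h]

end EpiMono

/-! ### The antisymmetrizer -/

section Antisymmetrizer

variable {C : Type u} [Category.{v} C] [Abelian C] [MonoidalCategory C] [MonoidalPreadditive C]
  [BraidedCategory C] (X : C)

/-- The braided factorial as an endomorphism of `X ^ ⊗ n`. -/
noncomputable def factEnd (n : ℕ) : End (tpow X n) := braidFact (gen X n) 0 n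

theorem actRight_factEnd {n m k : ℕ} (h : n + m = k) :
    actRight X n m k h (factEnd X m) = braidFact (gen X k) n m :=
  map_braidFact _ fun i hi => by simpa using actRight_gen X h (by omega)

theorem actLeft_factEnd {n m k : ℕ} (h : n + m = k) :
    actLeft X n m k h (factEnd X n) = braidFact (gen X k) 0 n :=
  map_braidFact _ fun i hi => by simpa using actLeft_gen X h (by omega)

theorem unop_braidFact_gen {n m k : ℕ} (h : n + m = k) :
    (braidFact (fun a => MulOpposite.op (gen X k a)) n m).unop =
      actRight X n m k h (factEnd X m) := by
  rw [factEnd, ← unop_braidFact (isBraidSeq_gen X m)]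
  exact congrArg MulOpposite.unop (map_braidFact (actRight X n m k h).op
    (φ := fun a => MulOpposite.op (gen X m a)) (ψ := fun a => MulOpposite.op (gen X k a))
    fun i hi => congrArg MulOpposite.op (by simpa using actRight_gen X h (by omega))).symm

theorem unop_braidFact_gen' {n m k : ℕ} (h : n + m = k) :
    (braidFact (fun a => MulOpposite.op (gen X k a)) 0 n).unop =
      actLeft X n m k h (factEnd X n) := by
  rw [factEnd, ← unop_braidFact (isBraidSeq_gen X n)]
  exact congrArg MulOpposite.unop (map_braidFact (actLeft X n m k h).op
    (φ := fun a => MulOpposite.op (gen X n a)) (ψ := fun a => MulOpposite.op (gen X k a))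
    fun i hi => congrArg MulOpposite.op (by simpa using actLeft_gen X h (by omega))).symm

/-- The identity behind the compatibility of the antisymmetrizer with comultiplication. -/
theorem factEnd_eq_mul_binom {i j k : ℕ} (h : i + j = k) :
    actLeft X i j k h (factEnd X i) * actRight X i j k h (factEnd X j) * binom X k i =
      factEnd X k := by
  rw [actLeft_factEnd, actRight_factEnd]
  subst h
  simpa only [binom, factEnd, zero_add] using
    (isBraidSeq_gen X (i + j)).braidFact_mul_braidBinom 0 i j

/-- The identity behind the compatibility of the antisymmetrizer with multiplication. -/
theorem dualBinom_mul_factEnd {i j k : ℕ} (h : i + j = k) :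
    dualBinom X k i * (actRight X i j k h (factEnd X j) * actLeft X i j k h (factEnd X i)) =
      factEnd X k := by
  have := congrArg MulOpposite.unop ((isBraidSeq_gen X k).op.braidFact_mul_braidBinom 0 i j)
  rw [h, unop_braidFact (isBraidSeq_gen X k)] at this
  rw [← unop_braidFact_gen, ← unop_braidFact_gen']
  simpa only [dualBinom, factEnd, MulOpposite.unop_mul, zero_add] using this

theorem ap_antisymmetrizer (n : ℕ) :
    ap (antisymmetrizer X) n = (factEnd X n : tpow X n ⟶ tpow X n) :=
  braidedFactorial_eq X n

theorem mulT_antisymmetrizer : mulT X ≫ antisymmetrizer X =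
    (antisymmetrizer X ⊗ₘ antisymmetrizer X) ≫ mulTDual X := by
  refine hom_ext fun k => tensor_hom_ext fun i j h => ?_
  rw [ap_comp, ap_comp, reassoc_of% @inc_tensorHom]
  refine (Category.assoc _ _ _).symm.trans ?_
  change mulc (mulT X) i j k ≫ _ = _ ≫ mulc (mulTDual X) i j k
  rw [mulc_mulT X h, mulc_mulTDual X h, ap_antisymmetrizer, ap_antisymmetrizer, ap_antisymmetrizer]
  change (tadd X i j k h).hom ≫ (factEnd X k : tpow X k ⟶ tpow X k) =
    ((factEnd X i : tpow X i ⟶ tpow X i) ⊗ₘ (factEnd X j : tpow X j ⟶ tpow X j)) ≫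
      (tadd X i j k h).hom ≫ (dualBinom X k i : tpow X k ⟶ tpow X k)
  rw [reassoc_of% tensorHom_tadd' X h (factEnd X i) (factEnd X j)]
  exact congrArg _ (dualBinom_mul_factEnd X h).symm

theorem comulT_antisymmetrizer : comulT X ≫ (antisymmetrizer X ⊗ₘ antisymmetrizer X) =
    antisymmetrizer X ≫ comulTDual X := by
  refine hom_ext fun k => tensor_hom_ext' fun i j h => ?_
  rw [ap_comp, ap_comp, Category.assoc, Category.assoc, tensorHom_prj _ _ h]
  refine (Category.assoc _ _ _).symm.trans ?_
  change comc (comulT X) i j k ≫ _ = _ ≫ comc (comulTDual X) i j k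
  rw [comc_comulT X h, comc_comulTDual X h, ap_antisymmetrizer, ap_antisymmetrizer,
    ap_antisymmetrizer]
  have h₃ := tensorHom_tadd X h (factEnd X i) (factEnd X j)
  rw [← Iso.eq_comp_inv, Category.assoc, ← Iso.inv_comp_eq] at h₃
  change ((binom X k i : tpow X k ⟶ tpow X k) ≫ (tadd X i j k h).inv) ≫
    ((factEnd X i : tpow X i ⟶ tpow X i) ⊗ₘ (factEnd X j : tpow X j ⟶ tpow X j)) =
      (factEnd X k : tpow X k ⟶ tpow X k) ≫ (tadd X i j k h).inv
  rw [Category.assoc, h₃]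
  exact (Category.assoc _ _ _).symm.trans (congrArg (· ≫ _) (factEnd_eq_mul_binom X h))

theorem unit_antisymmetrizer :
    (fun n => unitHom X n : 𝟙_ (NGraded C) ⟶ tensorAlg X) ≫ antisymmetrizer X =
      (fun n => unitHom X n : 𝟙_ (NGraded C) ⟶ dualTensorAlg X) :=
  unit_ext ((congrArg (unitHom X 0 ≫ ·) (braidedFactorial_eq X 0)).trans (Category.comp_id _))

theorem counit_antisymmetrizer :
    antisymmetrizer X ≫ (fun n => counitHom X n : dualTensorAlg X ⟶ 𝟙_ (NGraded C)) =
      (fun n => counitHom X n : tensorAlg X ⟶ 𝟙_ (NGraded C)) :=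
  counit_ext ((congrArg (· ≫ counitHom X 0) (braidedFactorial_eq X 0)).trans (Category.id_comp _))

theorem isHopfHom_antisymmetrizer :
    @IsHopfHom _ _ _ _ _ _ (tensorHopf X) (dualTensorHopf X) (antisymmetrizer X) := by
  let _ := tensorHopf X
  let _ := dualTensorHopf X
  have : IsBimonHom (antisymmetrizer X) :=
    { one_hom := unit_antisymmetrizer X
      mul_hom := mulT_antisymmetrizer X
      hom_counit := counit_antisymmetrizer X
      hom_comul := (comulT_antisymmetrizer X).symm }
  exact ⟨this, (HopfObj.hom_antipode (antisymmetrizer X)).symm⟩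

theorem coimA_imA : coimA X ≫ imA X = antisymmetrizer X :=
  hom_ext fun k => Abelian.image.fac (braidedFactorial X k)

theorem epi_ap_coimA (k : ℕ) : Epi (ap (coimA X) k) :=
  inferInstanceAs (Epi (Abelian.factorThruImage (braidedFactorial X k)))

theorem mono_ap_imA (k : ℕ) : Mono (ap (imA X) k) :=
  inferInstanceAs (Mono (Abelian.image.ι (braidedFactorial X k)))

end Antisymmetrizer
end BraidedTensor

theorem mainTheorem6 {C : Type u} [Category.{v} C] [Abelian C] [MonoidalCategory C]
    [MonoidalPreadditive C] [BraidedCategory C] [BraidedTensor.TensorFactor C] (X : C) :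
    ∃ (hT : HopfObj (BraidedTensor.tensorAlg X)) (hD : HopfObj (BraidedTensor.dualTensorAlg X)),
      BraidedTensor.IsTensorHopf X hT ∧ BraidedTensor.IsDualTensorHopf X hD ∧
      BraidedTensor.IsHopfHom (BraidedTensor.antisymmetrizer X) ∧
      Epi (BraidedTensor.coimA X) ∧ Mono (BraidedTensor.imA X) ∧
      BraidedTensor.coimA X ≫ BraidedTensor.imA X = BraidedTensor.antisymmetrizer X ∧
      ∃! hW : HopfObj (BraidedTensor.antisymTensorAlg X),
        BraidedTensor.IsHopfHom (BraidedTensor.coimA X) ∧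
          BraidedTensor.IsHopfHom (BraidedTensor.imA X) := by
  open BraidedTensor in
  let hT := tensorHopf X
  let hD := dualTensorHopf X
  have hA : IsHopfHom (antisymmetrizer X) := isHopfHom_antisymmetrizer X
  have hp := epi_ap_coimA X
  have hi := mono_ap_imA X
  have hpp := epi_ap_tensorHom (coimA X) (coimA X) hp hp
  have hii := mono_ap_tensorHom (imA X) (imA X) hi hi
  have := epi_of_ap _ hp
  have := mono_of_ap _ hi
  have := epi_of_ap _ hpp
  have := mono_of_ap _ hii
  refine ⟨hT, hD, isTensorHopf X, isDualTensorHopf X, hA, inferInstance, inferInstance,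
    coimA_imA X, ?_⟩
  have hf : IsBimonHom (coimA X ≫ imA X) := by rw [coimA_imA]; exact hA.isBimonHom
  -- The structure morphisms of the image are diagonal fillers of squares.
  obtain ⟨M, hM, hM'⟩ := exists_lift (coimA X ⊗ₘ coimA X) (imA X) hpp hi
    (μ[tensorAlg X] ≫ coimA X) ((imA X ⊗ₘ imA X) ≫ μ[dualTensorAlg X]) (by
      rw [Category.assoc, IsMonHom.mul_hom (coimA X ≫ imA X),
        MonoidalCategory.tensorHom_comp_tensorHom_assoc])
  obtain ⟨Δ', hD₁, hD₂⟩ := exists_lift (coimA X) (imA X ⊗ₘ imA X) hp hii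
    (Δ[tensorAlg X] ≫ (coimA X ⊗ₘ coimA X)) (imA X ≫ Δ[dualTensorAlg X]) (by
      rw [Category.assoc, MonoidalCategory.tensorHom_comp_tensorHom,
        ← IsComonHom.hom_comul (coimA X ≫ imA X), Category.assoc])
  obtain ⟨S, hS, hS'⟩ := exists_lift (coimA X) (imA X) hp hi
    (HopfObj.antipode (X := tensorAlg X) ≫ coimA X)
    (imA X ≫ HopfObj.antipode (X := dualTensorAlg X)) (by
      rw [Category.assoc, coimA_imA, hA.antipode_comp, ← coimA_imA, Category.assoc])
  obtain ⟨hW, h₁, h₂⟩ := exists_hopfObj_image (coimA X) (imA X) hf M hM hM' Δ' hD₁ hD₂ S hS hS'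
  exact ⟨hW, ⟨h₁, h₂⟩, fun hW' h => hopfObj_eq_of_epi (coimA X) hW' hW h.1 h₁⟩
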